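/- Let $Y$ be a smooth complete complex toric variety of dimension $n$, with character lattice $M_Y$ and prime torus-invariant divisors $\rho_1,\dots,\rho_r$ (primitive ray generators $u_1,\dots,u_r$). Let $D_j=\sum_\upsilon a_{j\upsilon}\rho_\upsilon$, $j=1,\dots,c$, be effective torus-invariant divisors such that $\mathcal V=\bigoplus_j\mathcal O_Y(D_j)$ is globally generated, i.e. for each $j$ the global sections of $\mathcal O_Y(D_j)$ have no common zero. Let $p_i$ be a $\mathbb Z$-basis of $H^2(Y;\mathbb Z)=\operatorname{coker}(\operatorname{div}_Y\colon M_Y\to\mathbb Z^r)$, write $[\rho_\upsilon]=\sum_i m_{i\upsilon}p_i$ and $[D_j]=\sum_i d_{ij}p_i$, let $t_i\in\mathbb C$ and $Q_i=e^{t_i}$. *The Landau-Ginzburg model and its dual.* Let $X=\mathrm{Tot}(\mathcal V^\vee)$, with character lattice $M_X=M_Y\oplus\bigoplus_j\mathbb Z\sigma_j$. Its ray generators in $N_X=\mathrm{Hom}(M_X,\mathbb Z)=N_Y\oplus\mathbb Z^c$ are $\xi'_\upsilon=(u_\upsilon,(a_{j\upsilon})_j)$ and $\xi'_j=(0,e_j)$,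 and these are the rows of $\operatorname{div}_X$. Let $\mathrm w=(\mathrm w_j)_j$ be a generic global section of $\mathcal V$: every character $\mu$ that is a section of $\mathcal O_Y(D_j)$ occurs in $\mathrm w_j$ with nonzero coefficient. Let $W=\sum_j \mathrm w_j\sigma_j$ be the function it defines on $X$, let $\Xi\subset M_X$ be its set of terms, let $\mathrm{mon}\colon N_X\to\mathbb Z^{\Xi}$ be the pairing with the terms, and let $L\in\operatorname{coker}(\mathrm{mon})_{\mathbb C/\mathbb Z}$ be the class of the coefficients of $W$ under $\exp(2\pi i\,\cdot)\colon\mathbb C/\mathbb Z\cong\mathbb C^\times$. Let $K=-\tfrac{i}{2\pi}\sum_i t_ip_i\in H^2(Y;\mathbb C/\mathbb Z)\cong\operatorname{coker}(\operatorname{div}_X)_{\mathbb C/\mathbb Z}$. The dual $(X',W',K')$ is obtained by exchanging $(\operatorname{div}_X,K)$ and $(\mathrm{mon},L)$. Thus $K'=L$; $X'$ is the toric variety of the inward normal fan of $\{\xi\in (N_X)_{\mathbb R}:\mathrm{mon}(\xi)+\alpha\ge0\}$, where $\alpha$ is a lift of $\operatorname{Im}L$ and this set must have nonempty interior; its character lattice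 is $M_{X'}=N_X$. And $W'=\sum_k\exp(2\pi i\kappa_k)\,\xi'_k$ with terms $\Xi'=\{\xi'_\upsilon\}\cup\{\xi'_j\}$, for a lift $\kappa$ of $K$. Let $M_{X'}^+\subset M_{X'}$ be the semigroup of the characters that are regular on $X'$. *Givental's mirror.* Let $H'_Q\subset\mathbb C^{r+c}$ be the closed subscheme with coordinates $(x,y)$ cut out by the Laurent monomial equations $\prod_\upsilon x_\upsilon^{m_{i\upsilon}}=Q_i\prod_j y_j^{d_{ij}}$ (all $i$), i.e. the closure in $\mathbb C^{r+c}$ of the subscheme they define in $(\mathbb C^\times)^{r+c}$. Let $F=\sum_\upsilon x_\upsilon+\sum_j y_j$. **Theorem.** (1) For every generic $\mathrm w$ the dual variety $X'$ exists, and $M_{X'}^+$ is generated as a semigroup (with $0$) by the terms $\xi'\in\Xi'$ of $W'$. (2) Let $\hat t\in\mathbb C^r$ satisfy $\sum_\upsilon m_{i\upsilon}\hat t_\upsilon=t_i$ for all $i$. Then $\kappa=(-i\hat t/2\pi,0)$ is a lift of $K$; with this lift, $W'=\sum_\upsilon e^{\hat t_\upsilon}\xi'_\upsilon+\sum_j\xi'_j$,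 and $x_\upsilon\mapsto e^{\hat t_\upsilon}\xi'_\upsilon$, $y_j\mapsto\xi'_j$ defines an isomorphism $\operatorname{Spec}\mathbb C[M_{X'}^+]\to H'_Q$, compatible with the inclusion $H'_Q\subset\mathbb C^{r+c}$, under which $F$ pulls back to $W'$. (3) The composition $X'\to\operatorname{Spec}\mathbb C[M_{X'}^+]\to\mathbb C^{r+c}$ has image $H'_Q$ and pulls $F$ back to $W'$. If $L=0$, it is an isomorphism $X'\cong H'_Q$. In particular this holds for the section $\mathrm w_{GHV}$ of $\mathcal V$ all of whose coefficients are $1$, for which $K'=L=0$: the mirror $(H'_Q,F)$ is the dual Landau-Ginzburg model of $(X,W_{GHV})$. (4) The points of $H'_Q$ with all coordinates nonzero are exactly the points $x_\upsilon=e^{-Z_\upsilon}$, $y_j=e^{-Y_j}$ with $\sum_\upsilon m_{i\upsilon}Z_\upsilon-\sum_jd_{ij}Y_j=-t_i$ for all $i$. This is the mirror of Hori and Vafa, whose superpotential $\sum_\upsilon e^{-Z_\upsilon}+\sum_je^{-Y_j}$ is $F$. -/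

import Mathlib

open CategoryTheory CategoryTheory.Limits AlgebraicGeometry
open scoped TensorProduct

noncomputable section

namespace ToricMirror

/-! ### Cones and fans in `ℝ^ι`, with lattice `ℤ^ι`; characters and one-parameter subgroups are
paired by the standard pairing. -/

/-- The pairing of an integral covector with a real vector. -/
def pair {ι : Type} [Fintype ι] (m : ι → ℤ) (v : ι → ℝ) : ℝ := ∑ i, (m i : ℝ) * v i

lemma pair_add_left {ι : Type} [Fintype ι] (m m' : ι → ℤ) (v : ι → ℝ) :
    pair (m + m') v = pair m v + pair m' v := by
  simp [pair, add_mul, Finset.sum_add_distrib]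

lemma pair_zero_left {ι : Type} [Fintype ι] (v : ι → ℝ) : pair 0 v = 0 := by simp [pair]

lemma pair_neg_left {ι : Type} [Fintype ι] (m : ι → ℤ) (v : ι → ℝ) :
    pair (-m) v = - pair m v := by
  simp [pair]

lemma pair_nsmul_left {ι : Type} [Fintype ι] (k : ℕ) (m : ι → ℤ) (v : ι → ℝ) :
    pair (k • m) v = k * pair m v := by
  simp [pair, Finset.mul_sum, mul_assoc]

lemma pair_add_right {ι : Type} [Fintype ι] (m : ι → ℤ) (v w : ι → ℝ) :
    pair m (v + w) = pair m v + pair m w := by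
  simp [pair, mul_add, Finset.sum_add_distrib]

lemma pair_smul_right {ι : Type} [Fintype ι] (m : ι → ℤ) (c : ℝ) (v : ι → ℝ) :
    pair m (c • v) = c * pair m v := by
  simp only [pair, Pi.smul_apply, smul_eq_mul, Finset.mul_sum]
  exact Finset.sum_congr rfl fun i _ => by ring

lemma pair_zero_right {ι : Type} [Fintype ι] (m : ι → ℤ) : pair m 0 = 0 := by simp [pair]

/-- The real vector underlying a lattice vector. -/
def toReal {ι : Type} (u : ι → ℤ) : ι → ℝ := fun i => (u i : ℝ)

/-- The cone `∑ ℝ_{≥0} u` spanned by a set of lattice vectors. -/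
def coneOf {ι : Type} (s : Set (ι → ℤ)) : PointedCone ℝ (ι → ℝ) :=
  Submodule.span {c : ℝ // 0 ≤ c} (toReal '' s)

/-- The semigroup `σ^∨ ∩ M` of the characters that are regular on the affine toric variety
of the cone `σ`. -/
def dualMonoid {ι : Type} [Fintype ι] (σ : PointedCone ℝ (ι → ℝ)) : AddSubmonoid (ι → ℤ) where
  carrier := {m | ∀ v ∈ σ, 0 ≤ pair m v}
  zero_mem' := fun v _ => (pair_zero_left v).ge
  add_mem' := fun {a b} ha hb v hv => by
    rw [pair_add_left]; exact add_nonneg (ha v hv) (hb v hv)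

lemma dualMonoid_anti {ι : Type} [Fintype ι] {σ τ : PointedCone ℝ (ι → ℝ)} (h : τ ≤ σ) :
    dualMonoid σ ≤ dualMonoid τ := fun _ hm v hv => hm v (h hv)

/-- `τ` is a face of `σ`: it is cut out on `σ` by a supporting hyperplane `u = 0`. (A face of a
rational polyhedral cone always has an integral supporting covector `u`; `u = 0` gives `σ`.) -/
def IsFace {ι : Type} [Fintype ι] (τ σ : PointedCone ℝ (ι → ℝ)) : Prop :=
  ∃ u ∈ dualMonoid σ, ∀ v, v ∈ τ ↔ v ∈ σ ∧ pair u v = 0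

/-- A fan: a nonempty finite collection of strongly convex rational polyhedral cones, closed under
taking faces, any two of which meet in a common face. -/
structure Fan (ι : Type) [Fintype ι] where
  cones : Set (PointedCone ℝ (ι → ℝ))
  nonempty : cones.Nonempty
  finite : cones.Finite
  rational : ∀ σ ∈ cones, ∃ s : Finset (ι → ℤ), σ = coneOf (s : Set (ι → ℤ))
  salient : ∀ σ ∈ cones, ∀ v ∈ σ, -v ∈ σ → v = 0
  face : ∀ σ ∈ cones, ∀ τ, IsFace τ σ → τ ∈ cones
  inter : ∀ σ ∈ cones, ∀ τ ∈ cones, IsFace (σ ⊓ τ) σ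

/-! ### The toric variety of a fan -/

section Charts

variable {ι : Type} [Fintype ι]

/-- The coordinate ring `ℂ[σ^∨ ∩ M]` of the affine toric variety `U_σ`. -/
abbrev chartRing (σ : PointedCone ℝ (ι → ℝ)) : Type := AddMonoidAlgebra ℂ (dualMonoid σ)

/-- The inclusion of a monoid algebra of a smaller monoid of characters in that of a bigger one. -/
def inclAlg {ι : Type} {S T : AddSubmonoid (ι → ℤ)} (h : S ≤ T) :
    AddMonoidAlgebra ℂ S →ₐ[ℂ] AddMonoidAlgebra ℂ T :=
  AddMonoidAlgebra.mapDomainAlgHom ℂ ℂ (AddSubmonoid.inclusion h)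

/-- The inclusion of the monoid algebra of `S ⊆ M` in the Laurent polynomials `ℂ[M]`. -/
def toLaurent {ι : Type} (S : AddSubmonoid (ι → ℤ)) :
    AddMonoidAlgebra ℂ S →ₐ[ℂ] AddMonoidAlgebra ℂ (ι → ℤ) :=
  AddMonoidAlgebra.mapDomainAlgHom ℂ ℂ S.subtype

lemma inclAlg_single {ι : Type} {S T : AddSubmonoid (ι → ℤ)} (h : S ≤ T) (s : S) (c : ℂ) :
    inclAlg h (AddMonoidAlgebra.single s c) = AddMonoidAlgebra.single ⟨s, h s.2⟩ c := by
  simp [inclAlg]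
  rfl

lemma inclAlg_injective {ι : Type} {S T : AddSubmonoid (ι → ℤ)} (h : S ≤ T) :
    Function.Injective (inclAlg h) :=
  AddMonoidAlgebra.mapDomain_injective (AddSubmonoid.inclusion_injective h)

lemma inclAlg_refl {ι : Type} {S : AddSubmonoid (ι → ℤ)} (h : S ≤ S) :
    inclAlg h = AlgHom.id ℂ _ := by
  ext s
  simp [inclAlg_single]

lemma inclAlg_comp {ι : Type} {S T U : AddSubmonoid (ι → ℤ)} (h : S ≤ T) (h' : T ≤ U) :
    (inclAlg h').comp (inclAlg h) = inclAlg (h.trans h') := by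
  ext s
  simp [inclAlg_single]

/-- If `τ` is the face of the rational polyhedral cone `σ` cut out by `u`, every character regular
on `U_τ` becomes regular on `U_σ` after multiplication with a power of `u`. -/
lemma exists_add_nsmul_mem {σ τ : PointedCone ℝ (ι → ℝ)}
    (hσ : ∃ s : Finset (ι → ℤ), σ = coneOf (s : Set (ι → ℤ))) {u : ι → ℤ} (hu : u ∈ dualMonoid σ)
    (hτ : ∀ v, v ∈ τ ↔ v ∈ σ ∧ pair u v = 0) {m : ι → ℤ} (hm : m ∈ dualMonoid τ) :
    ∃ k : ℕ, m + k • u ∈ dualMonoid σ := by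
  obtain ⟨s, rfl⟩ := hσ
  have hs : ∀ x ∈ s, toReal x ∈ coneOf (s : Set (ι → ℤ)) := fun x hx =>
    Submodule.subset_span ⟨x, hx, rfl⟩
  have h1 : ∀ x ∈ s, ∃ k : ℕ, ∀ l : ℕ, k ≤ l → 0 ≤ pair (m + l • u) (toReal x) := by
    intro x hx
    rcases (hu _ (hs x hx)).eq_or_lt with h0 | h0
    · refine ⟨0, fun l _ => ?_⟩
      rw [pair_add_left, pair_nsmul_left, ← h0, mul_zero, add_zero]
      exact hm _ ((hτ _).2 ⟨hs x hx, h0.symm⟩)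
    · obtain ⟨k, hk⟩ := exists_nat_gt (-(pair m (toReal x)) / pair u (toReal x))
      refine ⟨k, fun l hl => ?_⟩
      rw [div_lt_iff₀ h0] at hk
      rw [pair_add_left, pair_nsmul_left]
      have : (k : ℝ) ≤ l := by exact_mod_cast hl
      nlinarith
  choose! k hk using h1
  refine ⟨s.sup k, fun v hv => ?_⟩
  refine Submodule.span_induction (p := fun v _ => 0 ≤ pair (m + s.sup k • u) v) ?_ ?_ ?_ ?_ hv
  · rintro _ ⟨x, hx, rfl⟩
    exact hk x hx _ (Finset.le_sup hx)
  · exact (pair_zero_right _).ge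
  · intro x y _ _ hx hy
    rw [pair_add_right]; exact add_nonneg hx hy
  · intro c x _ hx
    change 0 ≤ pair _ ((c : ℝ) • x)
    rw [pair_smul_right]; exact mul_nonneg c.2 hx

/-- `U_τ` is a principal open subset of `U_σ` if `τ` is a face of `σ`. -/
lemma isLocalization_away {σ τ : PointedCone ℝ (ι → ℝ)}
    (hσ : ∃ s : Finset (ι → ℤ), σ = coneOf (s : Set (ι → ℤ))) (hle : τ ≤ σ) {u : ι → ℤ}
    (hu : u ∈ dualMonoid σ) (hτ : ∀ v, v ∈ τ ↔ v ∈ σ ∧ pair u v = 0) :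
    let _ := (inclAlg (dualMonoid_anti hle)).toRingHom.toAlgebra
    IsLocalization.Away (AddMonoidAlgebra.single (⟨u, hu⟩ : dualMonoid σ) (1 : ℂ))
      (chartRing τ) := by
  intro _
  have hneg : -u ∈ dualMonoid τ := fun v hv => by
    rw [pair_neg_left, ((hτ v).1 hv).2, neg_zero]
  have hmap : ∀ x : chartRing σ, algebraMap (chartRing σ) (chartRing τ) x =
    inclAlg (dualMonoid_anti hle) x := fun _ => rfl
  have hpow : ∀ k : ℕ, (AddMonoidAlgebra.single (⟨u, hu⟩ : dualMonoid σ) (1 : ℂ)) ^ k =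
      AddMonoidAlgebra.single (k • (⟨u, hu⟩ : dualMonoid σ)) 1 := fun k => by
    rw [AddMonoidAlgebra.single_pow, one_pow]
  refine (isLocalization_iff _ _).2 ⟨?_, ?_, ?_⟩
  · rintro ⟨_, k, rfl⟩
    simp only [hpow, hmap, inclAlg_single]
    refine IsUnit.of_mul_eq_one
      (AddMonoidAlgebra.single (k • (⟨-u, hneg⟩ : dualMonoid τ)) 1) ?_
    rw [AddMonoidAlgebra.single_mul_single, AddMonoidAlgebra.one_def]
    congr 1
    · ext i; simp
    · simp
  · suffices H : ∀ z : chartRing τ, ∃ k : ℕ, ∀ l, k ≤ l → ∃ x : chartRing σ,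
        z * inclAlg (dualMonoid_anti hle)
          (AddMonoidAlgebra.single (l • (⟨u, hu⟩ : dualMonoid σ)) 1) =
          inclAlg (dualMonoid_anti hle) x by
      intro z
      obtain ⟨k, hk⟩ := H z
      obtain ⟨x, hx⟩ := hk k le_rfl
      refine ⟨⟨x, ⟨_, k, rfl⟩⟩, ?_⟩
      simp only [hpow]
      exact hx
    intro z
    induction z using AddMonoidAlgebra.induction_linear with
    | zero => exact ⟨0, fun l _ => ⟨0, by simp⟩⟩
    | add f g hf hg =>
      obtain ⟨k, hk⟩ := hf
      obtain ⟨k', hk'⟩ := hg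
      refine ⟨max k k', fun l hl => ?_⟩
      obtain ⟨x, hx⟩ := hk l ((le_max_left _ _).trans hl)
      obtain ⟨y, hy⟩ := hk' l ((le_max_right _ _).trans hl)
      exact ⟨x + y, by rw [add_mul, hx, hy, map_add]⟩
    | single m c =>
      obtain ⟨k, hk⟩ := exists_add_nsmul_mem hσ hu hτ m.2
      refine ⟨k, fun l hl => ?_⟩
      obtain ⟨d, rfl⟩ := Nat.exists_eq_add_of_le hl
      have hmem : (m : ι → ℤ) + (k + d) • u ∈ dualMonoid σ := by
        rw [add_smul, ← add_assoc]
        exact add_mem hk (nsmul_mem hu d)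
      refine ⟨AddMonoidAlgebra.single ⟨_, hmem⟩ c, ?_⟩
      rw [inclAlg_single, inclAlg_single, AddMonoidAlgebra.single_mul_single, mul_one]
      congr 1
  · intro x y h
    exact ⟨1, by rw [inclAlg_injective _ h]⟩

end Charts

namespace Fan

variable {ι : Type} [Fintype ι] (Δ : Fan ι)

/-- The coordinate rings of the affine charts, contravariant in the cone. -/
def chartMap {σ τ : Δ.cones} (h : τ ≤ σ) :
    CommRingCat.of (chartRing σ.1) ⟶ CommRingCat.of (chartRing τ.1) :=
  CommRingCat.ofHom (inclAlg (dualMonoid_anti (show τ.1 ≤ σ.1 from h))).toRingHom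

/-- The diagram of affine charts `U_σ = Spec ℂ[σ^∨ ∩ M]`, with the inclusions `U_τ ⊆ U_σ` for
`τ ⊆ σ`. -/
def diagram : Δ.cones ⥤ Scheme.{0} where
  obj σ := Spec (CommRingCat.of (chartRing σ.1))
  map {τ σ} f := Spec.map (Δ.chartMap (leOfHom f))
  map_id σ := by
    rw [← Spec.map_id]
    congr 1
    ext1
    simp only [chartMap, inclAlg_refl]
    rfl
  map_comp {ρ τ σ} f g := by
    rw [← Spec.map_comp]
    congr 1
    ext1
    simp only [chartMap, ← inclAlg_comp (dualMonoid_anti (show τ.1 ≤ σ.1 from leOfHom g))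
      (dualMonoid_anti (show ρ.1 ≤ τ.1 from leOfHom f))]
    rfl

lemma isFace_of_le {σ τ : Δ.cones} (h : τ ≤ σ) : IsFace τ.1 σ.1 := by
  have := Δ.inter σ.1 σ.2 τ.1 τ.2
  rwa [inf_eq_right.2 (show τ.1 ≤ σ.1 from h)] at this

instance isOpenImmersion_diagram_map {τ σ : Δ.cones} (f : τ ⟶ σ) :
    IsOpenImmersion (Δ.diagram.map f) := by
  have hle : τ.1 ≤ σ.1 := leOfHom f
  obtain ⟨u, hu, hτ⟩ := Δ.isFace_of_le (leOfHom f)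
  let _ := (inclAlg (dualMonoid_anti hle)).toRingHom.toAlgebra
  have := isLocalization_away (Δ.rational σ.1 σ.2) hle hu hτ
  exact IsOpenImmersion.of_isLocalization (R := chartRing σ.1) (S := chartRing τ.1)
    (AddMonoidAlgebra.single (⟨u, hu⟩ : dualMonoid σ.1) (1 : ℂ))

lemma range_diagram_map {τ σ : Δ.cones} (f : τ ⟶ σ) {u : ι → ℤ}
    (hu : u ∈ dualMonoid σ.1) (hτ : ∀ v, v ∈ τ.1 ↔ v ∈ σ.1 ∧ pair u v = 0) :
    Set.range (Δ.diagram.map f) = (PrimeSpectrum.basicOpen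
      (AddMonoidAlgebra.single (⟨u, hu⟩ : dualMonoid σ.1) (1 : ℂ)) :
        Set (PrimeSpectrum (chartRing σ.1))) := by
  have hle : τ.1 ≤ σ.1 := leOfHom f
  let _ := (inclAlg (dualMonoid_anti hle)).toRingHom.toAlgebra
  have := isLocalization_away (Δ.rational σ.1 σ.2) hle hu hτ
  exact PrimeSpectrum.localization_away_comap_range (chartRing τ.1) _

instance isLocallyDirected_diagram : (Δ.diagram ⋙ Scheme.forget).IsLocallyDirected := by
  constructor
  intro σ₁ σ₂ σ f₁ f₂ x₁ x₂ h
  obtain ⟨u₁, hu₁, hσ₁⟩ := Δ.isFace_of_le (leOfHom f₁)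
  obtain ⟨u₂, hu₂, hσ₂⟩ := Δ.isFace_of_le (leOfHom f₂)
  let τ : Δ.cones := ⟨σ₁.1 ⊓ σ₂.1, Δ.face σ₁.1 σ₁.2 _ (Δ.inter σ₁.1 σ₁.2 σ₂.1 σ₂.2)⟩
  have g₁ : τ ⟶ σ₁ := homOfLE (show σ₁.1 ⊓ σ₂.1 ≤ σ₁.1 from inf_le_left)
  have g₂ : τ ⟶ σ₂ := homOfLE (show σ₁.1 ⊓ σ₂.1 ≤ σ₂.1 from inf_le_right)
  have hτ : ∀ v, v ∈ τ.1 ↔ v ∈ σ.1 ∧ pair (u₁ + u₂) v = 0 := by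
    intro v
    change v ∈ σ₁.1 ∧ v ∈ σ₂.1 ↔ _
    rw [hσ₁, hσ₂, pair_add_left]
    constructor
    · rintro ⟨⟨h, h1⟩, _, h2⟩
      exact ⟨h, by rw [h1, h2, add_zero]⟩
    · rintro ⟨h, h1⟩
      have a1 := hu₁ v h
      have a2 := hu₂ v h
      exact ⟨⟨h, by linarith⟩, h, by linarith⟩
  have h' : Δ.diagram.map f₁ x₁ = Δ.diagram.map f₂ x₂ := h
  have m₁ : Δ.diagram.map f₁ x₁ ∈ Set.range (Δ.diagram.map f₁) := ⟨_, rfl⟩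
  have m₂ : Δ.diagram.map f₁ x₁ ∈ Set.range (Δ.diagram.map f₂) := ⟨x₂, h'.symm⟩
  rw [Δ.range_diagram_map f₁ hu₁ hσ₁] at m₁
  rw [Δ.range_diagram_map f₂ hu₂ hσ₂] at m₂
  have m : Δ.diagram.map f₁ x₁ ∈ Set.range (Δ.diagram.map (g₁ ≫ f₁)) := by
    rw [Δ.range_diagram_map (g₁ ≫ f₁) (add_mem hu₁ hu₂) hτ]
    have e : (AddMonoidAlgebra.single (⟨u₁ + u₂, add_mem hu₁ hu₂⟩ : dualMonoid σ.1) (1 : ℂ)) =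
        AddMonoidAlgebra.single (⟨u₁, hu₁⟩ : dualMonoid σ.1) (1 : ℂ) *
          AddMonoidAlgebra.single (⟨u₂, hu₂⟩ : dualMonoid σ.1) (1 : ℂ) := by
      rw [AddMonoidAlgebra.single_mul_single, mul_one]
      rfl
    rw [e, PrimeSpectrum.basicOpen_mul]
    exact ⟨m₁, m₂⟩
  obtain ⟨y, hy⟩ := m
  refine ⟨τ, g₁, g₂, y, ?_, ?_⟩
  · apply (Δ.diagram.map f₁).isOpenEmbedding.injective
    rw [← hy, Functor.map_comp]
    rfl
  · apply (Δ.diagram.map f₂).isOpenEmbedding.injective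
    rw [← h', ← hy, Subsingleton.elim (g₁ ≫ f₁) (g₂ ≫ f₂), Functor.map_comp]
    rfl

/-- The toric variety `X(Δ)`: the affine charts `U_σ` glued along the `U_τ`, `τ` a face. -/
def toricVariety : Scheme.{0} := colimit Δ.diagram

/-- The open chart `U_σ ⟶ X(Δ)`. -/
def chart (σ : Δ.cones) : Spec (CommRingCat.of (chartRing σ.1)) ⟶ Δ.toricVariety :=
  colimit.ι Δ.diagram σ

instance isOpenImmersion_chart (σ : Δ.cones) : IsOpenImmersion (Δ.chart σ) :=
  (Scheme.IsLocallyDirected.openCover Δ.diagram).map_prop σ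

lemma exists_chart_eq (x : Δ.toricVariety) : ∃ σ y, Δ.chart σ y = x :=
  Scheme.IsLocallyDirected.ι_jointly_surjective Δ.diagram x

/-- `M_X^+`: the semigroup of the characters that are regular functions on all of `X(Δ)`. -/
def regularChars : AddSubmonoid (ι → ℤ) := ⨅ σ : Δ.cones, dualMonoid σ.1

lemma regularChars_le (σ : Δ.cones) : Δ.regularChars ≤ dualMonoid σ.1 := iInf_le _ σ

/-- The canonical morphism `X(Δ) ⟶ Spec ℂ[M_X^+]`, on each chart induced by
`ℂ[M_X^+] ⊆ ℂ[σ^∨ ∩ M]`. -/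
def toAffine : Δ.toricVariety ⟶ Spec (CommRingCat.of (AddMonoidAlgebra ℂ Δ.regularChars)) :=
  colimit.desc Δ.diagram
    { pt := Spec (CommRingCat.of (AddMonoidAlgebra ℂ Δ.regularChars))
      ι :=
        { app := fun σ => Spec.map (CommRingCat.ofHom (inclAlg (Δ.regularChars_le σ)).toRingHom)
          naturality := fun τ σ f => by
            simp only [diagram, chartMap, Functor.const_obj_obj, Functor.const_obj_map,
              Category.comp_id]
            rw [← Spec.map_comp, ← CommRingCat.ofHom_comp]
            congr 2
            exact congrArg AlgHom.toRingHom (inclAlg_comp (Δ.regularChars_le σ)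
              (dualMonoid_anti (show τ.1 ≤ σ.1 from leOfHom f))) } }

/-- The regular function `s` on `X(Δ)` is the one whose restriction to the torus is the Laurent
polynomial `W`: on every chart, `s` is an element of `ℂ[σ^∨ ∩ M]` equal to `W` in `ℂ[M]`. -/
def IsFunction (s : Γ(Δ.toricVariety, ⊤)) (W : AddMonoidAlgebra ℂ (ι → ℤ)) : Prop :=
  ∀ σ : Δ.cones, ∃ g : chartRing σ.1, toLaurent (dualMonoid σ.1) g = W ∧
    (Δ.chart σ).appTop.hom s = (Scheme.ΓSpecIso (CommRingCat.of (chartRing σ.1))).inv.hom g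

/-- The toric variety is smooth: every cone is spanned by a part of a basis of the lattice. -/
def IsSmooth : Prop :=
  ∀ σ ∈ Δ.cones, ∃ (b : Module.Basis ι ℤ (ι → ℤ)) (s : Set ι), σ = coneOf (b '' s)

/-- The toric variety is complete: the cones cover the whole space. -/
def IsComplete : Prop := ∀ v : ι → ℝ, ∃ σ ∈ Δ.cones, v ∈ σ

/-- `u` enumerates without repetition the primitive generators of the rays (one-dimensional cones)
of the fan, that is, the prime torus-invariant divisors. -/
def IsRayEnum {ρ : Type} (u : ρ → ι → ℤ) : Prop :=
  Function.Injective u ∧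
  (∀ r, u r ≠ 0 ∧ ∀ (k : ℤ) (v : ι → ℤ), u r = k • v → IsUnit k) ∧
  {σ | σ ∈ Δ.cones ∧ Module.finrank ℝ (Submodule.span ℝ (σ : Set (ι → ℝ))) = 1} =
    Set.range fun r => coneOf {u r}

/-! ### Torus-invariant divisors and sections of their line bundles -/

section Sections

variable {ρ : Type} (u : ρ → ι → ℤ) (a : ρ → ℤ)

/-- The character `χ^m` generates the line bundle `O(D)`, `D = ∑ a_r D_r`, on the chart `U_σ`. -/
def IsLocalGenerator (σ : Δ.cones) (m : ι → ℤ) : Prop :=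
  ∀ r, toReal (u r) ∈ σ.1 → ∑ i, m i * u r i = - a r

/-- `f` is a global section of `O(D)`: divided by a generator of `O(D)` on a chart, it is regular
on the chart. (Sections are viewed as rational functions; they are regular on the torus.) -/
def IsSection (f : AddMonoidAlgebra ℂ (ι → ℤ)) : Prop :=
  ∀ (σ : Δ.cones) (m : ι → ℤ), Δ.IsLocalGenerator u a σ m →
    ∃ g : chartRing σ.1, f = AddMonoidAlgebra.single m 1 * toLaurent _ g

/-- The global sections of `O(D)` have no common zero: at every closed point `x` of every chart,
there is a global section `χ^m g` with `g(x) ≠ 0`, where `χ^m` generates `O(D)` on the chart. -/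
def IsBasePointFree : Prop :=
  ∀ (σ : Δ.cones) (m : ι → ℤ), Δ.IsLocalGenerator u a σ m →
    ∀ x : chartRing σ.1 →ₐ[ℂ] ℂ, ∃ g : chartRing σ.1,
      Δ.IsSection u a (AddMonoidAlgebra.single m 1 * toLaurent _ g) ∧ x g ≠ 0

end Sections

end Fan

/-! ### Linear data and toric Landau-Ginzburg models -/

section LinearData

variable {ι τ : Type} [Fintype ι]

/-- The cokernel of the homomorphism `ℤ^ι → ℤ^τ` given by a matrix. -/
abbrev coker (A : Matrix τ ι ℤ) : Type := (τ → ℤ) ⧸ LinearMap.range A.mulVecLin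

/-- The class in the cokernel. -/
def cokerMk (A : Matrix τ ι ℤ) : (τ → ℤ) →ₗ[ℤ] coker A := Submodule.mkQ _

open Classical in
/-- The image of `c ∈ G^τ = (ℤ^τ)_G` in `coker(A)_G = coker(A) ⊗ G`. -/
def cokerClass [Fintype τ] {G : Type} [AddCommGroup G] (A : Matrix τ ι ℤ) (c : τ → G) :
    coker A ⊗[ℤ] G :=
  ∑ j, cokerMk A (Pi.single j 1) ⊗ₜ[ℤ] c j

/-- `ℂ/ℤ`. -/
abbrev CmodZ : Type := AddCircle (1 : ℂ)

/-- The imaginary part `ℂ/ℤ → ℝ`. -/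
def imCmodZ : CmodZ →+ ℝ :=
  QuotientAddGroup.lift (AddSubgroup.zmultiples (1 : ℂ)) Complex.imAddGroupHom (by
    intro x hx
    obtain ⟨k, rfl⟩ := AddSubgroup.mem_zmultiples_iff.1 hx
    simp)

/-- The imaginary part `coker(A)_{ℂ/ℤ} → coker(A)_ℝ`. -/
def imCoker (A : Matrix τ ι ℤ) : coker A ⊗[ℤ] CmodZ →ₗ[ℤ] coker A ⊗[ℤ] ℝ :=
  LinearMap.lTensor (coker A) imCmodZ.toIntLinearMap

/-- Linear `ℂ/ℤ`-data: a homomorphism `ℤ^ι → ℤ^τ` and an element of its cokernel with coefficients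
in `ℂ/ℤ`. -/
structure LinearData (ι τ : Type) [Fintype ι] where
  mat : Matrix τ ι ℤ
  cls : coker mat ⊗[ℤ] CmodZ

/-- The linear data `(A, K)`, `(B, L)` of a toric Landau-Ginzburg model `(X, W, K)`: `A` is the
character-to-divisor map (its rows are the primitive generators of the rays of `X`), `B` is the
infinitesimal action on monomials (its rows are the terms of `W`), `L` is the class of `W`. -/
structure LGData (ι ρ τ : Type) [Fintype ι] where
  A : LinearData ι ρ
  B : LinearData ι τ

/-- The dual linear data: `(A', K') = (B, L)` and `(B', L') = (A, K)`. -/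
def LGData.dual {ρ : Type} (S : LGData ι ρ τ) : LGData ι τ ρ := ⟨S.B, S.A⟩

/-- The polyhedral set `{ξ | A ξ + α ≥ 0}`. -/
def polyhedron (A : Matrix τ ι ℤ) (α : τ → ℝ) : Set (ι → ℝ) :=
  {ξ | ∀ j, 0 ≤ pair (A j) ξ + α j}

/-- The cone of the covectors whose minimum on `P` is attained at all points of `f`. -/
def normalCone (P f : Set (ι → ℝ)) : PointedCone ℝ (ι → ℝ) where
  carrier := {ν | ∀ ξ ∈ f, ∀ η ∈ P, ν ⬝ᵥ ξ ≤ ν ⬝ᵥ η}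
  zero_mem' := fun ξ _ η _ => by simp
  add_mem' := fun {a b} ha hb ξ hξ η hη => by
    rw [add_dotProduct, add_dotProduct]
    exact add_le_add (ha ξ hξ η hη) (hb ξ hξ η hη)
  smul_mem' := fun c ν hν ξ hξ η hη => by
    change ((c : ℝ) • ν) ⬝ᵥ ξ ≤ ((c : ℝ) • ν) ⬝ᵥ η
    rw [smul_dotProduct, smul_dotProduct]
    exact mul_le_mul_of_nonneg_left (hν ξ hξ η hη) c.2

/-- The nonempty faces of `P`: intersections with the boundary of a half-space containing `P`, and
`P` itself (the case `ν = 0`). -/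
def IsPolyhedronFace (P f : Set (ι → ℝ)) : Prop :=
  f.Nonempty ∧ ∃ (ν : ι → ℝ) (b : ℝ), (∀ η ∈ P, b ≤ ν ⬝ᵥ η) ∧ f = {ξ | ξ ∈ P ∧ ν ⬝ᵥ ξ = b}

/-- The cones of the inward normal fan of `P`. -/
def normalFan (P : Set (ι → ℝ)) : Set (PointedCone ℝ (ι → ℝ)) :=
  {σ | ∃ f, IsPolyhedronFace P f ∧ σ = normalCone P f}

/-- `X` is (the fan of) the toric variety `X(A, Im K)` of the linear data `(A, K)`: the inward
normal fan of the polyhedral set of `A` and a lift `α` of `Im K`, which has nonempty interior. -/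
def LinearData.IsVariety [Fintype τ] (S : LinearData ι τ) (X : Fan ι) : Prop :=
  ∃ α : τ → ℝ, cokerClass S.mat α = imCoker S.mat S.cls ∧
    (interior (polyhedron S.mat α)).Nonempty ∧ X.cones = normalFan (polyhedron S.mat α)

/-- The Laurent polynomial `W(B, λ) = ∑ exp(2πi λ_j) ξ_j`, `ξ_j` the rows of `B`. -/
def potential [Fintype τ] (B : Matrix τ ι ℤ) (c : τ → ℂ) : AddMonoidAlgebra ℂ (ι → ℤ) :=
  ∑ j, AddMonoidAlgebra.single (B j) (Complex.exp (2 * Real.pi * Complex.I * c j))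

/-- The linear data `(mon, L)` of a function `W` on a torus: the rows of `mon` are the terms of
`W`, and `L` is the class of `W` under `exp(2πi -) : ℂ/ℤ ≅ ℂ^×`. -/
def monData (W : AddMonoidAlgebra ℂ (ι → ℤ)) : LinearData ι W.coeff.support where
  mat := Matrix.of fun ξ => ξ.1
  cls := cokerClass _ fun ξ =>
    ((Complex.log (W.coeff ξ.1) / (2 * Real.pi * Complex.I) : ℂ) : CmodZ)

end LinearData

/-! ### The sigma model / Landau-Ginzburg correspondence for a split bundle -/

section SplitBundle

variable {ι ρ κ : Type} [Fintype ι] [Fintype κ] [DecidableEq κ]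

/-- The primitive generators of the rays of the total space `X` of `⨁ O(-D_j)`, where
`D_j = ∑ D_{jr} D_r`, in `N_X = N_Y ⊕ ℤ^κ`: `(u_r, (D_{jr})_j)` for the preimage of the divisor
`D_r` of `Y`, and `(0, e_j)` for the total space of the subbundle where the `j`-th fibre coordinate
vanishes. -/
def totRay (u : ρ → ι → ℤ) (D : κ → ρ → ℤ) : ρ ⊕ κ → ι ⊕ κ → ℤ
  | Sum.inl r => Sum.elim (u r) fun j => D j r
  | Sum.inr j => Sum.elim 0 (Pi.single j 1)

/-- The function `W = ∑ w_j σ_j` on `X` defined by the section `w = (w_j)` of `⨁ O(D_j)`; here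
`M_X = M_Y ⊕ ⨁ ℤ σ_j` and `σ_j` is the `j`-th fibre coordinate. -/
def sectionPotential (w : κ → AddMonoidAlgebra ℂ (ι → ℤ)) :
    AddMonoidAlgebra ℂ (ι ⊕ κ → ℤ) :=
  ∑ j, AddMonoidAlgebra.mapDomain (fun m => Sum.elim m (Pi.single j 1)) (w j)

/-- The pullback of divisor classes from `Y` to `X`. -/
def pullbackClass (u : ρ → ι → ℤ) (D : κ → ρ → ℤ) :
    coker (Matrix.of u) →ₗ[ℤ] coker (Matrix.of (totRay u D)) :=
  Submodule.mapQ _ _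
    { toFun := fun a => (Sum.elim a 0 : ρ ⊕ κ → ℤ)
      map_add' := fun a b => by ext (r | j) <;> simp
      map_smul' := fun c a => by ext (r | j) <;> simp } (by
    rintro _ ⟨m, rfl⟩
    refine ⟨Sum.elim m 0, ?_⟩
    ext (r | j) <;> simp [Matrix.mulVec, dotProduct, totRay])

variable {I : Type} [Fintype I]

/-- The class `K = - i t / 2π`, `t = ∑ t_i p_i`, pulled back to `X`. -/
def kahlerClass (u : ρ → ι → ℤ) (D : κ → ρ → ℤ) (p : Module.Basis I ℤ (coker (Matrix.of u)))
    (t : I → ℂ) : coker (Matrix.of (totRay u D)) ⊗[ℤ] CmodZ :=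
  ∑ i, pullbackClass u D (p i) ⊗ₜ[ℤ] ((-Complex.I * t i / (2 * Real.pi) : ℂ) : CmodZ)

/-- The linear data of the Landau-Ginzburg model `(X, W, K)` of the section `w` and `K = -it/2π`. -/
def sigmaData (u : ρ → ι → ℤ) (D : κ → ρ → ℤ) (p : Module.Basis I ℤ (coker (Matrix.of u)))
    (t : I → ℂ) (w : κ → AddMonoidAlgebra ℂ (ι → ℤ)) :
    LGData (ι ⊕ κ) (ρ ⊕ κ) (sectionPotential w).coeff.support where
  A := ⟨Matrix.of (totRay u D), kahlerClass u D p t⟩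
  B := monData (sectionPotential w)

/-- The linear data `((A', K'), (B', L'))` of the dual Landau-Ginzburg model `(X', W', K')`. The
terms of `W'` are the rows of `B'`, enumerated by the invariant divisors `ρ ⊕ κ` of `X`. -/
def dualData (u : ρ → ι → ℤ) (D : κ → ρ → ℤ) (p : Module.Basis I ℤ (coker (Matrix.of u)))
    (t : I → ℂ) (w : κ → AddMonoidAlgebra ℂ (ι → ℤ)) :
    LGData (ι ⊕ κ) (sectionPotential w).coeff.support (ρ ⊕ κ) :=
  (sigmaData u D p t w).dual

/-- The lift `(-i tHat / 2π, 0)` to `ℂ^{ρ ⊕ κ}` of `K`, given a representative `tHat` of `t`. -/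
def kahlerLift (κ : Type) (tHat : ρ → ℂ) : ρ ⊕ κ → ℂ :=
  Sum.elim (fun r => -Complex.I * tHat r / (2 * Real.pi)) 0

/-- The coordinates with respect to the basis `p` of the class of the divisor `∑ a_r D_r`. -/
def charge (u : ρ → ι → ℤ) (p : Module.Basis I ℤ (coker (Matrix.of u))) (i : I) (a : ρ → ℤ) : ℤ :=
  p.repr (cokerMk (Matrix.of u) a) i

end SplitBundle

/-! ### The Givental and Hori-Vafa mirrors -/

section Givental

variable {I ρ κ : Type}

/-- The inclusion of polynomials in Laurent polynomials. -/
def polyToLaurent (τ : Type) [DecidableEq τ] :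
    MvPolynomial τ ℂ →ₐ[ℂ] AddMonoidAlgebra ℂ (τ → ℤ) :=
  MvPolynomial.aeval fun j => AddMonoidAlgebra.single (Pi.single j 1) 1

variable [DecidableEq ρ] [DecidableEq κ]

/-- The ideal of `H'_Q ⊆ ℂ^{ρ ⊕ κ}`. The equations `∏ x_r^{m_{ir}} = Q_i ∏ y_j^{d_{ij}}` are
equations between Laurent monomials; they cut out a closed subscheme of the torus, and `H'_Q` is
the closure of the latter: its ideal consists of the polynomials that lie in the ideal of the
equations in the ring of Laurent polynomials. -/
def giventalIdeal (m : I → ρ → ℤ) (d : I → κ → ℤ) (Q : I → ℂ) :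
    Ideal (MvPolynomial (ρ ⊕ κ) ℂ) :=
  (Ideal.span (Set.range fun i =>
    (AddMonoidAlgebra.single (Sum.elim (m i) (0 : κ → ℤ)) 1 -
      AddMonoidAlgebra.single (Sum.elim (0 : ρ → ℤ) (d i)) (Q i) :
        AddMonoidAlgebra ℂ (ρ ⊕ κ → ℤ)))).comap (polyToLaurent (ρ ⊕ κ)).toRingHom

/-- The affine space `ℂ^τ`. -/
abbrev complexSpace (τ : Type) : Scheme.{0} := Spec (CommRingCat.of (MvPolynomial τ ℂ))

/-- `H'_Q`. -/
def giventalVariety (m : I → ρ → ℤ) (d : I → κ → ℤ) (Q : I → ℂ) : Scheme.{0} :=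
  Spec (CommRingCat.of (MvPolynomial (ρ ⊕ κ) ℂ ⧸ giventalIdeal m d Q))

/-- The closed immersion `H'_Q ⟶ ℂ^{ρ ⊕ κ}`. -/
def giventalInclusion (m : I → ρ → ℤ) (d : I → κ → ℤ) (Q : I → ℂ) :
    giventalVariety m d Q ⟶ complexSpace (ρ ⊕ κ) :=
  Spec.map (CommRingCat.ofHom (Ideal.Quotient.mk (giventalIdeal m d Q)))

/-- `F = ∑ x_r + ∑ y_j`. -/
def giventalF (ρ κ : Type) [Fintype ρ] [Fintype κ] : MvPolynomial (ρ ⊕ κ) ℂ :=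
  ∑ j, MvPolynomial.X j

/-- The mirror of Hori and Vafa in logarithmic coordinates `(Z, Y)`:
`∑ m_{ir} Z_r - ∑ d_{ij} Y_j = s_i`. -/
def horiVafaLocus [Fintype ρ] [Fintype κ] (m : I → ρ → ℤ) (d : I → κ → ℤ) (s : I → ℂ) :
    Set (ρ ⊕ κ → ℂ) :=
  {z | ∀ i, ∑ r, (m i r : ℂ) * z (Sum.inl r) - ∑ j, (d i j : ℂ) * z (Sum.inr j) = s i}

end Givental

end ToricMirror

end

/-! The characters regular on $X'$ are the lattice points of the recession cone of
$\{\mathrm{mon}(\xi)+\alpha\ge 0\}$ (`mem_regularChars_iff`), so they depend on the terms of $W$ and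
not on $L$. For $(v,n)\in N_Y\oplus\mathbb Z^c$ in that cone, completeness puts $v$ in a cone
$\sigma$ of $Y$ and smoothness makes it an $\mathbb N$-combination of the $u_\upsilon\in\sigma$.
Global generation supplies monomial sections $\mu_j$ with $\mu_j\cdot u_\upsilon=-a_{j\upsilon}$ on
$\sigma$. Hence $(v,(-\mu_j\cdot v)_j)$ is the same combination of the $\xi'_\upsilon$, and
$n_j+\mu_j\cdot v\ge 0$ because $\chi^{\mu_j}\sigma_j$ is a term of $W$; these numbers are the
multiplicities of the $\xi'_j$ (`forall_term_nonneg_iff`).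

So $\mathbb C[M_{X'}^+]$ is a quotient of the polynomial ring in $(x,y)$. Its relations may be
computed among Laurent polynomials, where the kernel of a monomial map is generated by binomials for
generators of the lattice of relations (`ker_monomialHom`). A relation among the $\xi'$ is
determined by one among the $u_\upsilon$, and those are spanned by the charge vectors because the
$p_i$ are a basis of the cokernel. Contracting to polynomials gives exactly the ideal of the closure
$H'_Q$.

A point of $\operatorname{Spec}\mathbb C[M_{X'}^+]$ singles out the face of characters not vanishing
there. A lattice point $w$ of the dual cone vanishing exactly on this face lies in some cone
$\sigma$ of the normal fan, by linear programming. The point lifts to $U_\sigma$, since characters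
into the units of an algebraically closed field extend by divisibility (`toAffine_surjective`). If
$L=0$, the polyhedral set is a translated cone, its normal fan has a greatest cone, and $X'$ is
affine.

Convexity rests on `farkas` and on `exists_int_same_sign`, which replaces real points by lattice
points. For the Hori-Vafa form, logarithms solve the equations up to multiples of $2\pi i$, which
are absorbed because the charges map $\mathbb Z^r$ onto $\mathbb Z^I$. -/

noncomputable section

namespace ToricMirror

/-! ### Finite systems of linear inequalities -/

/-- **Farkas' lemma** for finitely many linear functionals. -/
theorem farkas {V τ : Type*} [AddCommGroup V] [Module ℝ V] (s : Finset τ) :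
    ∀ (a : τ → V →ₗ[ℝ] ℝ) (b : V →ₗ[ℝ] ℝ), (∀ x, (∀ j ∈ s, 0 ≤ a j x) → 0 ≤ b x) →
      ∃ c : τ → ℝ, (∀ j, 0 ≤ c j) ∧ b = ∑ j ∈ s, c j • a j := by
  classical
  induction s using Finset.induction_on with
  | empty =>
    intro a b h
    refine ⟨0, fun _ => le_rfl, ?_⟩
    ext x
    have h1 := h x (by simp)
    have h2 := h (-x) (by simp)
    rw [map_neg] at h2
    simp only [Finset.sum_empty, LinearMap.zero_apply]
    linarith
  | insert k s hk ih =>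
    intro a b h
    -- If the constraints in `s` already imply `0 ≤ b`, the new functional gets coefficient `0`.
    -- Otherwise a witness `x₀` must violate the constraint `k`.
    by_cases hb : ∀ x, (∀ j ∈ s, 0 ≤ a j x) → 0 ≤ b x
    · obtain ⟨c, hc, e⟩ := ih a b hb
      refine ⟨fun j => if j = k then 0 else c j, fun j => ?_, ?_⟩
      · dsimp only
        split_ifs
        exacts [le_rfl, hc j]
      · rw [Finset.sum_insert hk, e]
        simp only [if_true, zero_smul, zero_add]
        refine Finset.sum_congr rfl fun j hj => ?_
        rw [if_neg (ne_of_mem_of_not_mem hj hk)]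
    · push Not at hb
      obtain ⟨x₀, h₀, hb₀⟩ := hb
      have hk₀ : a k x₀ < 0 := by
        by_contra! hcon
        refine hb₀.not_ge (h x₀ fun j hj => ?_)
        rcases Finset.mem_insert.1 hj with rfl | hj
        exacts [hcon, h₀ j hj]
      -- With `a k y = -1`, the map `x ↦ x + a k x • y` projects onto `ker (a k)` along `y`. The
      -- induction hypothesis is applied to the pullbacks of the `a j` and of `b` by this
      -- projection.
      set y : V := (-(a k x₀)⁻¹) • x₀ with hy
      have hpos : 0 < -(a k x₀)⁻¹ := by
        rw [neg_pos]; exact inv_lt_zero.2 hk₀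
      have hky : a k y = -1 := by
        rw [hy, map_smul, smul_eq_mul, neg_mul, inv_mul_cancel₀ hk₀.ne]
      have hby : b y < 0 := by
        rw [hy, map_smul, smul_eq_mul]; exact mul_neg_of_pos_of_neg hpos hb₀
      have hjy : ∀ j ∈ s, 0 ≤ a j y := fun j hj => by
        rw [hy, map_smul, smul_eq_mul]; exact mul_nonneg hpos.le (h₀ j hj)
      obtain ⟨c, hc, e⟩ := ih (fun j => a j + a j y • a k) (b + b y • a k) (by
        intro x hx
        have hb' := h (x + a k x • y) (by
          intro j hj
          rcases Finset.mem_insert.1 hj with rfl | hj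
          · simp [hky]
          · have := hx j hj
            simp only [LinearMap.add_apply, LinearMap.smul_apply, smul_eq_mul] at this
            simp only [map_add, map_smul, smul_eq_mul]
            linarith)
        simp only [map_add, map_smul, smul_eq_mul] at hb'
        simp only [LinearMap.add_apply, LinearMap.smul_apply, smul_eq_mul]
        linarith)
      -- Undoing the projection gives this coefficient of `a k`; it is nonnegative because `a j y ≥
      -- 0` on `s` and `b y < 0`.
      refine ⟨fun j => if j = k then ∑ j ∈ s, c j * a j y - b y else c j, fun j => ?_, ?_⟩
      · dsimp only
        split_ifs
        · have := Finset.sum_nonneg fun j hj => mul_nonneg (hc j) (hjy j hj)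
          linarith
        · exact hc j
      · rw [Finset.sum_insert hk]
        dsimp only
        rw [if_pos rfl]
        have e' : ∑ j ∈ s, (if j = k then ∑ j ∈ s, c j * a j y - b y else c j) • a j =
            ∑ j ∈ s, c j • a j :=
          Finset.sum_congr rfl fun j hj => by rw [if_neg (ne_of_mem_of_not_mem hj hk)]
        rw [e']
        ext x
        have := LinearMap.congr_fun e x
        simp only [LinearMap.add_apply, LinearMap.sum_apply, LinearMap.smul_apply, smul_eq_mul,
          mul_add, ← mul_assoc, Finset.sum_add_distrib, ← Finset.sum_mul, sub_mul] at this ⊢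
        linarith

lemma pair_toReal {ι : Type} [Fintype ι] (m u : ι → ℤ) :
    pair m (toReal u) = ((m ⬝ᵥ u : ℤ) : ℝ) := by
  simp [pair, toReal, dotProduct]

lemma pair_eq_dotProduct {ι : Type} [Fintype ι] (m : ι → ℤ) (v : ι → ℝ) :
    pair m v = toReal m ⬝ᵥ v := rfl

/-- The signs of finitely many integral linear forms at a real point are also their signs at an
integral point. -/
theorem exists_int_same_sign {ι τ : Type} [Fintype ι] [Finite τ] (a : τ → ι → ℤ)
    (x : ι → ℝ) :
    ∃ u : ι → ℤ, ∀ j, (pair (a j) x = 0 → a j ⬝ᵥ u = 0) ∧ (0 < pair (a j) x → 0 < a j ⬝ᵥ u) := by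
  classical
  -- The coordinates of `x` are expanded in a `ℚ`-basis `b` of their rational span, and `b` is then
  -- varied as a real parameter `t`. An integral form vanishing at `x` vanishes for every `t`, by
  -- rational independence, while positivity is an open condition. So a rational `t` near `b` works.
  let V : Submodule ℚ ℝ := Submodule.span ℚ (Set.range x)
  have : FiniteDimensional ℚ V := FiniteDimensional.span_of_finite ℚ (Set.finite_range x)
  let b := Module.finBasis ℚ V
  have hx : ∀ i, x i ∈ V := fun i => Submodule.subset_span ⟨i, rfl⟩
  let q : ι → Fin (Module.finrank ℚ V) → ℚ := fun i k => b.repr ⟨x i, hx i⟩ k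
  have hq : ∀ i, x i = ∑ k, (q i k : ℝ) * (b k : ℝ) := fun i => by
    have := congrArg (Subtype.val : V → ℝ) (b.sum_repr ⟨x i, hx i⟩)
    simp only [AddSubmonoidClass.coe_finsetSum, Submodule.coe_smul, Rat.smul_def] at this
    exact this.symm
  let f : τ → (Fin (Module.finrank ℚ V) → ℝ) → ℝ := fun j t =>
    ∑ i, (a j i : ℝ) * ∑ k, (q i k : ℝ) * t k
  have hf : ∀ j, pair (a j) x = f j fun k => (b k : ℝ) := fun j => by
    simp only [pair, f, ← hq]
  have hf0 : ∀ j, pair (a j) x = 0 → ∀ t, f j t = 0 := by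
    intro j hj t
    have e : ∀ t, f j t = ∑ k, ((∑ i, (a j i : ℚ) * q i k : ℚ) : ℝ) * t k := fun t => by
      simp only [f, Finset.mul_sum, Rat.cast_sum, Finset.sum_mul]
      rw [Finset.sum_comm]
      refine Finset.sum_congr rfl fun k _ => Finset.sum_congr rfl fun i _ => ?_
      push_cast; ring
    have hz : ∀ k, (∑ i, (a j i : ℚ) * q i k : ℚ) = 0 := by
      refine Fintype.linearIndependent_iff.1 b.linearIndependent _ ?_
      apply Subtype.ext
      rw [hf, e] at hj
      simpa [Rat.smul_def] using hj
    rw [e]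
    simp [hz]
  have hopen : IsOpen {t | ∀ j, 0 < pair (a j) x → 0 < f j t} := by
    simp only [Set.ofPred_forall]
    refine isOpen_iInter_of_finite fun j => isOpen_iInter_of_finite fun _ => ?_
    exact isOpen_lt continuous_const (by fun_prop)
  have hdense : DenseRange fun (t : Fin (Module.finrank ℚ V) → ℚ) k => (t k : ℝ) :=
    DenseRange.piMap fun _ => Rat.denseRange_cast
  obtain ⟨t, ht⟩ := hdense.exists_mem_open hopen ⟨_, fun j hj => (hf j) ▸ hj⟩
  let v : ι → ℚ := fun i => ∑ k, q i k * t k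
  have hv : ∀ j, f j (fun k => (t k : ℝ)) = ((∑ i, (a j i : ℚ) * v i : ℚ) : ℝ) := fun j => by
    simp [f, v]
  obtain ⟨N, hN⟩ := IsLocalization.exist_integer_multiples_of_finite (nonZeroDivisors ℤ) v
  choose u' hu' using hN
  have hN0 : (N : ℤ) ≠ 0 := nonZeroDivisors.ne_zero N.2
  -- The common denominator `N` may be negative; multiplying by it twice scales every form by `N ^ 2
  -- > 0`.
  refine ⟨fun i => N * u' i, fun j => ?_⟩
  have e : ((a j ⬝ᵥ fun i => (N : ℤ) * u' i : ℤ) : ℚ) = (N : ℚ) ^ 2 * ∑ i, (a j i : ℚ) * v i := by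
    simp only [dotProduct, Int.cast_sum, Int.cast_mul, Finset.mul_sum]
    refine Finset.sum_congr rfl fun i _ => ?_
    have := hu' i
    simp only [algebraMap_int_eq, eq_intCast] at this
    rw [this]
    simp only [zsmul_eq_mul]
    ring
  constructor
  · intro hj
    have h1 := hf0 j hj fun k => (t k : ℝ)
    rw [hv] at h1
    have h2 : (∑ i, (a j i : ℚ) * v i : ℚ) = 0 := by exact_mod_cast h1
    rw [h2, mul_zero] at e
    exact_mod_cast e
  · intro hj
    have h1 := ht j hj
    rw [hv] at h1
    have h2 : 0 < (∑ i, (a j i : ℚ) * v i : ℚ) := by exact_mod_cast h1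
    have h3 : (0 : ℚ) < (N : ℚ) ^ 2 := by
      have : ((N : ℤ) : ℚ) ≠ 0 := by exact_mod_cast hN0
      positivity
    have h4 := mul_pos h3 h2
    rw [← e] at h4
    exact_mod_cast h4

/-! ### Polyhedral cones -/

section Cone

variable {ι τ : Type}

lemma toReal_mem_coneOf {s : Set (ι → ℤ)} {u : ι → ℤ} (h : u ∈ s) : toReal u ∈ coneOf s :=
  Submodule.subset_span ⟨u, h, rfl⟩

lemma coneOf_mono {s t : Set (ι → ℤ)} (h : s ⊆ t) : coneOf s ≤ coneOf t :=
  Submodule.span_mono (Set.image_mono h)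

lemma smul_mem_cone {σ : PointedCone ℝ (ι → ℝ)} {c : ℝ} (hc : 0 ≤ c) {v : ι → ℝ} (hv : v ∈ σ) :
    c • v ∈ σ :=
  σ.smul_mem hc hv

lemma mem_coneOf_image [Fintype τ] {A : τ → ι → ℤ} {T : Set τ} {v : ι → ℝ} :
    v ∈ coneOf (A '' T) ↔
      ∃ c : τ → ℝ, (∀ j, 0 ≤ c j) ∧ (∀ j ∉ T, c j = 0) ∧ v = ∑ j, c j • toReal (A j) := by
  classical
  constructor
  · intro hv
    refine Submodule.span_induction (p := fun v _ => ∃ c : τ → ℝ, (∀ j, 0 ≤ c j) ∧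
      (∀ j ∉ T, c j = 0) ∧ v = ∑ j, c j • toReal (A j)) ?_ ?_ ?_ ?_ hv
    · rintro _ ⟨_, ⟨j, hj, rfl⟩, rfl⟩
      refine ⟨Pi.single j 1, fun k => ?_, fun k hk => ?_, ?_⟩
      · rw [Pi.single_apply]; split_ifs <;> norm_num
      · rw [Pi.single_apply, if_neg]
        rintro rfl
        exact hk hj
      · simp [Pi.single_apply]
    · exact ⟨0, fun _ => le_rfl, fun _ _ => rfl, by simp⟩
    · rintro _ _ _ _ ⟨c, h1, h2, rfl⟩ ⟨d, h3, h4, rfl⟩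
      exact ⟨c + d, fun j => add_nonneg (h1 j) (h3 j), fun j hj => by simp [h2 j hj, h4 j hj],
        by simp [add_smul, Finset.sum_add_distrib]⟩
    · rintro r x - ⟨c, h1, h2, rfl⟩
      refine ⟨fun j => r * c j, fun j => mul_nonneg r.2 (h1 j), fun j hj => by simp [h2 j hj], ?_⟩
      change (r : ℝ) • (∑ j, c j • toReal (A j)) = _
      rw [Finset.smul_sum]
      exact Finset.sum_congr rfl fun j _ => (mul_smul _ _ _).symm
  · rintro ⟨c, h1, h2, rfl⟩
    refine sum_mem fun j _ => ?_
    by_cases hj : j ∈ T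
    · exact smul_mem_cone (h1 j) (toReal_mem_coneOf ⟨j, hj, rfl⟩)
    · rw [h2 j hj, zero_smul]; exact zero_mem _

variable [Fintype ι]

lemma pair_sum_smul [Fintype τ] (m : ι → ℤ) (c : τ → ℝ) (A : τ → ι → ℤ) :
    pair m (∑ j, c j • toReal (A j)) = ∑ j, c j * pair m (toReal (A j)) := by
  simp only [pair_eq_dotProduct, dotProduct_sum, dotProduct_smul, smul_eq_mul]

/-- Farkas' lemma: a cone spanned by finitely many lattice vectors is its own double dual. -/
lemma mem_coneOf_image_iff_dual [Finite τ] {A : τ → ι → ℤ} {T : Set τ} {v : ι → ℝ} :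
    v ∈ coneOf (A '' T) ↔ ∀ x : ι → ℝ, (∀ j ∈ T, 0 ≤ pair (A j) x) → 0 ≤ v ⬝ᵥ x := by
  classical
  have := Fintype.ofFinite τ
  constructor
  · intro hv x hx
    obtain ⟨c, h1, h2, rfl⟩ := mem_coneOf_image.1 hv
    rw [sum_dotProduct]
    refine Finset.sum_nonneg fun j _ => ?_
    rw [smul_dotProduct, smul_eq_mul]
    by_cases hj : j ∈ T
    · exact mul_nonneg (h1 j) (hx j hj)
    · rw [h2 j hj, zero_mul]
  · intro h
    obtain ⟨c, hc, e⟩ := farkas (Finset.univ.filter (· ∈ T))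
      (fun j => dotProductBilin ℝ ℝ (toReal (A j))) (dotProductBilin ℝ ℝ v)
      (fun x hx => h x fun j hj => hx j (by simpa using hj))
    refine mem_coneOf_image.2 ⟨fun j => if j ∈ T then c j else 0, fun j => ?_, fun j hj => ?_, ?_⟩
    · dsimp only; split_ifs; exacts [hc j, le_rfl]
    · simp [hj]
    · ext i
      have := LinearMap.congr_fun e (Pi.single i 1)
      simp only [LinearMap.sum_apply, LinearMap.smul_apply, dotProductBilin_apply_apply,
        dotProduct_single, mul_one, smul_eq_mul] at this
      rw [this, Finset.sum_apply, Finset.sum_filter]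
      simp

/-- A lattice vector that is nonnegative on the lattice points of the dual of a cone lies in the
cone. -/
lemma toReal_mem_coneOf_range [Finite τ] {A : τ → ι → ℤ} {w : ι → ℤ}
    (h : ∀ u : ι → ℤ, (∀ j, 0 ≤ A j ⬝ᵥ u) → 0 ≤ w ⬝ᵥ u) :
    toReal w ∈ coneOf (Set.range A) := by
  rw [← Set.image_univ, mem_coneOf_image_iff_dual]
  intro x hx
  by_contra! hneg
  -- The index `none` carries the form `-w`, so that the separation of `w` from the cone survives
  -- the passage to a lattice point.
  obtain ⟨u, hu⟩ := exists_int_same_sign (fun o : Option τ => o.elim (-w) A) x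
  have h1 := (hu none).2 (by
    simp only [Option.elim_none, pair_neg_left]
    rw [pair_eq_dotProduct]; linarith)
  simp only [Option.elim_none, neg_dotProduct] at h1
  have h2 := h u fun j => by
    rcases (hx j trivial).eq_or_lt with h0 | h0
    · exact ((hu (some j)).1 h0.symm).ge
    · exact ((hu (some j)).2 h0).le
  linarith

end Cone

/-! ### The normal fan of a polyhedral set -/

section NormalFan

variable {ι τ : Type} [Fintype ι]

lemma mem_normalCone {P f : Set (ι → ℝ)} {ν : ι → ℝ} :
    ν ∈ normalCone P f ↔ ∀ ξ ∈ f, ∀ η ∈ P, ν ⬝ᵥ ξ ≤ ν ⬝ᵥ η := Iff.rfl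

lemma mem_normalCone_singleton {P : Set (ι → ℝ)} {x ν : ι → ℝ} :
    ν ∈ normalCone P {x} ↔ ∀ η ∈ P, ν ⬝ᵥ x ≤ ν ⬝ᵥ η := by
  simp [mem_normalCone]

/-- The inequalities that are equalities at a point. -/
def tight (A : Matrix τ ι ℤ) (α : τ → ℝ) (x : ι → ℝ) : Set τ := {j | pair (A j) x + α j = 0}

variable {A : Matrix τ ι ℤ} {α : τ → ℝ}

lemma pos_of_notMem_tight {x : ι → ℝ} (hx : x ∈ polyhedron A α) {j : τ} (hj : j ∉ tight A α x) :
    0 < pair (A j) x + α j :=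
  lt_of_le_of_ne (hx j) (Ne.symm hj)

/-- The slack inequalities are finitely many open conditions satisfied at `ε = 0`. -/
lemma exists_add_smul_pos [Finite τ] {x : ι → ℝ} (hx : x ∈ polyhedron A α) (d : ι → ℝ) :
    ∃ ε : ℝ, 0 < ε ∧ ∀ j ∉ tight A α x, 0 < pair (A j) (x + ε • d) + α j := by
  have h : ∀ᶠ ε : ℝ in nhdsWithin 0 (Set.Ioi 0),
      ∀ j, j ∉ tight A α x → 0 < pair (A j) (x + ε • d) + α j := by
    refine Filter.eventually_all.2 fun j => ?_
    by_cases hj : j ∈ tight A α x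
    · exact Filter.Eventually.of_forall fun ε h => (h hj).elim
    have hc : Continuous fun ε : ℝ => pair (A j) (x + ε • d) + α j := by
      simp only [pair_add_right, pair_smul_right]
      fun_prop
    have h0 : 0 < (fun ε : ℝ => pair (A j) (x + ε • d) + α j) 0 := by
      simpa using pos_of_notMem_tight hx hj
    filter_upwards [nhdsWithin_le_nhds (hc.continuousAt.eventually_mem (isOpen_Ioi.mem_nhds h0))]
      with ε hε _ using hε
  obtain ⟨ε, h1, h2⟩ := (h.and self_mem_nhdsWithin).exists
  exact ⟨ε, h2, h1⟩

lemma toReal_mem_normalCone {f : Set (ι → ℝ)} {j : τ} (hj : ∀ x ∈ f, j ∈ tight A α x) :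
    toReal (A j) ∈ normalCone (polyhedron A α) f := by
  intro x hx η hη
  have h1 : pair (A j) x + α j = 0 := hj x hx
  have h2 := hη j
  rw [← pair_eq_dotProduct, ← pair_eq_dotProduct]
  linarith

lemma coneOf_le_normalCone {f : Set (ι → ℝ)} {T : Set τ} (h : ∀ x ∈ f, T ⊆ tight A α x) :
    coneOf (A '' T) ≤ normalCone (polyhedron A α) f := by
  refine Submodule.span_le.2 ?_
  rintro _ ⟨_, ⟨j, hj, rfl⟩, rfl⟩
  exact toReal_mem_normalCone fun x hx => h x hx hj

/-- If the tight rows are nonnegative on a direction `d`, a short step along `d` stays in the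
polyhedral set, so a covector minimal at `x` is nonnegative on `d`. Farkas' lemma then writes the
covector in terms of the tight rows. -/
lemma normalCone_singleton [Finite τ] {x : ι → ℝ} (hx : x ∈ polyhedron A α) :
    normalCone (polyhedron A α) {x} = coneOf (A '' tight A α x) := by
  refine le_antisymm (fun ν hν => ?_) (coneOf_le_normalCone fun y hy => by
    rw [Set.mem_singleton_iff.1 hy])
  rw [mem_normalCone_singleton] at hν
  refine mem_coneOf_image_iff_dual.2 fun d hd => ?_
  obtain ⟨ε, hε, h⟩ := exists_add_smul_pos hx d
  have := hν (x + ε • d) fun j => by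
    by_cases hj : j ∈ tight A α x
    · have h1 : pair (A j) x + α j = 0 := hj
      rw [pair_add_right, pair_smul_right]
      have := mul_nonneg hε.le (hd j hj)
      linarith
    · exact (h j hj).le
  rw [dotProduct_add, dotProduct_smul, smul_eq_mul] at this
  exact nonneg_of_mul_nonneg_right (by linarith) hε

/-- The sum of the tight rows is a supporting covector: a sum of nonnegative slacks vanishes only if
each of them does. -/
lemma isPolyhedronFace_tight [Finite τ] {x : ι → ℝ} (hx : x ∈ polyhedron A α) :
    IsPolyhedronFace (polyhedron A α) {y ∈ polyhedron A α | tight A α x ⊆ tight A α y} := by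
  classical
  have := Fintype.ofFinite τ
  let T := Finset.univ.filter (· ∈ tight A α x)
  have e : ∀ y, (∑ j ∈ T, toReal (A j)) ⬝ᵥ y = ∑ j ∈ T, (pair (A j) y + α j) - ∑ j ∈ T, α j := by
    intro y
    rw [Finset.sum_add_distrib, add_sub_cancel_right, sum_dotProduct]
    rfl
  refine ⟨⟨x, hx, subset_rfl⟩, ∑ j ∈ T, toReal (A j), -∑ j ∈ T, α j, fun η hη => ?_, ?_⟩
  · rw [e]
    have := Finset.sum_nonneg fun j (_ : j ∈ T) => hη j
    linarith
  · ext y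
    refine and_congr_right fun hy => ?_
    rw [e, sub_eq_neg_self, Finset.sum_eq_zero_iff_of_nonneg fun j _ => hy j]
    simp only [T, Finset.mem_filter, Finset.mem_univ, true_and]
    rfl

lemma pair_midpoint_add {x y : ι → ℝ} (j : τ) :
    pair (A j) ((1 / 2 : ℝ) • (x + y)) + α j =
      (1 / 2) * (pair (A j) x + α j) + (1 / 2) * (pair (A j) y + α j) := by
  rw [pair_smul_right, pair_add_right]; ring

/-- A point of a face with the fewest tight inequalities has the same normal cone as the face. This
lets points replace faces in all fan axioms. -/
lemma normalFan_polyhedron [Finite τ] :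
    normalFan (polyhedron A α) =
      {σ | ∃ x ∈ polyhedron A α, σ = normalCone (polyhedron A α) {x}} := by
  classical
  ext σ
  constructor
  · rintro ⟨f, ⟨hne, ν, b, hb, hf⟩, rfl⟩
    obtain ⟨x, hx, hmin⟩ := exists_minimalFor_of_wellFoundedLT (· ∈ f) (tight A α) hne
    have hfP : ∀ y ∈ f, y ∈ polyhedron A α := fun y hy => by rw [hf] at hy; exact hy.1
    refine ⟨x, hfP x hx, le_antisymm (fun ν hν => ?_) ?_⟩
    · rw [mem_normalCone_singleton]; exact hν x hx
    rw [normalCone_singleton (hfP x hx)]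
    refine coneOf_le_normalCone fun y hy => ?_
    -- The midpoint of `x` and `y` is tight only where both are, so minimality at `x` forces every
    -- inequality tight at `x` to be tight at `y`.
    have hz : (1 / 2 : ℝ) • (x + y) ∈ f := by
      have h1 := hx; have h2 := hy
      rw [hf] at h1 h2 ⊢
      refine ⟨fun j => ?_, ?_⟩
      · rw [pair_midpoint_add]
        have := h1.1 j; have := h2.1 j; positivity
      · rw [dotProduct_smul, dotProduct_add, h1.2, h2.2, smul_eq_mul]; ring
    have key : tight A α ((1 / 2 : ℝ) • (x + y)) ⊆ tight A α x ∩ tight A α y := by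
      intro j hj
      have h0 : pair (A j) ((1 / 2 : ℝ) • (x + y)) + α j = 0 := hj
      rw [pair_midpoint_add] at h0
      have h1 := hfP x hx j; have h2 := hfP y hy j
      exact ⟨show _ = _ by linarith, show _ = _ by linarith⟩
    exact (hmin hz (key.trans Set.inter_subset_left)).trans (key.trans Set.inter_subset_right)
  · rintro ⟨x, hx, rfl⟩
    refine ⟨_, isPolyhedronFace_tight hx, le_antisymm ?_ fun ν hν => ?_⟩
    · rw [normalCone_singleton hx]
      exact coneOf_le_normalCone fun y hy => hy.2
    · rw [mem_normalCone_singleton]; exact hν x ⟨hx, subset_rfl⟩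

/-- Such a `ν` is constant on `P`, yet moving an interior point by `ε • ν` changes it by `ε` times
the squared length of `ν`. -/
lemma salient_normalCone {P : Set (ι → ℝ)} (hP : (interior P).Nonempty) {f : Set (ι → ℝ)}
    (hf : f.Nonempty) {ν : ι → ℝ} (h : ν ∈ normalCone P f) (h' : -ν ∈ normalCone P f) : ν = 0 := by
  obtain ⟨x, hx⟩ := hf
  obtain ⟨y, hy⟩ := hP
  have hconst : ∀ η ∈ P, ν ⬝ᵥ η = ν ⬝ᵥ x := fun η hη => by
    have h1 := h x hx η hη
    have h2 := h' x hx η hη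
    simp only [neg_dotProduct] at h2
    linarith
  have hc : Continuous fun ε : ℝ => y + ε • ν := by fun_prop
  have hev : ∀ᶠ ε : ℝ in nhdsWithin 0 (Set.Ioi 0), y + ε • ν ∈ interior P :=
    nhdsWithin_le_nhds (hc.continuousAt.eventually_mem
      (isOpen_interior.mem_nhds (by simpa using hy)))
  obtain ⟨ε, h1, h2⟩ := (hev.and self_mem_nhdsWithin).exists
  have h3 := hconst _ (interior_subset h1)
  rw [dotProduct_add, hconst _ (interior_subset hy), dotProduct_smul, smul_eq_mul,
    add_eq_left] at h3
  exact dotProduct_self_eq_zero.1 ((mul_eq_zero.1 h3).resolve_left (ne_of_gt h2))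

/-- On a row tight at `x`, the vector `y - x` takes the value of the slack at `y`: nonnegative, and
zero exactly if the row is tight at `y` too. A lattice vector with the same signs is the supporting
covector. -/
lemma isFace_inf_normalCone [Finite τ] {x : ι → ℝ} (hx : x ∈ polyhedron A α) {y : ι → ℝ}
    (hy : y ∈ polyhedron A α) :
    IsFace (normalCone (polyhedron A α) {x} ⊓ normalCone (polyhedron A α) {y})
      (normalCone (polyhedron A α) {x}) := by
  classical
  have := Fintype.ofFinite τ
  obtain ⟨u, hu⟩ := exists_int_same_sign (fun j : tight A α x => A j) (y - x)
  have hyx : ∀ j ∈ tight A α x, pair (A j) (y - x) = pair (A j) y + α j := by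
    intro j hj
    have h0 : pair (A j) x + α j = 0 := hj
    rw [pair_eq_dotProduct, dotProduct_sub, ← pair_eq_dotProduct, ← pair_eq_dotProduct]
    linarith
  have hcomm : ∀ j, pair u (toReal (A j)) = ((A j ⬝ᵥ u : ℤ) : ℝ) := fun j => by
    rw [pair_toReal, dotProduct_comm]
  have hzero : ∀ j ∈ tight A α x, j ∈ tight A α y → pair u (toReal (A j)) = 0 := by
    intro j hj hj'
    rw [hcomm, (hu ⟨j, hj⟩).1 ((hyx j hj).trans hj'), Int.cast_zero]
  have hpos : ∀ j ∈ tight A α x, j ∉ tight A α y → 0 < pair u (toReal (A j)) := by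
    intro j hj hj'
    rw [hcomm, Int.cast_pos]
    refine (hu ⟨j, hj⟩).2 ?_
    rw [hyx j hj]
    exact pos_of_notMem_tight hy hj'
  have hnonneg : ∀ j ∈ tight A α x, 0 ≤ pair u (toReal (A j)) := fun j hj => by
    by_cases h : j ∈ tight A α y
    exacts [(hzero j hj h).ge, (hpos j hj h).le]
  refine ⟨u, fun v hv => ?_, fun v => ?_⟩
  · rw [normalCone_singleton hx] at hv
    obtain ⟨c, h1, h2, rfl⟩ := mem_coneOf_image.1 hv
    rw [pair_sum_smul u c A]
    refine Finset.sum_nonneg fun j _ => ?_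
    by_cases hj : j ∈ tight A α x
    · exact mul_nonneg (h1 j) (hnonneg j hj)
    · rw [h2 j hj, zero_mul]
  · constructor
    · rintro ⟨hv, hv'⟩
      refine ⟨hv, ?_⟩
      have hv0 := hv
      rw [normalCone_singleton hx] at hv
      obtain ⟨c, h1, h2, rfl⟩ := mem_coneOf_image.1 hv
      rw [SetLike.mem_coe, mem_normalCone_singleton] at hv0 hv'
      have e : (∑ j, c j • toReal (A j)) ⬝ᵥ (y - x) = 0 := by
        rw [dotProduct_sub]
        have := hv0 y hy
        have := hv' x hx
        linarith
      rw [sum_dotProduct] at e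
      have e' := (Finset.sum_eq_zero_iff_of_nonneg (fun j _ => ?_)).1 e
      · rw [pair_sum_smul u c A]
        refine Finset.sum_eq_zero fun j _ => ?_
        by_cases hj : j ∈ tight A α x
        · by_cases hj' : j ∈ tight A α y
          · rw [hzero j hj hj', mul_zero]
          · have h3 := e' j (Finset.mem_univ j)
            rw [smul_dotProduct, smul_eq_mul, ← pair_eq_dotProduct, hyx j hj] at h3
            rw [(mul_eq_zero.1 h3).resolve_right hj', zero_mul]
        · rw [h2 j hj, zero_mul]
      · rw [smul_dotProduct, smul_eq_mul, ← pair_eq_dotProduct]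
        by_cases hj : j ∈ tight A α x
        · rw [hyx j hj]; exact mul_nonneg (h1 j) (hy j)
        · rw [h2 j hj, zero_mul]
    · rintro ⟨hv, hv'⟩
      refine ⟨hv, ?_⟩
      rw [normalCone_singleton hx] at hv
      obtain ⟨c, h1, h2, rfl⟩ := mem_coneOf_image.1 hv
      rw [pair_sum_smul u c A] at hv'
      have e' := (Finset.sum_eq_zero_iff_of_nonneg (fun j _ => ?_)).1 hv'
      · rw [SetLike.mem_coe, normalCone_singleton hy]
        refine mem_coneOf_image.2 ⟨c, h1, fun j hj' => ?_, rfl⟩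
        by_cases hj : j ∈ tight A α x
        · exact (mul_eq_zero.1 (e' j (Finset.mem_univ j))).resolve_right (hpos j hj hj').ne'
        · exact h2 j hj
      · by_cases hj : j ∈ tight A α x
        · exact mul_nonneg (h1 j) (hnonneg j hj)
        · rw [h2 j hj, zero_mul]

/-- A small step from `x` along the covector `u` of the face keeps tight exactly the tight rows on
which `u` vanishes; the point reached has the face as its normal cone. -/
lemma face_mem_normalFan [Finite τ] {x : ι → ℝ} (hx : x ∈ polyhedron A α)
    {σ : PointedCone ℝ (ι → ℝ)} (h : IsFace σ (normalCone (polyhedron A α) {x})) :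
    ∃ y ∈ polyhedron A α, σ = normalCone (polyhedron A α) {y} := by
  obtain ⟨u, hu, hσ⟩ := h
  obtain ⟨ε, hε, h⟩ := exists_add_smul_pos hx (toReal u)
  have hrow : ∀ j ∈ tight A α x, 0 ≤ pair (A j) (toReal u) := fun j hj => by
    have := hu _ (toReal_mem_normalCone (f := {x}) (j := j) fun z hz => by
      rwa [Set.mem_singleton_iff.1 hz])
    rwa [pair_toReal, dotProduct_comm, ← pair_toReal] at this
  have hval : ∀ j ∈ tight A α x, pair (A j) (x + ε • toReal u) + α j =
      ε * pair (A j) (toReal u) := fun j hj => by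
    have h1 : pair (A j) x + α j = 0 := hj
    rw [pair_add_right, pair_smul_right]
    linarith
  have hy : x + ε • toReal u ∈ polyhedron A α := fun j => by
    by_cases hj : j ∈ tight A α x
    · rw [hval j hj]; exact mul_nonneg hε.le (hrow j hj)
    · exact (h j hj).le
  have hpair : ∀ v : ι → ℝ, v ⬝ᵥ toReal u = pair u v := fun v => dotProduct_comm _ _
  refine ⟨_, hy, le_antisymm (fun v hv => ?_) ?_⟩
  · obtain ⟨h1, h2⟩ := (hσ v).1 hv
    rw [mem_normalCone_singleton] at h1 ⊢
    rwa [dotProduct_add, dotProduct_smul, hpair, h2, smul_zero, add_zero]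
  · rw [normalCone_singleton hy]
    refine Submodule.span_le.2 ?_
    rintro _ ⟨_, ⟨j, hj, rfl⟩, rfl⟩
    have hjx : j ∈ tight A α x := by
      by_contra hjx
      exact (h j hjx).ne' hj
    refine (hσ _).2 ⟨toReal_mem_normalCone fun z hz => by rwa [Set.mem_singleton_iff.1 hz], ?_⟩
    have h3 := hval j hjx
    rw [show pair (A j) (x + ε • toReal u) + α j = 0 from hj, eq_comm, mul_eq_zero] at h3
    rw [pair_toReal, dotProduct_comm, ← pair_toReal]
    exact h3.resolve_left hε.ne'

lemma exists_finset_coneOf {ι τ : Type} [Finite τ] {A : Matrix τ ι ℤ} (T : Set τ) :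
    ∃ s : Finset (ι → ℤ), coneOf (A '' T) = coneOf (s : Set (ι → ℤ)) :=
  ⟨(T.toFinite.image A).toFinset, by rw [Set.Finite.coe_toFinset]⟩

/-- The inward normal fan of a polyhedral set with nonempty interior. -/
def polyhedralFan [Finite τ] (A : Matrix τ ι ℤ) (α : τ → ℝ)
    (hP : (interior (polyhedron A α)).Nonempty) : Fan ι where
  cones := normalFan (polyhedron A α)
  nonempty := by
    obtain ⟨x, hx⟩ := hP
    rw [normalFan_polyhedron]
    exact ⟨_, x, interior_subset hx, rfl⟩
  finite := by
    refine (Set.finite_range fun T : Set τ => coneOf (A '' T)).subset ?_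
    rw [normalFan_polyhedron]
    rintro _ ⟨x, hx, rfl⟩
    exact ⟨_, (normalCone_singleton hx).symm⟩
  rational := by
    rw [normalFan_polyhedron]
    rintro _ ⟨x, hx, rfl⟩
    rw [normalCone_singleton hx]
    exact exists_finset_coneOf _
  salient := by
    rintro _ ⟨f, hf, rfl⟩ v hv hv'
    exact salient_normalCone hP hf.1 hv hv'
  face := by
    rw [normalFan_polyhedron]
    rintro _ ⟨x, hx, rfl⟩ σ hσ
    exact face_mem_normalFan hx hσ
  inter := by
    rw [normalFan_polyhedron]
    rintro _ ⟨x, hx, rfl⟩ _ ⟨y, hy, rfl⟩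
    exact isFace_inf_normalCone hx hy

/-- Linear programming: a linear function in the cone spanned by the rows attains its minimum on
the polyhedral set. -/
lemma exists_mem_normalCone [Finite τ] (hP : (polyhedron A α).Nonempty) {w : ι → ℝ}
    (hw : w ∈ coneOf (Set.range A)) :
    ∃ x ∈ polyhedron A α, w ∈ normalCone (polyhedron A α) {x} := by
  classical
  have := Fintype.ofFinite τ
  have hw' : w ∈ coneOf (A '' Set.univ) := Set.image_univ (f := A) ▸ hw
  obtain ⟨c, hc, -, rfl⟩ := mem_coneOf_image.1 hw'
  set w := ∑ j, c j • toReal (A j) with hwdef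
  have hbdd : BddBelow ((fun x => w ⬝ᵥ x) '' polyhedron A α) := by
    refine ⟨-∑ j, c j * α j, ?_⟩
    rintro _ ⟨x, hx, rfl⟩
    have h1 : 0 ≤ ∑ j, c j * (pair (A j) x + α j) :=
      Finset.sum_nonneg fun j _ => mul_nonneg (hc j) (hx j)
    simp only [mul_add, Finset.sum_add_distrib] at h1
    have h2 : w ⬝ᵥ x = ∑ j, c j * pair (A j) x := by
      rw [hwdef, sum_dotProduct]
      exact Finset.sum_congr rfl fun j _ => by rw [smul_dotProduct, smul_eq_mul]; rfl
    simp only [h2]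
    linarith
  set β := sInf ((fun x => w ⬝ᵥ x) '' polyhedron A α) with hβ
  have hβle : ∀ x ∈ polyhedron A α, β ≤ w ⬝ᵥ x := fun x hx => csInf_le hbdd ⟨x, hx, rfl⟩
  by_contra! hcon
  have hno : ∀ x ∈ polyhedron A α, w ⬝ᵥ x ≠ β := fun x hx h => hcon x hx (by
    rw [mem_normalCone_singleton, h]; exact hβle)
  -- Homogenised system in `(x, h)`: `h ≥ 0`, `β h - w ⬝ᵥ x ≥ 0`, `A x + α h ≥ 0`. A solution with
  -- `h > 0` would rescale to a minimum, so these constraints imply `-h ≥ 0`. The Farkas certificate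
  -- evaluated at `h = 1` bounds `w ⬝ᵥ x - β` below by a positive constant, which contradicts the
  -- choice of `β` as infimum.
  let F : Option (Option τ) → ((ι → ℝ) × ℝ) →ₗ[ℝ] ℝ := fun o =>
    o.elim (LinearMap.snd ℝ _ ℝ) fun o' =>
      o'.elim (β • LinearMap.snd ℝ _ ℝ - (dotProductBilin ℝ ℝ w).comp (LinearMap.fst ℝ _ ℝ))
        fun j => (dotProductBilin ℝ ℝ (toReal (A j))).comp (LinearMap.fst ℝ _ ℝ) +
          α j • LinearMap.snd ℝ _ ℝ
  obtain ⟨y, hy, e⟩ := farkas Finset.univ F (-LinearMap.snd ℝ _ ℝ) (by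
    rintro ⟨x, h⟩ hx
    have h0 : 0 ≤ h := hx none (Finset.mem_univ _)
    have h1 : 0 ≤ β * h - w ⬝ᵥ x := hx (some none) (Finset.mem_univ _)
    have h2 : ∀ j, 0 ≤ pair (A j) x + α j * h := fun j => hx (some (some j)) (Finset.mem_univ _)
    change 0 ≤ -h
    by_contra! hlt
    have hpos : 0 < h := by linarith
    have hm : h⁻¹ • x ∈ polyhedron A α := fun j => by
      rw [pair_smul_right]
      have := mul_nonneg (inv_nonneg.2 h0) (h2 j)
      rw [mul_add, mul_left_comm, inv_mul_cancel₀ hpos.ne', mul_one] at this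
      exact this
    refine hno _ hm (le_antisymm ?_ (hβle _ hm))
    have := mul_nonneg (inv_nonneg.2 h0) h1
    rw [mul_sub, mul_left_comm, inv_mul_cancel₀ hpos.ne', mul_one] at this
    rw [dotProduct_smul, smul_eq_mul]
    linarith)
  have hkey : ∀ x ∈ polyhedron A α, 1 ≤ y (some none) * (w ⬝ᵥ x - β) := by
    intro x hx
    have h1 := LinearMap.congr_fun e (x, 1)
    simp only [LinearMap.neg_apply, LinearMap.snd_apply, LinearMap.sum_apply,
      LinearMap.smul_apply, smul_eq_mul, Fintype.sum_option, F, Option.elim_none,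
      Option.elim_some, LinearMap.sub_apply, LinearMap.add_apply, LinearMap.comp_apply,
      LinearMap.fst_apply, dotProductBilin_apply_apply, mul_one] at h1
    have h2 : 0 ≤ ∑ j, y (some (some j)) * (toReal (A j) ⬝ᵥ x + α j) :=
      Finset.sum_nonneg fun j _ => mul_nonneg (hy _) (hx j)
    have h3 := hy none
    linarith
  obtain ⟨x₀, hx₀⟩ := hP
  have hz : 0 < y (some none) := by
    refine lt_of_le_of_ne (hy _) fun h => ?_
    have := hkey x₀ hx₀
    rw [← h, zero_mul] at this
    linarith
  have : β + (y (some none))⁻¹ ≤ β := by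
    refine le_csInf ⟨_, x₀, hx₀, rfl⟩ ?_
    rintro _ ⟨x, hx, rfl⟩
    have := mul_le_mul_of_nonneg_left (hkey x hx) (inv_nonneg.2 hz.le)
    rw [mul_one, ← mul_assoc, inv_mul_cancel₀ hz.ne', one_mul] at this
    simp only
    linarith
  have := inv_pos.2 hz
  linarith

/-- The characters that are regular on the toric variety of the normal fan of `{A ξ + α ≥ 0}` are
those in its recession cone. -/
lemma mem_regularChars_iff [Finite τ] {X : Fan ι} (hX : X.cones = normalFan (polyhedron A α))
    (hP : (polyhedron A α).Nonempty) {m : ι → ℤ} :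
    m ∈ X.regularChars ↔ ∀ j, 0 ≤ A j ⬝ᵥ m := by
  have hcomm : ∀ j, pair m (toReal (A j)) = ((A j ⬝ᵥ m : ℤ) : ℝ) := fun j => by
    rw [pair_toReal, dotProduct_comm]
  constructor
  · intro hm j
    -- Each row is bounded below on the polyhedral set, hence attains its minimum there and lies in
    -- a cone of the fan.
    obtain ⟨x, hx, hxj⟩ := exists_mem_normalCone hP (toReal_mem_coneOf (Set.mem_range_self j))
    have hmem : normalCone (polyhedron A α) {x} ∈ X.cones := by
      rw [hX, normalFan_polyhedron]; exact ⟨x, hx, rfl⟩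
    have := X.regularChars_le ⟨_, hmem⟩ hm _ hxj
    rw [hcomm] at this
    exact_mod_cast this
  · intro hm
    refine (AddSubmonoid.mem_iInf).2 ?_
    rintro ⟨σ, hσ⟩ v hv
    have hσ' := hσ
    rw [hX, normalFan_polyhedron] at hσ'
    obtain ⟨x, hx, rfl⟩ := hσ'
    change v ∈ normalCone (polyhedron A α) {x} at hv
    rw [normalCone_singleton hx] at hv
    have := Fintype.ofFinite τ
    obtain ⟨c, h1, -, rfl⟩ := mem_coneOf_image.1 hv
    rw [pair_sum_smul m c A]
    refine Finset.sum_nonneg fun j _ => mul_nonneg (h1 j) ?_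
    rw [hcomm j]
    exact_mod_cast hm j

/-- The support of the normal fan is dual to the semigroup of the regular characters. -/
lemma exists_cone_of_nonneg_regularChars [Finite τ] {X : Fan ι}
    (hX : X.cones = normalFan (polyhedron A α)) (hP : (polyhedron A α).Nonempty) {w : ι → ℤ}
    (hw : ∀ m ∈ X.regularChars, 0 ≤ w ⬝ᵥ m) : ∃ σ ∈ X.cones, toReal w ∈ σ := by
  obtain ⟨x, hx, h⟩ := exists_mem_normalCone hP
    (toReal_mem_coneOf_range fun u hu => hw u ((mem_regularChars_iff hX hP).2 hu))
  refine ⟨_, ?_, h⟩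
  rw [hX, normalFan_polyhedron]
  exact ⟨x, hx, rfl⟩

/-- If the polyhedral set is a translated cone, its normal fan has a greatest cone. -/
lemma exists_greatest_cone [Finite τ] {X : Fan ι} (hX : X.cones = normalFan (polyhedron A α))
    {x : ι → ℝ} (hx : ∀ j, pair (A j) x + α j = 0) : ∃ σ ∈ X.cones, ∀ σ' ∈ X.cones, σ' ≤ σ := by
  have hx' : x ∈ polyhedron A α := fun j => (hx j).ge
  refine ⟨normalCone (polyhedron A α) {x}, ?_, ?_⟩
  · rw [hX, normalFan_polyhedron]
    exact ⟨x, hx', rfl⟩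
  · rw [hX, normalFan_polyhedron]
    rintro _ ⟨y, hy, rfl⟩
    rw [normalCone_singleton hx', normalCone_singleton hy]
    exact coneOf_mono (Set.image_mono fun j _ => hx j)

end NormalFan

/-! ### Monoid algebras of monoids of characters -/

section MonoidAlgebra

variable {ι : Type} {S : AddSubmonoid (ι → ℤ)}

lemma toLaurent_single (s : S) (c : ℂ) :
    toLaurent S (AddMonoidAlgebra.single s c) = AddMonoidAlgebra.single (s : ι → ℤ) c := by
  simp [toLaurent]

lemma toLaurent_injective (S : AddSubmonoid (ι → ℤ)) : Function.Injective (toLaurent S) :=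
  AddMonoidAlgebra.mapDomain_injective Subtype.val_injective

lemma coeff_toLaurent (g : AddMonoidAlgebra ℂ S) :
    (toLaurent S g).coeff = Finsupp.mapDomain Subtype.val g.coeff := rfl

lemma coeff_toLaurent_apply (g : AddMonoidAlgebra ℂ S) (s : S) :
    (toLaurent S g).coeff s = g.coeff s := by
  rw [coeff_toLaurent, Finsupp.mapDomain_apply Subtype.val_injective]

lemma mem_of_coeff_toLaurent_ne_zero {g : AddMonoidAlgebra ℂ S} {m : ι → ℤ}
    (h : (toLaurent S g).coeff m ≠ 0) : m ∈ S := by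
  by_contra hm
  refine h ?_
  rw [coeff_toLaurent, Finsupp.mapDomain_of_notMem_range]
  simpa using hm

lemma coeff_single_one_mul_apply {M : Type} [AddCommGroup M] (m μ : M)
    (f : AddMonoidAlgebra ℂ M) :
    (AddMonoidAlgebra.single m 1 * f).coeff μ = f.coeff (μ - m) := by
  have := AddMonoidAlgebra.coeff_single_mul_apply f (1 : ℂ) m μ
  rw [this, one_mul, neg_add_eq_sub]

/-- The elements of `χ^m ℂ[S]` are characterized by their terms. -/
lemma exists_eq_single_mul_toLaurent_iff {m : ι → ℤ} {f : AddMonoidAlgebra ℂ (ι → ℤ)} :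
    (∃ g : AddMonoidAlgebra ℂ S, f = AddMonoidAlgebra.single m 1 * toLaurent S g) ↔
      ∀ μ, f.coeff μ ≠ 0 → μ - m ∈ S := by
  constructor
  · rintro ⟨g, rfl⟩ μ hμ
    rw [coeff_single_one_mul_apply] at hμ
    exact mem_of_coeff_toLaurent_ne_zero hμ
  · intro h
    refine ⟨∑ μ ∈ f.coeff.support.attach,
      AddMonoidAlgebra.single ⟨μ - m, h μ (Finsupp.mem_support_iff.1 μ.2)⟩ (f.coeff μ), ?_⟩
    rw [map_sum, Finset.mul_sum]
    simp only [toLaurent_single, AddMonoidAlgebra.single_mul_single, one_mul, add_sub_cancel]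
    rw [Finset.sum_attach f.coeff.support fun μ => AddMonoidAlgebra.single μ (f.coeff μ)]
    exact (AddMonoidAlgebra.sum_coeff_single f).symm

end MonoidAlgebra

/-! ### Smooth cones and their rays -/

section Rays

variable {ι : Type}

/-- Two primitive lattice vectors on the same half-line are equal. -/
lemma eq_of_primitive {b u : ι → ℤ} (hb : ∀ (k : ℤ) (v : ι → ℤ), b = k • v → IsUnit k)
    (hu : ∀ (k : ℤ) (v : ι → ℤ), u = k • v → IsUnit k) {c : ℝ} (hc : 0 ≤ c)
    (h : toReal b = c • toReal u) : b = u := by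
  have hi : ∀ i, (b i : ℝ) = c * u i := fun i => congrFun h i
  have hu0 : u ≠ 0 := by
    rintro rfl
    exact not_isUnit_zero (hu 0 0 (by simp))
  obtain ⟨k, hk⟩ := Function.ne_iff.1 hu0
  have hk : u k ≠ 0 := hk
  have hmul : ∀ i, u k * b i = b k * u i := fun i => by
    have : ((u k * b i : ℤ) : ℝ) = ((b k * u i : ℤ) : ℝ) := by
      push_cast
      rw [hi i, hi k]; ring
    exact_mod_cast this
  -- Dividing by the gcd turns proportionality into `p b = q u` with `p`, `q` coprime. Then `p`
  -- divides `u` and `q` divides `b`, so both are units by primitivity, and `c ≥ 0` makes their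
  -- signs agree.
  obtain ⟨g, p, q, hg, hpq, e1, e2⟩ := Int.exists_gcd_one' (Int.gcd_pos_of_ne_zero_left (b k) hk)
  have hg : (g : ℤ) ≠ 0 := by exact_mod_cast hg.ne'
  have hcop : IsCoprime p q := Int.isCoprime_iff_gcd_eq_one.2 hpq
  have hpq' : ∀ i, p * b i = q * u i := fun i => by
    have := hmul i
    rw [e1, e2] at this
    refine mul_right_cancel₀ hg ?_
    linarith
  have hp : IsUnit p := by
    have h1 : ∀ i, p ∣ u i := fun i => hcop.dvd_of_dvd_mul_left ⟨b i, (hpq' i).symm⟩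
    choose v hv using h1
    exact hu p v (funext hv)
  have hq : IsUnit q := by
    have h1 : ∀ i, q ∣ b i := fun i => hcop.symm.dvd_of_dvd_mul_left ⟨u i, hpq' i⟩
    choose v hv using h1
    exact hb q v (funext hv)
  have hsame : p = q := by
    have h1 : (q : ℝ) = c * p := by
      have h2 := hi k
      have h3 : ((u k : ℤ) : ℝ) = p * (g : ℤ) := by rw [e1]; push_cast; rfl
      have h4 : ((b k : ℤ) : ℝ) = q * (g : ℤ) := by rw [e2]; push_cast; rfl
      have h5 : ((g : ℤ) : ℝ) ≠ 0 := by exact_mod_cast hg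
      refine mul_right_cancel₀ h5 ?_
      rw [← h4, h2, h3, mul_assoc]
    rcases Int.isUnit_iff.1 hp with rfl | rfl <;> rcases Int.isUnit_iff.1 hq with rfl | rfl <;>
      push_cast at h1 <;> first | rfl | (exfalso; linarith)
  funext i
  have := hpq' i
  rw [hsame] at this
  exact mul_left_cancel₀ hq.ne_zero this

/-- The covector that computes a coordinate with respect to a basis of the lattice. -/
def coordVec {ι : Type} [Fintype ι] (b : Module.Basis ι ℤ (ι → ℤ)) (i : ι) : ι → ℤ :=
  open Classical in fun k => b.repr (Pi.single k 1) i

variable [Fintype ι]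

lemma coordVec_dotProduct (b : Module.Basis ι ℤ (ι → ℤ)) (i : ι) (v : ι → ℤ) :
    coordVec b i ⬝ᵥ v = b.repr v i := by
  classical
  conv_rhs => rw [pi_eq_sum_univ' v]
  simp only [map_sum, map_smul, Finsupp.coe_finsetSum, Finset.sum_apply, Finsupp.smul_apply,
    smul_eq_mul, dotProduct, coordVec]
  refine Finset.sum_congr rfl fun k _ => ?_
  rw [mul_comm]

lemma coordVec_basis [DecidableEq ι] (b : Module.Basis ι ℤ (ι → ℤ)) (i k : ι) :
    coordVec b i ⬝ᵥ b k = if k = i then 1 else 0 := by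
  rw [coordVec_dotProduct, b.repr_self, Finsupp.single_apply]

lemma basis_primitive (b : Module.Basis ι ℤ (ι → ℤ)) (i : ι) (k : ℤ) (v : ι → ℤ)
    (h : b i = k • v) : IsUnit k := by
  classical
  have := coordVec_basis b i i
  rw [h, dotProduct_smul, if_pos rfl, smul_eq_mul] at this
  exact IsUnit.of_mul_eq_one _ this

lemma pair_coordVec (b : Module.Basis ι ℤ (ι → ℤ)) (i : ι) (c : ι → ℝ) :
    pair (coordVec b i) (∑ k, c k • toReal (b k)) = c i := by
  classical
  rw [pair_sum_smul (coordVec b i) c b]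
  simp [pair_toReal, coordVec_basis]

lemma mem_coneOf_singleton {ι : Type} {x : ι → ℤ} {v : ι → ℝ} :
    v ∈ coneOf {x} ↔ ∃ c : ℝ, 0 ≤ c ∧ v = c • toReal x := by
  rw [coneOf, Set.image_singleton, Submodule.mem_span_singleton]
  constructor
  · rintro ⟨c, rfl⟩
    exact ⟨c, c.2, rfl⟩
  · rintro ⟨c, hc, rfl⟩
    exact ⟨⟨c, hc⟩, rfl⟩

lemma toReal_ne_zero {ι : Type} {x : ι → ℤ} (hx : x ≠ 0) : toReal x ≠ 0 := by
  obtain ⟨i, hi⟩ := Function.ne_iff.1 hx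
  intro h
  exact hi (by simpa [toReal] using congrFun h i)

lemma finrank_span_coneOf_singleton {ι : Type} {x : ι → ℤ} (hx : x ≠ 0) :
    Module.finrank ℝ (Submodule.span ℝ (coneOf {x} : Set (ι → ℝ))) = 1 := by
  have : Submodule.span ℝ (coneOf {x} : Set (ι → ℝ)) = Submodule.span ℝ {toReal x} := by
    refine le_antisymm (Submodule.span_le.2 fun v hv => ?_) (Submodule.span_mono ?_)
    · obtain ⟨c, -, rfl⟩ := mem_coneOf_singleton.1 hv
      exact Submodule.smul_mem _ _ (Submodule.mem_span_singleton_self _)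
    · rintro _ rfl
      exact toReal_mem_coneOf rfl
  rw [this]
  exact finrank_span_singleton (toReal_ne_zero hx)

/-! ### Ray generators and sections of line bundles on a smooth complete fan. -/

namespace Fan

variable {Y : Fan ι} {ρ : Type} {u : ρ → ι → ℤ}

lemma IsRayEnum.cone_mem (hu : Y.IsRayEnum u) (r : ρ) : coneOf {u r} ∈ Y.cones := by
  have : coneOf {u r} ∈ Set.range fun r => coneOf {u r} := ⟨r, rfl⟩
  rw [← hu.2.2] at this
  exact this.1

/-- A basis vector spanning a ray of a cone of the fan is one of the primitive generators. -/
lemma IsRayEnum.exists_eq_basis (hu : Y.IsRayEnum u) {b : Module.Basis ι ℤ (ι → ℤ)} {s : Set ι}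
    (hσ : coneOf (b '' s) ∈ Y.cones) {i : ι} (hi : i ∈ s) : ∃ r, u r = b i := by
  classical
  have hface : IsFace (coneOf {b i}) (coneOf (b '' s)) := by
    have hval : ∀ c : ι → ℝ, pair (∑ k ∈ Finset.univ.erase i, coordVec b k)
        (∑ k, c k • toReal (b k)) = ∑ k ∈ Finset.univ.erase i, c k := by
      intro c
      have : ∀ T : Finset ι, pair (∑ k ∈ T, coordVec b k) (∑ k, c k • toReal (b k)) =
          ∑ k ∈ T, c k := by
        intro T
        induction T using Finset.induction_on with
        | empty => simp [pair_zero_left]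
        | insert k T hk ih => rw [Finset.sum_insert hk, Finset.sum_insert hk, pair_add_left, ih,
            pair_coordVec]
      exact this _
    -- The sum of the dual basis covectors other than the `i`-th is nonnegative on the cone and
    -- vanishes there only on the ray of `b i`.
    refine ⟨∑ k ∈ Finset.univ.erase i, coordVec b k, fun v hv => ?_, fun v => ?_⟩
    · obtain ⟨c, h1, -, rfl⟩ := mem_coneOf_image.1 hv
      rw [hval]
      exact Finset.sum_nonneg fun k _ => h1 k
    · constructor
      · intro hv
        refine ⟨coneOf_mono (Set.singleton_subset_iff.2 (Set.mem_image_of_mem b hi)) hv, ?_⟩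
        rw [← Set.image_singleton] at hv
        obtain ⟨c, h1, h2, rfl⟩ := mem_coneOf_image.1 hv
        rw [hval]
        exact Finset.sum_eq_zero fun k hk => h2 k (Finset.ne_of_mem_erase hk)
      · rintro ⟨hv, h0⟩
        obtain ⟨c, h1, h2, rfl⟩ := mem_coneOf_image.1 hv
        rw [hval, Finset.sum_eq_zero_iff_of_nonneg fun k _ => h1 k] at h0
        rw [← Set.image_singleton]
        exact mem_coneOf_image.2 ⟨c, h1, fun k hk => h0 k (Finset.mem_erase.2 ⟨hk, Finset.mem_univ _⟩),
          rfl⟩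
  have hmem : coneOf {b i} ∈ {σ | σ ∈ Y.cones ∧
      Module.finrank ℝ (Submodule.span ℝ (σ : Set (ι → ℝ))) = 1} :=
    ⟨Y.face _ hσ _ hface, finrank_span_coneOf_singleton (b.ne_zero i)⟩
  rw [hu.2.2] at hmem
  obtain ⟨r, hr⟩ := hmem
  have h1 : toReal (b i) ∈ coneOf {u r} := by
    simp only at hr
    rw [hr]; exact toReal_mem_coneOf rfl
  obtain ⟨c, hc, e⟩ := mem_coneOf_singleton.1 h1
  exact ⟨r, (eq_of_primitive (basis_primitive b i) (hu.2.1 r).2 hc e).symm⟩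

/-- The primitive ray generators in a smooth cone belong to its basis. -/
lemma IsRayEnum.exists_basis_eq (hu : Y.IsRayEnum u) {b : Module.Basis ι ℤ (ι → ℤ)} {s : Set ι}
    (hσ : coneOf (b '' s) ∈ Y.cones) {r : ρ} (hr : toReal (u r) ∈ coneOf (b '' s)) :
    ∃ i ∈ s, u r = b i := by
  have hle : coneOf {u r} ≤ coneOf (b '' s) := by
    refine Submodule.span_le.2 ?_
    rintro _ ⟨_, rfl, rfl⟩
    exact hr
  -- The ray of `u r` is a face of the cone. Any basis vector occurring in `u r` with nonzero
  -- coefficient lies on that face, that is, on the ray.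
  obtain ⟨w, hw, hτ⟩ := Y.isFace_of_le (τ := (⟨_, hu.cone_mem r⟩ : Y.cones)) (σ := (⟨_, hσ⟩ : Y.cones)) hle
  obtain ⟨c, h1, h2, e⟩ := mem_coneOf_image.1 hr
  have h0 : pair w (toReal (u r)) = 0 := ((hτ _).1 (toReal_mem_coneOf rfl)).2
  rw [e, pair_sum_smul w c b, Finset.sum_eq_zero_iff_of_nonneg] at h0
  swap
  · intro i _
    by_cases hi : i ∈ s
    · exact mul_nonneg (h1 i) (hw _ (toReal_mem_coneOf ⟨i, hi, rfl⟩))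
    · rw [h2 i hi, zero_mul]
  obtain ⟨i, hi⟩ : ∃ i, c i ≠ 0 := by
    by_contra! hall
    refine toReal_ne_zero (hu.2.1 r).1 ?_
    rw [e]
    exact Finset.sum_eq_zero fun i _ => by rw [hall i, zero_smul]
  have his : i ∈ s := by
    by_contra his
    exact hi (h2 i his)
  refine ⟨i, his, ?_⟩
  have hb : toReal (b i) ∈ coneOf {u r} := (hτ _).2 ⟨toReal_mem_coneOf ⟨i, his, rfl⟩,
    (mul_eq_zero.1 (h0 i (Finset.mem_univ i))).resolve_left hi⟩
  obtain ⟨c', hc', e'⟩ := mem_coneOf_singleton.1 hb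
  exact (eq_of_primitive (basis_primitive b i) (hu.2.1 r).2 hc' e').symm

/-- The ray generators in a smooth cone belong to a lattice basis, so the prescribed values are met
by a combination of dual basis covectors. Without such a generator the conditions defining sections
and base point freeness would be vacuous on the chart. -/
lemma exists_isLocalGenerator (hs : Y.IsSmooth) (hu : Y.IsRayEnum u) (a : ρ → ℤ) (σ : Y.cones) :
    ∃ m, Y.IsLocalGenerator u a σ m := by
  classical
  obtain ⟨σ, hσ⟩ := σ
  obtain ⟨b, s, rfl⟩ := hs σ hσ
  have hn : ∀ i, ∃ n : ℤ, ∀ r, u r = b i → n = a r := fun i => by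
    by_cases h : ∃ r, u r = b i
    · obtain ⟨r, hr⟩ := h
      exact ⟨a r, fun r' hr' => by rw [hu.1 (hr.trans hr'.symm)]⟩
    · exact ⟨0, fun r hr => (h ⟨r, hr⟩).elim⟩
  choose n hn using hn
  refine ⟨∑ i, (-n i) • coordVec b i, fun r hr => ?_⟩
  obtain ⟨i, hi, e⟩ := hu.exists_basis_eq hσ hr
  change (∑ i, (-n i) • coordVec b i) ⬝ᵥ u r = _
  rw [e, sum_dotProduct]
  simp only [smul_dotProduct, coordVec_basis, smul_eq_mul, mul_ite, mul_one, mul_zero,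
    Finset.sum_ite_eq, Finset.mem_univ, if_true]
  rw [hn i r e]

/-- The sections of `O(D)` are the Laurent polynomials with terms in the polytope of `D`. -/
lemma isSection_iff (hs : Y.IsSmooth) (hu : Y.IsRayEnum u) {a : ρ → ℤ}
    {f : AddMonoidAlgebra ℂ (ι → ℤ)} :
    Y.IsSection u a f ↔ ∀ μ, f.coeff μ ≠ 0 → ∀ r, -a r ≤ μ ⬝ᵥ u r := by
  simp only [IsSection, exists_eq_single_mul_toLaurent_iff]
  constructor
  · intro h μ hμ r
    obtain ⟨m, hm⟩ := exists_isLocalGenerator hs hu a ⟨_, hu.cone_mem r⟩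
    have h1 := h _ m hm μ hμ _ (toReal_mem_coneOf (Set.mem_singleton (u r)))
    rw [pair_toReal, sub_dotProduct,
      show m ⬝ᵥ u r = -a r from hm r (toReal_mem_coneOf (Set.mem_singleton (u r)))] at h1
    have h2 : 0 ≤ μ ⬝ᵥ u r - -a r := by exact_mod_cast h1
    linarith
  · rintro h ⟨σ, hσ⟩ m hm μ hμ v hv
    obtain ⟨b, s, rfl⟩ := hs σ hσ
    obtain ⟨c, h1, h2, rfl⟩ := mem_coneOf_image.1 hv
    rw [pair_sum_smul (μ - m) c b]
    refine Finset.sum_nonneg fun i _ => ?_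
    by_cases hi : i ∈ s
    · refine mul_nonneg (h1 i) ?_
      obtain ⟨r, hr⟩ := hu.exists_eq_basis hσ hi
      have h3 : m ⬝ᵥ u r = -a r := hm r (by rw [hr]; exact toReal_mem_coneOf ⟨i, hi, rfl⟩)
      have h4 := h μ hμ r
      rw [pair_toReal, ← hr, sub_dotProduct, h3]
      have : 0 ≤ μ ⬝ᵥ u r - -a r := by linarith
      exact_mod_cast this
    · rw [h2 i hi, zero_mul]

/-- The monomial sections of `O(D)`: the lattice points of the polytope of `D`. -/
lemma isSection_single_iff (hs : Y.IsSmooth) (hu : Y.IsRayEnum u) {a : ρ → ℤ} {μ : ι → ℤ} :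
    Y.IsSection u a (AddMonoidAlgebra.single μ 1) ↔ ∀ r, -a r ≤ μ ⬝ᵥ u r := by
  classical
  rw [isSection_iff hs hu]
  constructor
  · exact fun h => h μ (by simp)
  · intro h ν hν
    rw [AddMonoidAlgebra.coeff_single, Finsupp.single_apply] at hν
    split_ifs at hν with e
    · exact e ▸ h
    · exact (hν rfl).elim

/-- The distinguished point of an affine toric variety: the characters that are invertible take
the value `1`, the others the value `0`. -/
def distinguishedPoint (σ : PointedCone ℝ (ι → ℝ)) : chartRing σ →ₐ[ℂ] ℂ :=
  open Classical in
  AddMonoidAlgebra.lift ℂ ℂ (dualMonoid σ)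
    { toFun := fun s => if -(s.toAdd : ι → ℤ) ∈ dualMonoid σ then 1 else 0
      map_one' := if_pos (by simp)
      map_mul' := fun s t => by
        have key : -((s * t).toAdd : ι → ℤ) ∈ dualMonoid σ ↔
            -(s.toAdd : ι → ℤ) ∈ dualMonoid σ ∧ -(t.toAdd : ι → ℤ) ∈ dualMonoid σ := by
          rw [toAdd_mul, AddSubmonoid.coe_add, neg_add]
          constructor
          · intro h
            constructor
            · simpa using add_mem h t.toAdd.2
            · simpa using add_mem h s.toAdd.2
          · exact fun h => add_mem h.1 h.2
        by_cases h1 : -(s.toAdd : ι → ℤ) ∈ dualMonoid σ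
        · by_cases h2 : -(t.toAdd : ι → ℤ) ∈ dualMonoid σ
          · rw [if_pos h1, if_pos h2, if_pos (key.2 ⟨h1, h2⟩), one_mul]
          · rw [if_neg h2, if_neg fun h => h2 (key.1 h).2, mul_zero]
        · rw [if_neg h1, if_neg fun h => h1 (key.1 h).1, zero_mul] }

/-- If `O(D)` has no base points, it has on each chart a generator that is a global section. -/
lemma IsBasePointFree.exists_section (hs : Y.IsSmooth) (hu : Y.IsRayEnum u) {a : ρ → ℤ}
    (h : Y.IsBasePointFree u a) (σ : Y.cones) :
    ∃ μ, (∀ r, -a r ≤ μ ⬝ᵥ u r) ∧ ∀ r, toReal (u r) ∈ σ.1 → μ ⬝ᵥ u r = -a r := by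
  classical
  obtain ⟨m, hm⟩ := exists_isLocalGenerator hs hu a σ
  -- A section not vanishing at the distinguished point has a term `χ^{m+s}` with `χ^s` invertible
  -- on the chart. This term is itself a global section, and it generates the line bundle there.
  obtain ⟨g, hg, hx⟩ := h σ m hm (distinguishedPoint σ.1)
  rw [distinguishedPoint, AddMonoidAlgebra.lift_apply] at hx
  obtain ⟨s, hs1, hs2⟩ := Finset.exists_ne_zero_of_sum_ne_zero hx
  have hneg : -(s : ι → ℤ) ∈ dualMonoid σ.1 := by
    by_contra hn
    exact hs2 (by simp [hn])
  rw [isSection_iff hs hu] at hg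
  refine ⟨m + s, hg _ ?_, fun r hr => ?_⟩
  · rw [coeff_single_one_mul_apply, add_sub_cancel_left, coeff_toLaurent_apply]
    exact Finsupp.mem_support_iff.1 hs1
  · have h1 := s.2 _ hr
    have h2 := hneg _ hr
    rw [pair_toReal] at h1 h2
    have h1' : 0 ≤ (s : ι → ℤ) ⬝ᵥ u r := by exact_mod_cast h1
    have h2' : 0 ≤ (-(s : ι → ℤ)) ⬝ᵥ u r := by exact_mod_cast h2
    rw [neg_dotProduct] at h2'
    rw [add_dotProduct, show m ⬝ᵥ u r = -a r from hm r hr]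
    linarith

/-- In a smooth complete fan, every lattice vector is a nonnegative integral combination of the
ray generators of a single cone. -/
lemma exists_mem_closure (hs : Y.IsSmooth) (hc : Y.IsComplete) (hu : Y.IsRayEnum u) (v : ι → ℤ) :
    ∃ σ : Y.cones, v ∈ AddSubmonoid.closure (u '' {r | toReal (u r) ∈ σ.1}) := by
  obtain ⟨σ, hσ, hv⟩ := hc (toReal v)
  obtain ⟨b, s, rfl⟩ := hs σ hσ
  refine ⟨⟨_, hσ⟩, ?_⟩
  obtain ⟨c, h1, h2, e⟩ := mem_coneOf_image.1 hv
  have hrepr : ∀ i, ((b.repr v i : ℤ) : ℝ) = c i := fun i => by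
    rw [← coordVec_dotProduct, ← pair_toReal, e, pair_coordVec]
  rw [← b.sum_repr v]
  refine sum_mem fun i _ => ?_
  by_cases hi : i ∈ s
  · obtain ⟨r, hr⟩ := hu.exists_eq_basis hσ hi
    have hn : 0 ≤ b.repr v i := by
      have := h1 i
      rw [← hrepr] at this
      exact_mod_cast this
    obtain ⟨n, hn⟩ := Int.eq_ofNat_of_zero_le hn
    rw [hn, natCast_zsmul, ← hr]
    refine nsmul_mem (AddSubmonoid.subset_closure (Set.mem_image_of_mem u ?_)) n
    change toReal (u r) ∈ coneOf (b '' s)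
    rw [hr]
    exact toReal_mem_coneOf ⟨i, hi, rfl⟩
  · have : b.repr v i = 0 := by
      have := hrepr i
      rw [h2 i hi] at this
      exact_mod_cast this
    rw [this, zero_smul]
    exact zero_mem _

/-- On a smooth complete toric variety, a line bundle has finitely many monomial sections. -/
lemma finite_sections (hs : Y.IsSmooth) (hc : Y.IsComplete) (hu : Y.IsRayEnum u) (a : ρ → ℤ) :
    {μ : ι → ℤ | ∀ r, -a r ≤ μ ⬝ᵥ u r}.Finite := by
  classical
  -- Since `v` is an `ℕ`-combination of ray generators, pairing with `v` is bounded below on the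
  -- polytope. Taking `v` to be plus or minus the unit vectors encloses the polytope in a box.
  have hbound : ∀ v : ι → ℤ, ∃ C : ℤ, ∀ μ : ι → ℤ, (∀ r, -a r ≤ μ ⬝ᵥ u r) → C ≤ μ ⬝ᵥ v := by
    intro v
    obtain ⟨σ, hv⟩ := exists_mem_closure hs hc hu v
    induction hv using AddSubmonoid.closure_induction with
    | mem x hx =>
      obtain ⟨r, -, rfl⟩ := hx
      exact ⟨-a r, fun μ h => h r⟩
    | zero => exact ⟨0, fun μ _ => by simp⟩
    | add x y _ _ hx hy =>
      obtain ⟨C, hC⟩ := hx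
      obtain ⟨C', hC'⟩ := hy
      exact ⟨C + C', fun μ h => by rw [dotProduct_add]; exact add_le_add (hC μ h) (hC' μ h)⟩
  choose C hC using hbound
  refine (Set.finite_Icc (fun i => C (Pi.single i 1)) fun i => -C (-Pi.single i 1)).subset ?_
  intro μ hμ
  refine ⟨fun i => ?_, fun i => ?_⟩
  · simpa using hC (Pi.single i 1) μ hμ
  · have := hC (-Pi.single i 1) μ hμ
    rw [dotProduct_neg, dotProduct_single, mul_one] at this
    dsimp only
    linarith

end Fan

end Rays

/-! ### The cone dual to the terms of the superpotential -/

section Superpotential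

variable {ι κ : Type} [Fintype κ] [DecidableEq κ]

/-- The fibre degree `Pi.single j 1` separates the summands, so no terms cancel. -/
lemma coeff_sectionPotential (w : κ → AddMonoidAlgebra ℂ (ι → ℤ)) (j : κ) (μ : ι → ℤ) :
    (sectionPotential w).coeff (Sum.elim μ (Pi.single j 1)) = (w j).coeff μ := by
  rw [sectionPotential, AddMonoidAlgebra.coeff_sum, Finsupp.finsetSum_apply,
    Finset.sum_eq_single j]
  · rw [AddMonoidAlgebra.coeff_mapDomain]
    exact Finsupp.mapDomain_apply (fun μ ν h => (Sum.elim_eq_iff.1 h).1) _ _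
  · intro k _ hk
    rw [AddMonoidAlgebra.coeff_mapDomain, Finsupp.mapDomain_of_notMem_range]
    rintro ⟨ν, h⟩
    have h1 := congrFun (Sum.elim_eq_iff.1 h).2 k
    rw [Pi.single_eq_same, Pi.single_eq_of_ne hk] at h1
    exact one_ne_zero h1
  · simp

lemma exists_term_of_coeff_sectionPotential {w : κ → AddMonoidAlgebra ℂ (ι → ℤ)} {ξ : ι ⊕ κ → ℤ}
    (h : (sectionPotential w).coeff ξ ≠ 0) : ∃ j μ, ξ = Sum.elim μ (Pi.single j 1) := by
  by_contra! hcon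
  refine h ?_
  rw [sectionPotential, AddMonoidAlgebra.coeff_sum, Finsupp.finsetSum_apply]
  refine Finset.sum_eq_zero fun j _ => ?_
  rw [AddMonoidAlgebra.coeff_mapDomain, Finsupp.mapDomain_of_notMem_range]
  rintro ⟨μ, rfl⟩
  exact hcon j μ rfl

variable [Fintype ι]

/-- Every term has total fibre degree one, so the vector `(0, (C, …, C))` pairs to `C` with every
row. Here `C` is chosen to exceed all `|α k|`. -/
lemma interior_polyhedron_nonempty {τ : Type} [Finite τ] {A : Matrix τ (ι ⊕ κ) ℤ}
    (hA : ∀ k, ∃ j μ, A k = Sum.elim μ (Pi.single j 1)) (α : τ → ℝ) :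
    (interior (polyhedron A α)).Nonempty := by
  classical
  have := Fintype.ofFinite τ
  have hopen : IsOpen {x : ι ⊕ κ → ℝ | ∀ k, 0 < pair (A k) x + α k} := by
    simp only [Set.ofPred_forall]
    refine isOpen_iInter_of_finite fun k => isOpen_lt continuous_const ?_
    unfold pair
    fun_prop
  refine ⟨Sum.elim 0 fun _ => 1 + ∑ k, |α k|, interior_maximal (fun x hx k => (hx k).le) hopen ?_⟩
  intro k
  obtain ⟨j, μ, e⟩ := hA k
  have h1 : pair (A k) (Sum.elim 0 fun _ => 1 + ∑ k, |α k|) = 1 + ∑ k, |α k| := by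
    rw [e]
    simp [pair, Pi.single_apply]
  have h2 : |α k| ≤ ∑ k, |α k| :=
    Finset.single_le_sum (f := fun k => |α k|) (fun k _ => abs_nonneg _) (Finset.mem_univ k)
  have h3 := neg_abs_le (α k)
  rw [h1]
  linarith

variable {ρ : Type} {Y : Fan ι} {u : ρ → ι → ℤ} {D : κ → ρ → ℤ}

lemma sumElim_dotProduct_totRay_inl (μ : ι → ℤ) (j : κ) (r : ρ) :
    Sum.elim μ (Pi.single j 1) ⬝ᵥ totRay u D (Sum.inl r) = μ ⬝ᵥ u r + D j r := by
  simp [totRay, dotProduct, Pi.single_apply]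

lemma sumElim_dotProduct_totRay_inr (μ : ι → ℤ) (j k : κ) :
    Sum.elim μ (Pi.single j 1) ⬝ᵥ totRay u D (Sum.inr k) = if k = j then 1 else 0 := by
  simp [totRay, dotProduct, Pi.single_apply, eq_comm]

/-- The characters that pair nonnegatively with all terms of a generic superpotential are generated
by the ray generators of the total space. -/
lemma forall_term_nonneg_iff (hs : Y.IsSmooth) (hc : Y.IsComplete) (hu : Y.IsRayEnum u)
    (hgen : ∀ j, Y.IsBasePointFree u (D j)) {w : κ → AddMonoidAlgebra ℂ (ι → ℤ)}
    (hw : ∀ j, Y.IsSection u (D j) (w j))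
    (hw' : ∀ j μ, Y.IsSection u (D j) (AddMonoidAlgebra.single μ 1) → (w j).coeff μ ≠ 0)
    {m : ι ⊕ κ → ℤ} :
    (∀ ξ, (sectionPotential w).coeff ξ ≠ 0 → 0 ≤ ξ ⬝ᵥ m) ↔
      m ∈ AddSubmonoid.closure (Set.range (totRay u D)) := by
  constructor
  · intro h
    obtain ⟨σ, hσ⟩ := Fan.exists_mem_closure hs hc hu fun i => m (Sum.inl i)
    choose μ hμ hμ' using fun j => (hgen j).exists_section hs hu σ
    -- On the semigroup of `σ`, the additive map `v ↦ (v, (-(μ j ⬝ᵥ v))_j)` sends `u r` to the ray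
    -- generator over it, because `μ j ⬝ᵥ u r = -D j r`.
    have hgraph : ∀ v ∈ AddSubmonoid.closure (u '' {r | toReal (u r) ∈ σ.1}),
        (Sum.elim v fun j => -(μ j ⬝ᵥ v) : ι ⊕ κ → ℤ) ∈
          AddSubmonoid.closure (Set.range (totRay u D)) := by
      intro v hv
      induction hv using AddSubmonoid.closure_induction with
      | mem x hx =>
        obtain ⟨r, hr, rfl⟩ := hx
        refine AddSubmonoid.subset_closure ⟨Sum.inl r, ?_⟩
        ext (i | j)
        · rfl
        · simp [totRay, hμ' j r hr]
      | zero =>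
        convert zero_mem (AddSubmonoid.closure (Set.range (totRay u D)))
        ext (i | j) <;> simp
      | add x y _ _ hx hy =>
        convert add_mem hx hy using 1
        ext (i | j)
        · rfl
        · simp [dotProduct_add, add_comm]
    -- Genericity enters here: the section `μ j` gives a term of the superpotential. The resulting
    -- nonnegative integer is the multiplicity of the `j`-th fibre generator.
    have hnonneg : ∀ j, 0 ≤ m (Sum.inr j) + μ j ⬝ᵥ fun i => m (Sum.inl i) := by
      intro j
      have h1 := h (Sum.elim (μ j) (Pi.single j 1)) (by
        rw [coeff_sectionPotential]
        exact hw' j _ ((Fan.isSection_single_iff hs hu).2 (hμ j)))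
      simpa [dotProduct, Pi.single_apply, add_comm] using h1
    have hsplit : m = (Sum.elim (fun i => m (Sum.inl i))
          fun j => -(μ j ⬝ᵥ fun i => m (Sum.inl i)) : ι ⊕ κ → ℤ) +
        ∑ j, (m (Sum.inr j) + μ j ⬝ᵥ fun i => m (Sum.inl i)).toNat •
          totRay u D (Sum.inr j) := by
      ext (i | j)
      · simp [totRay, Finset.sum_apply]
      · simp [totRay, Finset.sum_apply, Pi.single_apply, hnonneg]
    rw [hsplit]
    exact add_mem (hgraph _ hσ) (sum_mem fun j _ => nsmul_mem
      (AddSubmonoid.subset_closure (Set.mem_range_self _)) _)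
  · intro h ξ hξ
    obtain ⟨j, μ, rfl⟩ := exists_term_of_coeff_sectionPotential hξ
    rw [coeff_sectionPotential] at hξ
    have hμ := (Fan.isSection_iff hs hu).1 (hw j) μ hξ
    induction h using AddSubmonoid.closure_induction with
    | mem x hx =>
      obtain ⟨r | k, rfl⟩ := hx
      · rw [sumElim_dotProduct_totRay_inl]
        linarith [hμ r]
      · rw [sumElim_dotProduct_totRay_inr]
        split_ifs <;> norm_num
    | zero => simp
    | add x y _ _ hx hy => rw [dotProduct_add]; exact add_nonneg hx hy

end Superpotential

/-! ### Cokernels with coefficients -/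

section Coker

variable {ι τ : Type} [Fintype ι] [Fintype τ]

lemma imCoker_cokerClass (A : Matrix τ ι ℤ) (c : τ → CmodZ) :
    imCoker A (cokerClass A c) = cokerClass A fun j => imCmodZ (c j) := by
  exact map_sum (imCoker A) _ _

lemma cokerClass_zero {G : Type} [AddCommGroup G] (A : Matrix τ ι ℤ) :
    cokerClass A (0 : τ → G) = 0 := by
  simp [cokerClass]

/-- The cokernel with real coefficients is the cokernel of the real linear map. -/
lemma exists_pair_eq_of_cokerClass_eq_zero {A : Matrix τ ι ℤ} {α : τ → ℝ}
    (h : cokerClass A α = 0) : ∃ x : ι → ℝ, ∀ j, pair (A j) x = α j := by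
  classical
  let L : (ι → ℝ) →ₗ[ℤ] (τ → ℝ) :=
    { toFun := fun x j => pair (A j) x
      map_add' := fun x y => funext fun j => pair_add_right _ _ _
      map_smul' := fun k x => funext fun j => by
        rw [← Int.cast_smul_eq_zsmul ℝ k x, pair_smul_right]
        simp }
  -- The pairing `(a, r) ↦ [r a]` kills the integral image in its first argument, so it descends to
  -- the tensor product and sends the class of `α` to its class modulo the real image.
  let Φ : (τ → ℤ) →ₗ[ℤ] ℝ →ₗ[ℤ] (τ → ℝ) ⧸ LinearMap.range L :=
    LinearMap.mk₂ ℤ (fun a r => Submodule.mkQ _ fun j => (a j : ℝ) * r)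
      (fun a a' r => by rw [← map_add]; congr 1; ext j; simp [add_mul])
      (fun k a r => by rw [← map_smul]; congr 1; ext j; simp [mul_assoc])
      (fun a r r' => by rw [← map_add]; congr 1; ext j; simp [mul_add])
      (fun k a r => by rw [← map_smul]; congr 1; ext j; simp [mul_left_comm])
  have hΦ : LinearMap.range A.mulVecLin ≤ LinearMap.ker Φ := by
    rintro _ ⟨v, rfl⟩
    rw [LinearMap.mem_ker]
    ext r
    refine (Submodule.Quotient.mk_eq_zero _).2 ⟨r • toReal v, ?_⟩
    ext j
    change pair (A j) (r • toReal v) = _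
    rw [pair_smul_right, pair_toReal, mul_comm]
    rfl
  have key : TensorProduct.lift (Submodule.liftQ _ Φ hΦ) (cokerClass A α) =
      Submodule.mkQ (LinearMap.range L) α := by
    simp only [cokerClass, map_sum, TensorProduct.lift.tmul, cokerMk, Submodule.mkQ_apply,
      Submodule.liftQ_apply]
    change ∑ j, Submodule.mkQ (LinearMap.range L) _ = Submodule.mkQ (LinearMap.range L) α
    rw [← map_sum]
    congr 1
    ext j
    simp [Finset.sum_apply, Pi.single_apply]
  rw [h, map_zero] at key
  obtain ⟨x, hx⟩ := (Submodule.Quotient.mk_eq_zero _).1 key.symm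
  exact ⟨x, fun j => congrFun hx j⟩

end Coker

/-! ### Homomorphisms of Laurent polynomial rings given by monomials -/

section Monomial

variable {τ M : Type} [Fintype τ] [AddCommGroup M]

/-- The homomorphism `χ^a ↦ exp(∑ a_k c_k) χ^{∑ a_k B_k}` of Laurent polynomial rings. -/
def monomialHom (c : τ → ℂ) (B : τ → M) : AddMonoidAlgebra ℂ (τ → ℤ) →ₐ[ℂ] AddMonoidAlgebra ℂ M :=
  AddMonoidAlgebra.lift ℂ _ (τ → ℤ)
    { toFun := fun a => AddMonoidAlgebra.single (∑ k, a.toAdd k • B k)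
        (Complex.exp (∑ k, (a.toAdd k : ℂ) * c k))
      map_one' := by simp [AddMonoidAlgebra.one_def]
      map_mul' := fun a b => by
        rw [AddMonoidAlgebra.single_mul_single, ← Complex.exp_add]
        simp [add_smul, add_mul, Finset.sum_add_distrib] }

lemma monomialHom_single (c : τ → ℂ) (B : τ → M) (a : τ → ℤ) (z : ℂ) :
    monomialHom c B (AddMonoidAlgebra.single a z) = AddMonoidAlgebra.single (∑ k, a k • B k)
      (z * Complex.exp (∑ k, (a k : ℂ) * c k)) := by
  rw [monomialHom, AddMonoidAlgebra.lift_single]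
  simp

/-- If the relations among the exponents are generated by the `a i - b i`, the kernel of a monomial
homomorphism is generated by the corresponding binomials. -/
theorem ker_monomialHom {I : Type} {c : τ → ℂ} {B : τ → M} {a b : I → τ → ℤ} {Q : I → ℂ}
    (hQ : ∀ i, Complex.exp (∑ k, (a i k : ℂ) * c k) = Q i * Complex.exp (∑ k, (b i k : ℂ) * c k))
    (hab : ∀ i, ∑ k, a i k • B k = ∑ k, b i k • B k)
    (hgen : ∀ v : τ → ℤ, ∑ k, v k • B k = 0 →
      v ∈ AddSubgroup.closure (Set.range fun i => a i - b i)) :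
    RingHom.ker (monomialHom c B) = Ideal.span (Set.range fun i =>
      (AddMonoidAlgebra.single (a i) 1 - AddMonoidAlgebra.single (b i) (Q i) :
        AddMonoidAlgebra ℂ (τ → ℤ))) := by
  classical
  set J := Ideal.span (Set.range fun i =>
      (AddMonoidAlgebra.single (a i) 1 - AddMonoidAlgebra.single (b i) (Q i) :
        AddMonoidAlgebra ℂ (τ → ℤ))) with hJ
  refine le_antisymm ?_ ?_
  · let E : (τ → ℤ) → ℂ := fun v => Complex.exp (∑ k, (v k : ℂ) * c k)
    let e : (τ → ℤ) → AddMonoidAlgebra ℂ (τ → ℤ) ⧸ J := fun v =>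
      Ideal.Quotient.mkₐ ℂ J (AddMonoidAlgebra.single v 1)
    have hE : ∀ v w, E (v + w) = E v * E w := fun v w => by
      simp only [E, ← Complex.exp_add, ← Finset.sum_add_distrib, ← add_mul, Pi.add_apply,
        Int.cast_add]
    have he : ∀ v w, e (v + w) = e v * e w := fun v w => by
      simp only [e, ← map_mul, AddMonoidAlgebra.single_mul_single, mul_one]
    have he0 : e 0 = 1 := by
      simp only [e, ← AddMonoidAlgebra.one_def, map_one]
    have hE0 : E 0 = 1 := by simp [E]
    have hen : ∀ v, e v * e (-v) = 1 := fun v => by rw [← he, add_neg_cancel, he0]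
    have hEn : ∀ v, E v * E (-v) = 1 := fun v => by rw [← hE, add_neg_cancel, hE0]
    have hmk : ∀ v z, Ideal.Quotient.mkₐ ℂ J (AddMonoidAlgebra.single v z) = z • e v := by
      intro v z
      rw [← map_smul, AddMonoidAlgebra.smul_single, smul_eq_mul, mul_one]
    -- Modulo `J`, a monomial whose exponent is a relation equals the scalar by which the
    -- homomorphism maps it.
    have hrel : ∀ v ∈ AddSubgroup.closure (Set.range fun i => a i - b i),
        e v = algebraMap ℂ _ (E v) := by
      intro v hv
      induction hv using AddSubgroup.closure_induction with
      | mem x hx =>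
        obtain ⟨i, rfl⟩ := hx
        have h1 : e (a i) = Q i • e (b i) := by
          rw [← hmk (b i), ← sub_eq_zero]
          simp only [e]
          rw [← map_sub]
          exact Ideal.Quotient.eq_zero_iff_mem.2 (Ideal.subset_span ⟨i, rfl⟩)
        have h2 : E (a i - b i) = Q i := by
          rw [sub_eq_add_neg, hE, show E (a i) = Q i * E (b i) from hQ i, mul_assoc, hEn, mul_one]
        dsimp only
        rw [h2, sub_eq_add_neg, he, h1, smul_mul_assoc, hen, Algebra.algebraMap_eq_smul_one]
      | zero => rw [he0, hE0, map_one]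
      | add x y _ _ hx hy => rw [he, hE, map_mul, hx, hy]
      | neg x _ hx =>
        calc e (-x) = algebraMap ℂ _ (E x * E (-x)) * e (-x) := by rw [hEn, map_one, one_mul]
          _ = algebraMap ℂ _ (E (-x)) * (e x * e (-x)) := by rw [map_mul, hx]; ring
          _ = _ := by rw [hen, mul_one]
    -- A choice of exponent over each attained value; the default `0` elsewhere is never used.
    let s : M → τ → ℤ := fun n => if h : ∃ v : τ → ℤ, ∑ k, v k • B k = n then h.choose else 0
    have hs : ∀ v : τ → ℤ, ∑ k, s (∑ k, v k • B k) k • B k = ∑ k, v k • B k := fun v => by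
      have h : ∃ v' : τ → ℤ, ∑ k, v' k • B k = ∑ k, v k • B k := ⟨v, rfl⟩
      simp only [s, dif_pos h]
      exact h.choose_spec
    -- A linear map through which the quotient map by `J` factors after the monomial homomorphism.
    -- Its existence puts the kernel inside `J`.
    let T : (M →₀ ℂ) →ₗ[ℂ] AddMonoidAlgebra ℂ (τ → ℤ) ⧸ J :=
      Finsupp.linearCombination ℂ fun n => E (-s n) • e (s n)
    have hT : ∀ f, Ideal.Quotient.mkₐ ℂ J f = T (monomialHom c B f).coeff := by
      intro f
      induction f using AddMonoidAlgebra.induction_linear with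
      | zero => simp
      | add f g hf hg => rw [map_add, map_add, AddMonoidAlgebra.coeff_add, map_add, hf, hg]
      | single v z =>
        rw [hmk, monomialHom_single, AddMonoidAlgebra.coeff_single]
        simp only [T, Finsupp.linearCombination_single]
        set w := s (∑ k, v k • B k) with hw
        have h1 : v - w ∈ AddSubgroup.closure (Set.range fun i => a i - b i) := by
          refine hgen _ ?_
          simp only [Pi.sub_apply, sub_smul, Finset.sum_sub_distrib, hw, hs, sub_self]
        have h2 : e v = E v • E (-w) • e w := by
          have h3 : e v = e (v - w) * e w := by rw [← he, sub_add_cancel]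
          rw [h3, hrel _ h1, sub_eq_add_neg, hE, ← Algebra.smul_def, mul_smul]
        rw [h2, mul_smul]
    intro f hf
    rw [RingHom.mem_ker] at hf
    have := hT f
    rw [show monomialHom c B f = 0 from hf, AddMonoidAlgebra.coeff_zero, map_zero] at this
    exact Ideal.Quotient.eq_zero_iff_mem.1 this
  · rw [hJ, Ideal.span_le]
    rintro _ ⟨i, rfl⟩
    rw [SetLike.mem_coe, RingHom.mem_ker, map_sub, monomialHom_single, monomialHom_single, hab,
      one_mul, hQ, sub_self]

lemma polyToLaurent_monomial [DecidableEq τ] (n : τ →₀ ℕ) (z : ℂ) :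
    polyToLaurent τ (MvPolynomial.monomial n z) =
      AddMonoidAlgebra.single (fun k => (n k : ℤ)) z := by
  rw [polyToLaurent, MvPolynomial.aeval_monomial, Finsupp.prod_fintype _ _ (by simp)]
  have h : ∀ T : Finset τ, ∏ k ∈ T, (AddMonoidAlgebra.single (Pi.single k (1 : ℤ)) (1 : ℂ) :
      AddMonoidAlgebra ℂ (τ → ℤ)) ^ n k =
      AddMonoidAlgebra.single (∑ k ∈ T, Pi.single k (n k : ℤ)) 1 := by
    intro T
    induction T using Finset.induction_on with
    | empty => simp [AddMonoidAlgebra.one_def]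
    | insert k T hk ih =>
      rw [Finset.prod_insert hk, Finset.sum_insert hk, ih, AddMonoidAlgebra.single_pow,
        AddMonoidAlgebra.single_mul_single, one_pow, one_mul]
      congr 2
      ext l
      simp [Pi.single_apply]
  rw [h, AddMonoidAlgebra.coe_algebraMap, Function.comp_apply, AddMonoidAlgebra.single_mul_single]
  simp [Finset.univ_sum_single]

lemma monomialHom_polyToLaurent_X [DecidableEq τ] (c : τ → ℂ) (B : τ → M) (k : τ) :
    monomialHom c B (polyToLaurent τ (MvPolynomial.X k)) =
      AddMonoidAlgebra.single (B k) (Complex.exp (c k)) := by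
  rw [polyToLaurent, MvPolynomial.aeval_X, monomialHom_single]
  simp [Pi.single_apply]

/-- Every Laurent polynomial is a polynomial up to a monomial. -/
lemma exists_polyToLaurent_eq [DecidableEq τ] (f : AddMonoidAlgebra ℂ (τ → ℤ)) :
    ∃ (n : τ →₀ ℕ) (g : MvPolynomial τ ℂ),
      polyToLaurent τ g = polyToLaurent τ (MvPolynomial.monomial n 1) * f := by
  induction f using AddMonoidAlgebra.induction_linear with
  | zero => exact ⟨0, 0, by simp⟩
  | add f g hf hg =>
    obtain ⟨n, p, hp⟩ := hf
    obtain ⟨n', p', hp'⟩ := hg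
    refine ⟨n + n', MvPolynomial.monomial n' 1 * p + MvPolynomial.monomial n 1 * p', ?_⟩
    have e : MvPolynomial.monomial (n + n') (1 : ℂ) =
        MvPolynomial.monomial n 1 * MvPolynomial.monomial n' 1 := by
      rw [MvPolynomial.monomial_mul, one_mul]
    rw [map_add, map_mul, map_mul, hp, hp', e, map_mul]
    ring
  | single a z =>
    -- Multiplying by the monomial with exponents `|a k|` makes all exponents `a k + |a k|`
    -- nonnegative.
    refine ⟨Finsupp.equivFunOnFinite.symm fun k => (a k).natAbs,
      MvPolynomial.monomial (Finsupp.equivFunOnFinite.symm fun k => (a k + (a k).natAbs).toNat) z,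
      ?_⟩
    rw [polyToLaurent_monomial, polyToLaurent_monomial, AddMonoidAlgebra.single_mul_single, one_mul]
    congr 1
    ext k
    simp only [Finsupp.equivFunOnFinite_symm_apply_apply, Pi.add_apply]
    omega

end Monomial

/-! ### Charges of the divisors and the ideal of Givental's mirror -/

section Charges

lemma sum_smul_totRay {ι κ ρ : Type} [Fintype κ] [Fintype ρ] [DecidableEq κ] (u : ρ → ι → ℤ)
    (D : κ → ρ → ℤ) (v : ρ ⊕ κ → ℤ) :
    ∑ k, v k • totRay u D k = Sum.elim (∑ r, v (Sum.inl r) • u r)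
      (fun j => ∑ r, v (Sum.inl r) * D j r + v (Sum.inr j)) := by
  ext (i | j)
  · simp [totRay, Finset.sum_apply]
  · simp [totRay, Finset.sum_apply, Pi.single_apply]

variable {ι κ ρ I : Type} [Fintype ι]
  {u : ρ → ι → ℤ} (p : Module.Basis I ℤ (coker (Matrix.of u)))

lemma charge_mulVec (i : I) (v : ι → ℤ) : charge u p i (Matrix.mulVec (Matrix.of u) v) = 0 := by
  have h : cokerMk (Matrix.of u) (Matrix.mulVec (Matrix.of u) v) = 0 :=
    (Submodule.Quotient.mk_eq_zero _).2 ⟨v, rfl⟩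
  rw [charge, h, map_zero, Finsupp.zero_apply]

variable [Fintype ρ] [DecidableEq ρ]

lemma charge_eq_sum (i : I) (a : ρ → ℤ) :
    charge u p i a = ∑ r, a r * charge u p i (Pi.single r 1) := by
  have h : ∀ a, charge u p i a =
      (((Finsupp.lapply i).comp p.repr.toLinearMap).comp (cokerMk (Matrix.of u))) a := fun _ => rfl
  simp only [h]
  conv_lhs => rw [pi_eq_sum_univ' a]
  rw [map_sum]
  exact Finset.sum_congr rfl fun r _ => by rw [map_smul, smul_eq_mul]

/-- Charges vanish on divisors of characters; for the coordinate characters this says that each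
charge vector is a relation among the rays. -/
lemma sum_charge_smul_ray (i : I) : ∑ r, charge u p i (Pi.single r 1) • u r = 0 := by
  classical
  ext k
  have h := charge_mulVec p i (Pi.single k 1)
  rw [charge_eq_sum] at h
  simpa [Finset.sum_apply, mul_comm] using h

variable {D : κ → ρ → ℤ} {m : I → ρ → ℤ} (hm : ∀ i r, m i r = charge u p i (Pi.single r 1))
  {d : I → κ → ℤ} (hd : ∀ i j, d i j = charge u p i (D j))

include hm hd in
lemma charge_divisor_eq_sum (i : I) (j : κ) : d i j = ∑ r, D j r * m i r := by
  rw [hd, charge_eq_sum]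
  simp only [hm]

variable [Fintype I]

/-- The relations among the ray generators of `Y` are generated by the charges. -/
lemma exists_eq_sum_charge {x : ρ → ℤ} (hx : ∑ r, x r • u r = 0) :
    ∃ n : I → ℤ, ∀ r, x r = ∑ i, n i * charge u p i (Pi.single r 1) := by
  -- A relation `x`, viewed as a functional on divisors, kills the principal ones and descends to
  -- the class group. Its values on the basis `p` are the coefficients sought.
  let l : (ρ → ℤ) →ₗ[ℤ] ℤ := dotProductBilin ℤ ℤ x
  have hl : LinearMap.range (Matrix.of u).mulVecLin ≤ LinearMap.ker l := by
    rintro _ ⟨v, rfl⟩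
    rw [LinearMap.mem_ker]
    change x ⬝ᵥ Matrix.mulVec (Matrix.of u) v = 0
    rw [Matrix.dotProduct_mulVec]
    have : Matrix.vecMul x (Matrix.of u) = 0 := by
      ext k
      have := congrFun hx k
      simpa [Matrix.vecMul, dotProduct, Finset.sum_apply] using this
    rw [this, zero_dotProduct]
  refine ⟨fun i => Submodule.liftQ _ l hl (p i), fun r => ?_⟩
  have h1 : x r = Submodule.liftQ _ l hl (cokerMk (Matrix.of u) (Pi.single r 1)) := by
    simp [cokerMk, l]
  rw [h1]
  conv_lhs => rw [← p.sum_repr (cokerMk (Matrix.of u) (Pi.single r 1))]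
  rw [map_sum]
  exact Finset.sum_congr rfl fun i _ => by rw [map_smul, smul_eq_mul, mul_comm]; rfl

variable [Fintype κ] [DecidableEq κ]

include hm

/-- The ideal of `H'_Q` is the kernel of the homomorphism `x_k ↦ exp(c_k) ξ'_k`. -/
lemma giventalIdeal_eq_ker {t : I → ℂ} {Q : I → ℂ} (hQ : ∀ i, Q i = Complex.exp (t i))
    {tHat : ρ → ℂ} (htHat : ∀ i, ∑ r, tHat r * m i r = t i) (hd : ∀ i j, d i j = charge u p i (D j)) :
    giventalIdeal m d Q = RingHom.ker ((monomialHom (Sum.elim tHat 0) (totRay u D)).comp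
      (polyToLaurent (ρ ⊕ κ))) := by
  have key := ker_monomialHom (c := (Sum.elim tHat 0 : ρ ⊕ κ → ℂ)) (B := totRay u D)
    (a := fun i => (Sum.elim (m i) 0 : ρ ⊕ κ → ℤ)) (b := fun i => Sum.elim 0 (d i)) (Q := Q)
    (fun i => by
      simp only [Fintype.sum_sum_type, Sum.elim_inl, Sum.elim_inr, Pi.zero_apply, Int.cast_zero,
        zero_mul, mul_zero, Finset.sum_const_zero, add_zero, Complex.exp_zero, mul_one]
      rw [hQ, ← htHat]
      simp only [mul_comm])
    (fun i => by
      rw [sum_smul_totRay, sum_smul_totRay]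
      ext (k | j)
      · simpa [hm] using congrFun (sum_charge_smul_ray p i) k
      · simp [charge_divisor_eq_sum p hm hd, mul_comm])
    -- The `ρ`-part of a relation is a relation among the rays of `Y`, hence a combination of
    -- charges; the fibre coordinates then determine the `κ`-part.
    (fun v hv => by
      rw [sum_smul_totRay] at hv
      have hv1 : ∑ r, v (Sum.inl r) • u r = 0 := by
        ext k
        exact congrFun hv (Sum.inl k)
      have hv2 : ∀ j, ∑ r, v (Sum.inl r) * D j r + v (Sum.inr j) = 0 := fun j =>
        congrFun hv (Sum.inr j)
      obtain ⟨n, hn⟩ := exists_eq_sum_charge p hv1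
      have e : v = ∑ i, n i • ((Sum.elim (m i) 0 : ρ ⊕ κ → ℤ) - (Sum.elim 0 (d i) : ρ ⊕ κ → ℤ)) := by
        ext (r | j)
        · simp [hn, hm, Finset.sum_apply]
        · rw [eq_neg_of_add_eq_zero_right (hv2 j)]
          simp only [hn, ← hm, Finset.sum_apply, Pi.smul_apply, Pi.sub_apply, Sum.elim_inr,
            Pi.zero_apply, zero_sub, smul_eq_mul, mul_neg, Finset.sum_neg_distrib,
            charge_divisor_eq_sum p hm hd, Finset.mul_sum, Finset.sum_mul]
          rw [Finset.sum_comm]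
          congr 1
          exact Finset.sum_congr rfl fun _ _ => Finset.sum_congr rfl fun _ _ => by ring
      rw [e]
      exact sum_mem fun i _ => zsmul_mem (AddSubgroup.subset_closure (Set.mem_range_self i)) _)
  rw [giventalIdeal, ← key]
  rfl

/-- `(-i tHat / 2π, 0)` is a lift of `K`. -/
lemma cokerClass_kahlerLift {t : I → ℂ} {tHat : ρ → ℂ} (htHat : ∀ i, ∑ r, tHat r * m i r = t i) :
    cokerClass (Matrix.of (totRay u D)) (fun k => (kahlerLift κ tHat k : CmodZ)) =
      kahlerClass u D p t := by
  have h1 : ∀ r, cokerMk (Matrix.of (totRay u D)) (Pi.single (Sum.inl r) 1) =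
      ∑ i, m i r • pullbackClass u D (p i) := by
    intro r
    have h2 : cokerMk (Matrix.of (totRay u D)) (Pi.single (Sum.inl r) 1) =
        pullbackClass u D (cokerMk (Matrix.of u) (Pi.single r 1)) := by
      change Submodule.Quotient.mk _ = Submodule.Quotient.mk _
      congr 1
      ext (r' | j) <;> simp [Pi.single_apply]
    rw [h2]
    conv_lhs => rw [← p.sum_repr (cokerMk (Matrix.of u) (Pi.single r 1))]
    rw [map_sum]
    exact Finset.sum_congr rfl fun i _ => by rw [map_smul, hm]; rfl
  have h3 : ∀ i, ((-Complex.I * t i / (2 * Real.pi) : ℂ) : CmodZ) =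
      ∑ r, m i r • ((-Complex.I * tHat r / (2 * Real.pi) : ℂ) : CmodZ) := by
    intro i
    have : (-Complex.I * t i / (2 * Real.pi) : ℂ) =
        ∑ r, m i r • (-Complex.I * tHat r / (2 * Real.pi) : ℂ) := by
      rw [← htHat, Finset.mul_sum, Finset.sum_div]
      exact Finset.sum_congr rfl fun r _ => by rw [zsmul_eq_mul]; ring
    rw [this]
    exact map_sum (QuotientAddGroup.mk' (AddSubgroup.zmultiples (1 : ℂ))) _ _
  have h4 : cokerClass (Matrix.of (totRay u D)) (fun k => (kahlerLift κ tHat k : CmodZ)) =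
      ∑ r, cokerMk (Matrix.of (totRay u D)) (Pi.single (Sum.inl r) 1) ⊗ₜ[ℤ]
        ((-Complex.I * tHat r / (2 * Real.pi) : ℂ) : CmodZ) := by
    rw [cokerClass, Fintype.sum_sum_type]
    simp only [kahlerLift, Sum.elim_inl, Sum.elim_inr, Pi.zero_apply]
    have h0 : ((0 : ℂ) : CmodZ) = 0 := rfl
    simp only [h0, TensorProduct.tmul_zero, Finset.sum_const_zero, add_zero]
    congr!
  rw [h4, kahlerClass]
  simp only [h1, h3, TensorProduct.sum_tmul, TensorProduct.tmul_sum]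
  rw [Finset.sum_comm]
  exact Finset.sum_congr rfl fun i _ => Finset.sum_congr rfl fun r _ =>
    TensorProduct.smul_tmul _ _ _

end Charges

/-- The factor `-i / 2π` of the lift cancels the `2πi` in the exponent. -/
lemma potential_kahlerLift {ι κ ρ : Type} [Fintype κ] [Fintype ρ]
    (B : Matrix (ρ ⊕ κ) ι ℤ) (tHat : ρ → ℂ) :
    potential B (kahlerLift κ tHat) =
      ∑ k, AddMonoidAlgebra.single (B k) (Complex.exp ((Sum.elim tHat 0 : ρ ⊕ κ → ℂ) k)) := by
  refine Finset.sum_congr rfl fun k _ => ?_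
  congr 2
  have hpi : (Real.pi : ℂ) ≠ 0 := by exact_mod_cast Real.pi_ne_zero
  rcases k with r | j
  · simp only [kahlerLift, Sum.elim_inl]
    have := Complex.I_sq
    field_simp
    linear_combination (-tHat r) * this
  · simp [kahlerLift]

/-! ### The mirror of Hori and Vafa -/

section HoriVafa

/-- Evaluation of Laurent polynomials at the point `exp z` of the torus. -/
def expEval {τ : Type} [Fintype τ] (z : τ → ℂ) : AddMonoidAlgebra ℂ (τ → ℤ) →ₐ[ℂ] ℂ :=
  AddMonoidAlgebra.lift ℂ _ (τ → ℤ)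
    { toFun := fun a => Complex.exp (∑ k, (a.toAdd k : ℂ) * z k)
      map_one' := by simp
      map_mul' := fun a b => by
        rw [← Complex.exp_add]
        simp [add_mul, Finset.sum_add_distrib] }

lemma expEval_single {τ : Type} [Fintype τ] (z : τ → ℂ) (a : τ → ℤ) (c : ℂ) :
    expEval z (AddMonoidAlgebra.single a c) = c * Complex.exp (∑ k, (a k : ℂ) * z k) := by
  rw [expEval, AddMonoidAlgebra.lift_single]
  rfl

lemma expEval_polyToLaurent {τ : Type} [Fintype τ] [DecidableEq τ] (z : τ → ℂ)
    (g : MvPolynomial τ ℂ) :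
    expEval z (polyToLaurent τ g) = MvPolynomial.eval (fun k => Complex.exp (z k)) g := by
  rw [← MvPolynomial.coe_aeval_eq_eval]
  change ((expEval z).comp (polyToLaurent τ)) g = MvPolynomial.aeval _ g
  congr 1
  refine MvPolynomial.algHom_ext fun k => ?_
  rw [AlgHom.comp_apply, polyToLaurent, MvPolynomial.aeval_X, MvPolynomial.aeval_X,
    expEval_single]
  simp [Pi.single_apply]

variable {I ρ κ : Type} [Fintype ρ] [Fintype κ] [DecidableEq ρ] [DecidableEq κ]

/-- The points of `H'_Q` in the torus are the solutions of the defining equations. -/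
lemma forall_mem_giventalIdeal_iff {m : I → ρ → ℤ} {d : I → κ → ℤ} {Q : I → ℂ} (z : ρ ⊕ κ → ℂ) :
    (∀ g ∈ giventalIdeal m d Q, MvPolynomial.eval (fun k => Complex.exp (z k)) g = 0) ↔
      ∀ i, Complex.exp (∑ r, (m i r : ℂ) * z (Sum.inl r)) =
        Q i * Complex.exp (∑ j, (d i j : ℂ) * z (Sum.inr j)) := by
  have hval : ∀ i, expEval z (AddMonoidAlgebra.single (Sum.elim (m i) (0 : κ → ℤ)) 1 -
      AddMonoidAlgebra.single (Sum.elim (0 : ρ → ℤ) (d i)) (Q i)) =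
      Complex.exp (∑ r, (m i r : ℂ) * z (Sum.inl r)) -
        Q i * Complex.exp (∑ j, (d i j : ℂ) * z (Sum.inr j)) := fun i => by
    rw [map_sub, expEval_single, expEval_single]
    simp
  constructor
  · intro h i
    -- A monomial multiple of the Laurent binomial is a polynomial in the ideal, and the monomial
    -- does not vanish on the torus.
    obtain ⟨n, g, hg⟩ := exists_polyToLaurent_eq (AddMonoidAlgebra.single
      (Sum.elim (m i) (0 : κ → ℤ)) 1 -
      AddMonoidAlgebra.single (Sum.elim (0 : ρ → ℤ) (d i)) (Q i) : AddMonoidAlgebra ℂ (ρ ⊕ κ → ℤ))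
    have h1 := h g (by
      rw [giventalIdeal, Ideal.mem_comap]
      change polyToLaurent _ g ∈ Ideal.span _
      rw [hg]
      exact Ideal.mul_mem_left _ _ (Ideal.subset_span ⟨i, rfl⟩))
    rw [← expEval_polyToLaurent, hg, map_mul, hval, polyToLaurent_monomial, expEval_single,
      one_mul] at h1
    exact sub_eq_zero.1 ((mul_eq_zero.1 h1).resolve_left (Complex.exp_ne_zero _))
  · intro h g hg
    rw [← expEval_polyToLaurent]
    have hle : Ideal.span (Set.range fun i =>
        (AddMonoidAlgebra.single (Sum.elim (m i) (0 : κ → ℤ)) 1 -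
          AddMonoidAlgebra.single (Sum.elim (0 : ρ → ℤ) (d i)) (Q i) :
            AddMonoidAlgebra ℂ (ρ ⊕ κ → ℤ))) ≤ RingHom.ker (expEval z) := by
      rw [Ideal.span_le]
      rintro _ ⟨i, rfl⟩
      exact (hval i).trans (sub_eq_zero.2 (h i))
    exact hle hg

/-- The points of Givental's mirror in the torus form the mirror of Hori and Vafa. -/
theorem givental_torus_eq_horiVafa {ι : Type} [Fintype ι] [Fintype I] {u : ρ → ι → ℤ}
    (p : Module.Basis I ℤ (coker (Matrix.of u))) {t : I → ℂ}
    {m : I → ρ → ℤ} (hm : ∀ i r, m i r = charge u p i (Pi.single r 1)) {d : I → κ → ℤ}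
    {Q : I → ℂ} (hQ : ∀ i, Q i = Complex.exp (t i)) :
    {x : ρ ⊕ κ → ℂ | (∀ g ∈ giventalIdeal m d Q, MvPolynomial.eval x g = 0) ∧ ∀ k, x k ≠ 0} =
      (fun (z : ρ ⊕ κ → ℂ) (k : ρ ⊕ κ) => Complex.exp (-z k)) '' horiVafaLocus m d (-t) := by
  ext x
  constructor
  · rintro ⟨hx, hx0⟩
    have hlog : x = fun k => Complex.exp (Complex.log (x k)) :=
      funext fun k => (Complex.exp_log (hx0 k)).symm
    rw [hlog, forall_mem_giventalIdeal_iff] at hx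
    have hn : ∀ i, ∃ n : ℤ, ∑ r, (m i r : ℂ) * Complex.log (x (Sum.inl r)) =
        t i + ∑ j, (d i j : ℂ) * Complex.log (x (Sum.inr j)) + n * (2 * Real.pi * Complex.I) :=
      fun i => by
        have h1 := hx i
        rw [hQ, ← Complex.exp_add] at h1
        exact Complex.exp_eq_exp_iff_exists_int.1 h1
    choose n hn using hn
    -- The logarithms satisfy the equations up to `2πi n`. An integral divisor `k` with charges `n`
    -- exists because `p` is a basis of the cokernel, and shifting the logarithms by `2πi k` removes
    -- the error without changing `x`.
    obtain ⟨k, hk⟩ := Submodule.mkQ_surjective (LinearMap.range (Matrix.of u).mulVecLin)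
      (∑ i, n i • p i)
    have hk' : ∀ i, ∑ r, k r * m i r = n i := fun i => by
      classical
      simp only [hm]
      rw [← charge_eq_sum, charge, show cokerMk (Matrix.of u) k = _ from hk]
      simp [Finsupp.single_apply]
    refine ⟨fun l => -Complex.log (x l) +
      (Sum.elim k 0 : ρ ⊕ κ → ℤ) l * (2 * Real.pi * Complex.I), fun i => ?_, ?_⟩
    · have h2 : ∑ r, (k r : ℂ) * (m i r : ℂ) = n i := by exact_mod_cast hk' i
      simp only [Sum.elim_inl, Sum.elim_inr, Pi.zero_apply, Int.cast_zero, zero_mul, add_zero,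
        mul_add, mul_neg, Finset.sum_add_distrib, Finset.sum_neg_distrib, Pi.neg_apply]
      have h3 : ∑ r, (m i r : ℂ) * ((k r : ℂ) * (2 * Real.pi * Complex.I)) =
          n i * (2 * Real.pi * Complex.I) := by
        rw [← h2, Finset.sum_mul]
        exact Finset.sum_congr rfl fun r _ => by ring
      rw [h3, hn i]
      ring
    · funext l
      dsimp only
      rw [neg_add, neg_neg, Complex.exp_add, Complex.exp_log (hx0 l), ← neg_mul, ← Int.cast_neg,
        Complex.exp_int_mul_two_pi_mul_I, mul_one]
  · rintro ⟨z, hz, rfl⟩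
    refine ⟨?_, fun k => Complex.exp_ne_zero _⟩
    rw [forall_mem_giventalIdeal_iff fun k => -z k]
    intro i
    have h1 := hz i
    rw [hQ, ← Complex.exp_add]
    congr 1
    simp only [mul_neg, Finset.sum_neg_distrib, Pi.neg_apply] at h1 ⊢
    linear_combination -h1

end HoriVafa

/-! ### Extension of characters of monoids -/

section Characters

/-- Roots exist, so the unit group is divisible, hence injective over `ℤ`. For negative `n` one
takes a `|n|`-th root of the inverse. -/
lemma baer_units_of_isAlgClosed (K : Type) [Field K] [IsAlgClosed K] :
    Module.Baer ℤ (Additive Kˣ) := by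
  have : DivisibleBy (Additive Kˣ) ℤ := divisibleByOfSMulRightSurj _ _ fun {n} hn a => by
    obtain ⟨z, hz⟩ := IsAlgClosed.exists_pow_nat_eq ((a.toMul ^ n.sign : Kˣ) : K)
      (Int.natAbs_pos.2 hn)
    have hz0 : z ≠ 0 := by
      rintro rfl
      rw [zero_pow (Int.natAbs_pos.2 hn).ne'] at hz
      exact Units.ne_zero _ hz.symm
    refine ⟨Additive.ofMul (Units.mk0 z hz0), ?_⟩
    have h1 : (Units.mk0 z hz0) ^ n.natAbs = a.toMul ^ n.sign := Units.ext (by simpa using hz)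
    change n • Additive.ofMul (Units.mk0 z hz0) = a
    rw [← ofMul_zpow]
    conv_lhs => rw [← Int.sign_mul_natAbs n, mul_comm, zpow_mul, zpow_natCast, h1, ← zpow_mul]
    have h2 : n.sign * n.sign = 1 := by
      rcases hn.lt_or_gt with h | h
      · rw [Int.sign_eq_neg_one_of_neg h]; norm_num
      · rw [Int.sign_eq_one_of_pos h]; norm_num
    rw [h2, zpow_one]
    rfl
  exact Module.Baer.of_divisible _

/-- A character of a submonoid of a lattice with values in the units of an algebraically closed
field extends to the lattice. -/
theorem exists_extend_character {M K : Type} [AddCommGroup M] [Field K] [IsAlgClosed K]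
    (F : AddSubmonoid M) (h : F →+ Additive Kˣ) :
    ∃ η : M →+ Additive Kˣ, ∀ f : F, η f = h f := by
  -- The character extends uniquely to the group of differences, and then to the lattice by
  -- injectivity of the unit group.
  let H : AddSubgroup M :=
    { carrier := {x | ∃ a b : F, x = a - b}
      zero_mem' := ⟨0, 0, by simp⟩
      add_mem' := by
        rintro _ _ ⟨a, b, rfl⟩ ⟨a', b', rfl⟩
        exact ⟨a + a', b + b', by push_cast; abel⟩
      neg_mem' := by
        rintro _ ⟨a, b, rfl⟩
        exact ⟨b, a, by abel⟩ }
  choose a b hab using fun x : H => x.2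
  have key : ∀ (x : H) (c d : F), (x : M) = c - d → h (a x) - h (b x) = h c - h d := by
    intro x c d hx
    rw [sub_eq_sub_iff_add_eq_add, ← map_add, ← map_add]
    congr 1
    ext
    push_cast
    rw [← sub_eq_sub_iff_add_eq_add, ← hx, ← hab x]
  let g : H →+ Additive Kˣ := AddMonoidHom.mk' (fun x => h (a x) - h (b x)) fun x y => by
    rw [key (x + y) (a x + a y) (b x + b y) (by
      push_cast
      rw [add_sub_add_comm, ← hab x, ← hab y]), map_add, map_add, add_sub_add_comm]
  obtain ⟨η, hη⟩ := (baer_units_of_isAlgClosed K).extension_property_addMonoidHom H.subtype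
    Subtype.val_injective g
  refine ⟨η, fun f => ?_⟩
  have hf : (f : M) ∈ H := ⟨f, 0, by simp⟩
  have h1 : η f = g ⟨f, hf⟩ := DFunLike.congr_fun hη ⟨f, hf⟩
  rw [h1]
  change h (a ⟨f, hf⟩) - h (b ⟨f, hf⟩) = h f
  rw [key ⟨f, hf⟩ f 0 (by simp), map_zero, sub_zero]

end Characters

/-! ### The morphism of a toric variety to the spectrum of its regular characters -/

section Extension

variable {ι K : Type} [Field K]

/-- The exponents of the monomials that do not vanish at a point. -/
def nonvanishing {S : AddSubmonoid (ι → ℤ)} (ev : AddMonoidAlgebra ℂ S →+* K) :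
    AddSubmonoid (ι → ℤ) where
  carrier := {m | ∃ h : m ∈ S, ev (AddMonoidAlgebra.single ⟨m, h⟩ 1) ≠ 0}
  zero_mem' := ⟨zero_mem S, by
    have : AddMonoidAlgebra.single (⟨0, zero_mem S⟩ : S) (1 : ℂ) = 1 := rfl
    rw [this, map_one]; exact one_ne_zero⟩
  add_mem' := by
    rintro a b ⟨ha, h1⟩ ⟨hb, h2⟩
    refine ⟨add_mem ha hb, ?_⟩
    have : AddMonoidAlgebra.single (⟨a + b, add_mem ha hb⟩ : S) (1 : ℂ) =
        AddMonoidAlgebra.single ⟨a, ha⟩ 1 * AddMonoidAlgebra.single ⟨b, hb⟩ 1 := by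
      rw [AddMonoidAlgebra.single_mul_single, mul_one]; rfl
    rw [this, map_mul]
    exact mul_ne_zero h1 h2

/-- The nonvanishing exponents form a face of `S`, since a product in a field is nonzero only if
both factors are. -/
lemma add_mem_nonvanishing_iff {S : AddSubmonoid (ι → ℤ)} {ev : AddMonoidAlgebra ℂ S →+* K}
    {a b : ι → ℤ} (ha : a ∈ S) (hb : b ∈ S) :
    a + b ∈ nonvanishing ev ↔ a ∈ nonvanishing ev ∧ b ∈ nonvanishing ev := by
  refine ⟨?_, fun h => add_mem h.1 h.2⟩
  rintro ⟨h, hne⟩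
  have : AddMonoidAlgebra.single (⟨a + b, h⟩ : S) (1 : ℂ) =
      AddMonoidAlgebra.single ⟨a, ha⟩ 1 * AddMonoidAlgebra.single ⟨b, hb⟩ 1 := by
    rw [AddMonoidAlgebra.single_mul_single, mul_one]; rfl
  rw [this, map_mul] at hne
  exact ⟨⟨ha, left_ne_zero_of_mul hne⟩, ⟨hb, right_ne_zero_of_mul hne⟩⟩

variable [Fintype ι]

/-- A point of `Spec ℂ[S]` whose nonvanishing monomials are those on which a lattice point of the
cone `σ` vanishes extends to a point of the affine toric variety `U_σ`. -/
lemma exists_extend_point [IsAlgClosed K] {S : AddSubmonoid (ι → ℤ)}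
    (ev : AddMonoidAlgebra ℂ S →+* K) {w : ι → ℤ}
    (hw : ∀ m ∈ S, w ⬝ᵥ m = 0 ↔ m ∈ nonvanishing ev) {σ : PointedCone ℝ (ι → ℝ)}
    (hσ : toReal w ∈ σ) (hS : S ≤ dualMonoid σ) :
    ∃ ev' : chartRing σ →+* K, ev'.comp (inclAlg hS).toRingHom = ev := by
  classical
  let h₀ : ∀ m : nonvanishing ev, Kˣ := fun m => Units.mk0 _ m.2.choose_spec
  have hh₀ : ∀ (m : nonvanishing ev) (hm : (m : ι → ℤ) ∈ S),
      (h₀ m : K) = ev (AddMonoidAlgebra.single ⟨m, hm⟩ 1) := fun m hm => rfl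
  let h : nonvanishing ev →+ Additive Kˣ :=
    { toFun := fun m => Additive.ofMul (h₀ m)
      map_zero' := by
        change Additive.ofMul _ = Additive.ofMul 1
        congr 1
        ext
        rw [hh₀ 0 (zero_mem S)]
        exact map_one ev
      map_add' := fun a b => by
        change Additive.ofMul _ = Additive.ofMul (h₀ a * h₀ b)
        congr 1
        ext
        obtain ⟨a, ha, _⟩ := a
        obtain ⟨b, hb, _⟩ := b
        rw [Units.val_mul, hh₀ _ (add_mem ha hb), hh₀ _ ha, hh₀ _ hb, ← map_mul,
          AddMonoidAlgebra.single_mul_single, mul_one]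
        rfl }
  obtain ⟨η, hη⟩ := exists_extend_character (nonvanishing ev) h
  have hnn : ∀ m ∈ dualMonoid σ, 0 ≤ w ⬝ᵥ m := fun m hm => by
    have := hm _ hσ
    rw [pair_toReal, dotProduct_comm] at this
    exact_mod_cast this
  -- Extension by zero off the hyperplane `w = 0` is multiplicative because `w ≥ 0` on the dual
  -- monoid: a sum lies on the hyperplane only if both summands do.
  let g : Multiplicative (dualMonoid σ) →* K :=
    { toFun := fun m => if w ⬝ᵥ (m.toAdd : ι → ℤ) = 0 then ((η (m.toAdd : ι → ℤ)).toMul : Kˣ) else 0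
      map_one' := by simp
      map_mul' := fun a b => by
        have h1 := hnn _ a.toAdd.2
        have h2 := hnn _ b.toAdd.2
        have e : w ⬝ᵥ ((a * b).toAdd : ι → ℤ) =
            w ⬝ᵥ (a.toAdd : ι → ℤ) + w ⬝ᵥ (b.toAdd : ι → ℤ) := by
          rw [← dotProduct_add]; rfl
        have e' : η ((a * b).toAdd : ι → ℤ) = η (a.toAdd : ι → ℤ) + η (b.toAdd : ι → ℤ) := by
          rw [← map_add]; rfl
        rw [e, e']
        by_cases ha : w ⬝ᵥ (a.toAdd : ι → ℤ) = 0
        · by_cases hb : w ⬝ᵥ (b.toAdd : ι → ℤ) = 0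
          · rw [if_pos ha, if_pos hb, if_pos (by rw [ha, hb, add_zero])]
            simp
          · rw [if_neg hb, if_neg (by omega), mul_zero]
        · rw [if_neg ha, if_neg (by omega), zero_mul] }
  -- `ev` is only a ring homomorphism, so the scalars `ℂ` act on `K` through `ev`.
  let ev' : chartRing σ →+* K := AddMonoidAlgebra.liftNCRingHom
    (ev.comp (algebraMap ℂ (AddMonoidAlgebra ℂ S))) g fun _ _ => Commute.all _ _
  have hev' : ∀ m c, ev' (AddMonoidAlgebra.single m c) =
      ev (algebraMap ℂ _ c) * g (Multiplicative.ofAdd m) := fun m c =>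
    AddMonoidAlgebra.liftNC_single _ _ _ _
  refine ⟨ev', AddMonoidAlgebra.ringHom_ext (fun r => ?_) fun m => ?_⟩
  · change ev' (inclAlg hS _) = _
    rw [inclAlg_single, hev']
    have : (Multiplicative.ofAdd (⟨((0 : S) : ι → ℤ), hS (0 : S).2⟩ : dualMonoid σ)) = 1 := rfl
    rw [this, map_one, mul_one]
    rfl
  · change ev' (inclAlg hS _) = _
    rw [inclAlg_single, hev', map_one, map_one, one_mul]
    change (if w ⬝ᵥ (m : ι → ℤ) = 0 then ((η (m : ι → ℤ)).toMul : K) else 0) = _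
    split_ifs with h0
    · have hm := (hw m m.2).1 h0
      have := hη ⟨m, hm⟩
      rw [show η (m : ι → ℤ) = h ⟨m, hm⟩ from this]
      exact hh₀ ⟨m, hm⟩ m.2
    · by_contra hne
      exact h0 ((hw m m.2).2 ⟨m.2, fun h => hne h.symm⟩)

/-- A lattice vector in the cone of finitely many lattice vectors has a multiple in their semigroup. -/
lemma exists_nsmul_mem_closure {τ : Type} [Finite τ] {A : τ → ι → ℤ} {w : ι → ℤ}
    (h : toReal w ∈ coneOf (Set.range A)) :
    ∃ N : ℕ, 0 < N ∧ N • w ∈ AddSubmonoid.closure (Set.range A) := by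
  classical
  have := Fintype.ofFinite τ
  rw [← Set.image_univ] at h
  obtain ⟨c, hc, -, e⟩ := mem_coneOf_image.1 h
  -- The forms record the coordinates of the relation between `w` and the `A j`, together with each
  -- single coefficient. A lattice point with the signs of `(1, c)` is thus an integral relation
  -- with positive coefficient at `w` and nonnegative ones elsewhere.
  let form : ι ⊕ Option τ → Option τ → ℤ :=
    Sum.elim (fun i o => o.elim (-w i) fun j => A j i) fun o => Pi.single o 1
  let x : Option τ → ℝ := fun o => o.elim 1 c
  obtain ⟨n, hn⟩ := exists_int_same_sign form x
  have h1 : ∀ i, n none * w i = ∑ j, n (some j) * A j i := fun i => by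
    have h2 := (hn (Sum.inl i)).1 (by
      have h3 := congrFun e i
      simp only [toReal, Finset.sum_apply, Pi.smul_apply, smul_eq_mul] at h3
      simp only [pair, Fintype.sum_option, form, x, Sum.elim_inl, Option.elim_none,
        Option.elim_some, Int.cast_neg, h3, mul_one]
      rw [neg_add_eq_zero]
      exact Finset.sum_congr rfl fun j _ => mul_comm _ _)
    simp only [dotProduct, Fintype.sum_option, form, Sum.elim_inl, Option.elim_none,
      Option.elim_some] at h2
    have h3 : ∑ j, n (some j) * A j i = ∑ j, A j i * n (some j) :=
      Finset.sum_congr rfl fun j _ => mul_comm _ _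
    rw [h3]
    linarith
  have hcoord : ∀ o, pair (form (Sum.inr o)) x = x o := fun o => by
    simp [pair, form, Pi.single_apply]
  have hcoord' : ∀ o, form (Sum.inr o) ⬝ᵥ n = n o := fun o => by
    simp [form]
  have h2 : 0 < n none := by
    have := (hn (Sum.inr none)).2 (by rw [hcoord]; exact one_pos)
    rwa [hcoord'] at this
  have h3 : ∀ j, 0 ≤ n (some j) := fun j => by
    rcases (hc j).eq_or_lt with h0 | h0
    · have := (hn (Sum.inr (some j))).1 (by rw [hcoord]; exact h0.symm)
      rw [hcoord'] at this
      exact this.ge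
    · have := (hn (Sum.inr (some j))).2 (by rw [hcoord]; exact h0)
      rw [hcoord'] at this
      exact this.le
  refine ⟨(n none).toNat, by omega, ?_⟩
  have h4 : (n none).toNat • w = ∑ j, (n (some j)).toNat • A j := by
    ext i
    simp only [Pi.smul_apply, Finset.sum_apply]
    simp only [nsmul_eq_mul, Int.toNat_of_nonneg h2.le,
      Int.toNat_of_nonneg (h3 _)]
    exact h1 i
  rw [h4]
  exact sum_mem fun j _ => nsmul_mem (AddSubmonoid.subset_closure (Set.mem_range_self j)) _

/-- The nonvanishing monomials of a point of `Spec ℂ[S]`, `S` finitely generated, are those on which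
a suitable lattice point in the dual cone of `S` vanishes. -/
lemma exists_dual_point {τ : Type} [Finite τ] {B : τ → ι → ℤ} {S : AddSubmonoid (ι → ℤ)}
    (hS : AddSubmonoid.closure (Set.range B) = S) (ev : AddMonoidAlgebra ℂ S →+* K) :
    ∃ w : ι → ℤ, ∀ m ∈ S, 0 ≤ w ⬝ᵥ m ∧ (w ⬝ᵥ m = 0 ↔ m ∈ nonvanishing ev) := by
  classical
  have := Fintype.ofFinite τ
  have hB : ∀ k, B k ∈ S := fun k => hS ▸ AddSubmonoid.subset_closure (Set.mem_range_self k)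
  have hk : ∀ k, ∃ w : ι → ℤ, (∀ l, 0 ≤ w ⬝ᵥ B l) ∧ (∀ l, B l ∈ nonvanishing ev → w ⬝ᵥ B l = 0) ∧
      (B k ∉ nonvanishing ev → 0 < w ⬝ᵥ B k) := by
    intro k
    by_cases hkF : B k ∈ nonvanishing ev
    · exact ⟨0, fun l => by simp, fun l _ => by simp, fun h => (h hkF).elim⟩
    by_contra! hcon
    -- If no such covector exists, `-B k` lies in the cone spanned by the generators of `S` and the
    -- negatives of those in the face. Clearing denominators gives `f = s + N B k` with `f` in the
    -- face, `s ∈ S` and `N > 0`, so `B k` lies in the face, a contradiction.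
    let A : τ ⊕ {l // B l ∈ nonvanishing ev} → ι → ℤ := Sum.elim B fun l => -B l
    have hmem : toReal (-B k) ∈ coneOf (Set.range A) := by
      refine toReal_mem_coneOf_range fun x hx => ?_
      have h1 : ∀ l, 0 ≤ x ⬝ᵥ B l := fun l => by
        rw [dotProduct_comm]; exact hx (Sum.inl l)
      have h2 := hcon x h1 fun l hl => le_antisymm (by
        have := hx (Sum.inr ⟨l, hl⟩)
        simp only [A, Sum.elim_inr, neg_dotProduct] at this
        rw [dotProduct_comm]
        linarith) (h1 l)
      rw [neg_dotProduct, dotProduct_comm]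
      linarith [h2.2]
    obtain ⟨N, hN, hmem⟩ := exists_nsmul_mem_closure hmem
    have hsplit : ∀ x ∈ AddSubmonoid.closure (Set.range A),
        ∃ s ∈ S, ∃ f ∈ nonvanishing ev, x + f = s := by
      intro x hx
      induction hx using AddSubmonoid.closure_induction with
      | mem x hx =>
        obtain ⟨l | ⟨l, hl⟩, rfl⟩ := hx
        · exact ⟨_, hB l, 0, zero_mem _, add_zero _⟩
        · exact ⟨0, zero_mem _, _, hl, neg_add_cancel _⟩
      | zero => exact ⟨0, zero_mem _, 0, zero_mem _, add_zero _⟩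
      | add x y _ _ hx hy =>
        obtain ⟨s, hs, f, hf, e⟩ := hx
        obtain ⟨s', hs', f', hf', e'⟩ := hy
        exact ⟨_, add_mem hs hs', _, add_mem hf hf', by rw [← e, ← e']; abel⟩
    obtain ⟨s, hs, f, hf, e⟩ := hsplit _ hmem
    obtain ⟨N, rfl⟩ := Nat.exists_eq_add_of_lt hN
    have e' : f = (s + N • B k) + B k := by
      rw [← e, zero_add, succ_nsmul, smul_neg]
      abel
    rw [e', add_mem_nonvanishing_iff (add_mem hs (nsmul_mem (hB k) N)) (hB k)] at hf
    exact hkF hf.2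
  choose w hw0 hwF hwpos using hk
  -- The sum still vanishes on the face and is positive at every generator outside it.
  refine ⟨∑ k, w k, fun m hm => ?_⟩
  rw [← hS] at hm
  induction hm using AddSubmonoid.closure_induction with
  | mem x hx =>
    obtain ⟨l, rfl⟩ := hx
    rw [sum_dotProduct]
    refine ⟨Finset.sum_nonneg fun k _ => hw0 k l, fun h => ?_, fun h =>
      Finset.sum_eq_zero fun k _ => hwF k l h⟩
    by_contra hl
    exact (hwpos l hl).ne' ((Finset.sum_eq_zero_iff_of_nonneg fun k _ => hw0 k l).1 h l
      (Finset.mem_univ l))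
  | zero => simp [zero_mem]
  | add x y hx hy hx' hy' =>
    rw [hS] at hx hy
    rw [dotProduct_add, add_mem_nonvanishing_iff hx hy, ← hx'.2, ← hy'.2]
    exact ⟨add_nonneg hx'.1 hy'.1, by have := hx'.1; have := hy'.1; omega⟩

end Extension

namespace Fan

variable {ι : Type} [Fintype ι] (X : Fan ι)

lemma chart_toAffine (σ : X.cones) :
    X.chart σ ≫ X.toAffine =
      Spec.map (CommRingCat.ofHom (inclAlg (X.regularChars_le σ)).toRingHom) :=
  colimit.ι_desc _ _

/-- If the regular characters are finitely generated, with dual cone covered by the fan, the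
morphism to the spectrum of the regular characters is surjective. -/
theorem toAffine_surjective {τ : Type} [Finite τ] {B : τ → ι → ℤ}
    (hB : AddSubmonoid.closure (Set.range B) = X.regularChars)
    (hX : ∀ w : ι → ℤ, (∀ m ∈ X.regularChars, 0 ≤ w ⬝ᵥ m) → ∃ σ ∈ X.cones, toReal w ∈ σ) :
    Function.Surjective X.toAffine := by
  intro q
  let q' : PrimeSpectrum (AddMonoidAlgebra ℂ X.regularChars) := q
  -- All scheme points are treated at once, not only closed ones; passing to the algebraic closure
  -- allows characters to be extended.
  let K := AlgebraicClosure q'.asIdeal.ResidueField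
  let ev : AddMonoidAlgebra ℂ X.regularChars →+* K :=
    (algebraMap q'.asIdeal.ResidueField K).comp (algebraMap _ _)
  have hker : RingHom.ker ev = q'.asIdeal := by
    rw [RingHom.ker_comp_of_injective _ (algebraMap q'.asIdeal.ResidueField K).injective,
      Ideal.ker_algebraMap_residueField]
  obtain ⟨w, hw⟩ := exists_dual_point hB ev
  obtain ⟨σ, hσ, hwσ⟩ := hX w fun m hm => (hw m hm).1
  obtain ⟨ev', hev'⟩ := exists_extend_point ev (fun m hm => (hw m hm).2) hwσ
    (X.regularChars_le ⟨σ, hσ⟩)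
  let y : PrimeSpectrum (chartRing σ) := ⟨RingHom.ker ev', RingHom.ker_isPrime _⟩
  refine ⟨X.chart ⟨σ, hσ⟩ y, ?_⟩
  refine (Scheme.Hom.comp_apply (X.chart ⟨σ, hσ⟩) X.toAffine y).symm.trans ?_
  rw [chart_toAffine]
  refine PrimeSpectrum.ext ?_
  change (RingHom.ker ev').comap (inclAlg (X.regularChars_le ⟨σ, hσ⟩)).toRingHom = q'.asIdeal
  rw [RingHom.comap_ker, hev', hker]

/-- If the fan has a greatest cone, the toric variety is affine. -/
theorem isIso_toAffine {σ : PointedCone ℝ (ι → ℝ)} (hσ : σ ∈ X.cones) (h : ∀ τ ∈ X.cones, τ ≤ σ) :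
    IsIso X.toAffine := by
  -- The greatest cone is a terminal object of the gluing diagram, so the colimit is its chart. Its
  -- dual monoid is the whole semigroup of regular characters.
  have hT : IsTerminal (⟨σ, hσ⟩ : X.cones) :=
    IsTerminal.ofUniqueHom (fun τ => homOfLE (h τ.1 τ.2)) fun _ _ => Subsingleton.elim _ _
  have h1 : IsIso (X.chart ⟨σ, hσ⟩) := isIso_ι_of_isTerminal hT X.diagram
  have heq : X.regularChars = dualMonoid σ :=
    le_antisymm (X.regularChars_le ⟨σ, hσ⟩) (le_iInf fun τ => dualMonoid_anti (h τ.1 τ.2))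
  have hbij : Function.Bijective (inclAlg (X.regularChars_le ⟨σ, hσ⟩)) := by
    refine ⟨inclAlg_injective _, fun f => ⟨inclAlg heq.ge f, ?_⟩⟩
    have := DFunLike.congr_fun (inclAlg_comp heq.ge (X.regularChars_le ⟨σ, hσ⟩)) f
    rw [AlgHom.comp_apply] at this
    rw [this, inclAlg_refl]
    rfl
  have h2 : IsIso (CommRingCat.ofHom (inclAlg (X.regularChars_le ⟨σ, hσ⟩)).toRingHom) :=
    (ConcreteCategory.isIso_iff_bijective _).2 hbij
  have h3 : IsIso (X.chart ⟨σ, hσ⟩ ≫ X.toAffine) := by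
    rw [chart_toAffine]
    infer_instance
  exact IsIso.of_isIso_comp_left (X.chart ⟨σ, hσ⟩) X.toAffine

/-- The pullback of a regular function under the morphism to the spectrum of the regular
characters. -/
lemma isFunction_toAffine {R : CommRingCat.{0}}
    (φ : R ⟶ CommRingCat.of (AddMonoidAlgebra ℂ X.regularChars)) (F : R) :
    X.IsFunction ((X.toAffine ≫ Spec.map φ).appTop.hom ((Scheme.ΓSpecIso R).inv.hom F))
      (toLaurent _ (φ.hom F)) := by
  intro σ
  refine ⟨inclAlg (X.regularChars_le σ) (φ.hom F), ?_, ?_⟩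
  · have : (toLaurent (dualMonoid σ.1)).comp (inclAlg (X.regularChars_le σ)) =
        toLaurent X.regularChars := by
      ext s
      simp [inclAlg_single, toLaurent_single]
    exact DFunLike.congr_fun this _
  · have e : X.chart σ ≫ X.toAffine ≫ Spec.map φ =
        Spec.map (φ ≫ CommRingCat.ofHom (inclAlg (X.regularChars_le σ)).toRingHom) := by
      rw [← Category.assoc, chart_toAffine, Spec.map_comp]
    have h1 : (Scheme.ΓSpecIso R).inv ≫ (X.toAffine ≫ Spec.map φ).appTop ≫ (X.chart σ).appTop =
        (φ ≫ CommRingCat.ofHom (inclAlg (X.regularChars_le σ)).toRingHom) ≫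
          (Scheme.ΓSpecIso (CommRingCat.of (chartRing σ.1))).inv := by
      rw [← Scheme.Hom.comp_appTop, e, Scheme.ΓSpecIso_inv_naturality]
    exact DFunLike.congr_fun (congrArg CommRingCat.Hom.hom h1) F

end Fan

/-! ### The dual Landau-Ginzburg model -/

section Dual

variable {ι κ ρ I : Type} [Fintype ι] [Fintype κ] [Fintype I] [DecidableEq κ]
  {Y : Fan ι} {u : ρ → ι → ℤ} {D : κ → ρ → ℤ}
  {p : Module.Basis I ℤ (coker (Matrix.of u))} {t : I → ℂ} {w : κ → AddMonoidAlgebra ℂ (ι → ℤ)}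

lemma exists_term_dualData (ξ : (sectionPotential w).coeff.support) :
    ∃ j μ, (dualData u D p t w).A.mat ξ = Sum.elim μ (Pi.single j 1) :=
  exists_term_of_coeff_sectionPotential (Finsupp.mem_support_iff.1 ξ.2)

/-- The dual toric variety exists. -/
lemma exists_isVariety_dualData : ∃ X' : Fan (ι ⊕ κ), (dualData u D p t w).A.IsVariety X' := by
  let α : (sectionPotential w).coeff.support → ℝ := fun ξ =>
    imCmodZ ((Complex.log ((sectionPotential w).coeff ξ.1) / (2 * Real.pi * Complex.I) : ℂ) : CmodZ)
  have hP := interior_polyhedron_nonempty (exists_term_dualData (u := u) (D := D) (p := p) (t := t)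
    (w := w)) α
  exact ⟨polyhedralFan _ α hP, α, (imCoker_cokerClass _ _).symm, hP, rfl⟩

/-- The regular characters of the dual toric variety are generated by the terms of the dual
superpotential. -/
lemma closure_range_eq_regularChars (hs : Y.IsSmooth) (hc : Y.IsComplete) (hu : Y.IsRayEnum u)
    (hgen : ∀ j, Y.IsBasePointFree u (D j)) (hw : ∀ j, Y.IsSection u (D j) (w j))
    (hw' : ∀ j μ, Y.IsSection u (D j) (AddMonoidAlgebra.single μ 1) → (w j).coeff μ ≠ 0)
    {X' : Fan (ι ⊕ κ)} (hX : (dualData u D p t w).A.IsVariety X') :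
    AddSubmonoid.closure (Set.range (totRay u D)) = X'.regularChars := by
  obtain ⟨α, -, hP, hcones⟩ := hX
  ext m
  rw [mem_regularChars_iff hcones (hP.mono interior_subset),
    ← forall_term_nonneg_iff hs hc hu hgen hw hw']
  exact ⟨fun h ξ => h ξ.1 (Finsupp.mem_support_iff.1 ξ.2), fun h ξ hξ =>
    h ⟨ξ, Finsupp.mem_support_iff.2 hξ⟩⟩

lemma toAffine_surjective_of_isVariety
    {X' : Fan (ι ⊕ κ)} (hX : (dualData u D p t w).A.IsVariety X') [Finite ρ]
    (hgen : AddSubmonoid.closure (Set.range (totRay u D)) = X'.regularChars) :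
    Function.Surjective X'.toAffine := by
  obtain ⟨α, -, hP, hcones⟩ := hX
  exact X'.toAffine_surjective hgen fun w hw =>
    exists_cone_of_nonneg_regularChars hcones (hP.mono interior_subset) hw

/-- Vanishing of the class makes `α` the image of a real vector `x`. All inequalities are then tight
at `-x`, whose normal cone contains every other cone of the fan. -/
lemma isIso_toAffine_of_cls_eq_zero
    {X' : Fan (ι ⊕ κ)} (hX : (dualData u D p t w).A.IsVariety X')
    (h0 : (dualData u D p t w).A.cls = 0) : IsIso X'.toAffine := by
  obtain ⟨α, hα, hP, hcones⟩ := hX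
  rw [h0, map_zero] at hα
  obtain ⟨x, hx⟩ := exists_pair_eq_of_cokerClass_eq_zero hα
  obtain ⟨σ, hσ, h⟩ := exists_greatest_cone hcones (x := (-1 : ℝ) • x) fun j => by
    rw [pair_smul_right, hx]; ring
  exact X'.isIso_toAffine hσ h

lemma cls_dualData_eq_zero (hw : ∀ ξ, (sectionPotential w).coeff ξ ≠ 0 →
    (sectionPotential w).coeff ξ = 1) : (dualData u D p t w).A.cls = 0 := by
  change cokerClass _ _ = 0
  rw [← cokerClass_zero (G := CmodZ)]
  congr 1
  funext ξ
  rw [hw ξ.1 (Finsupp.mem_support_iff.1 ξ.2), Complex.log_one, zero_div]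
  rfl

/-- The section all of whose coefficients are `1`. -/
lemma exists_section_coeff_one (hs : Y.IsSmooth) (hc : Y.IsComplete) (hu : Y.IsRayEnum u) :
    ∃ w : κ → AddMonoidAlgebra ℂ (ι → ℤ), (∀ j, Y.IsSection u (D j) (w j)) ∧
      (∀ j μ, Y.IsSection u (D j) (AddMonoidAlgebra.single μ 1) → (w j).coeff μ = 1) ∧
      (dualData u D p t w).A.cls = 0 := by
  classical
  let w : κ → AddMonoidAlgebra ℂ (ι → ℤ) := fun j =>
    ∑ μ ∈ (Fan.finite_sections hs hc hu (D j)).toFinset, AddMonoidAlgebra.single μ 1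
  have hcoeff : ∀ j μ, (w j).coeff μ = if ∀ r, -D j r ≤ μ ⬝ᵥ u r then 1 else 0 := fun j μ => by
    simp [w, AddMonoidAlgebra.coeff_sum, Finsupp.finsetSum_apply, Finsupp.single_apply]
  refine ⟨w, fun j => ?_, fun j μ h => ?_, cls_dualData_eq_zero fun ξ hξ => ?_⟩
  · rw [Fan.isSection_iff hs hu]
    intro μ hμ
    rw [hcoeff] at hμ
    by_contra h
    exact hμ (if_neg h)
  · rw [hcoeff, if_pos ((Fan.isSection_single_iff hs hu).1 h)]
  · obtain ⟨j, μ, rfl⟩ := exists_term_of_coeff_sectionPotential hξ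
    rw [coeff_sectionPotential, hcoeff] at hξ ⊢
    rw [if_pos (by_contra fun h => hξ (if_neg h))]

end Dual

/-! ### Presentation of the ring of regular characters by scaled generators. -/

section Isomorphism

variable {ι τ : Type}

/-- The parametrization of the spectrum of a monoid algebra by scaled generators. -/
def scaledGenerators {S : AddSubmonoid (ι → ℤ)} {B : τ → ι → ℤ} (hB : ∀ k, B k ∈ S) (c : τ → ℂ) :
    MvPolynomial τ ℂ →ₐ[ℂ] AddMonoidAlgebra ℂ S :=
  MvPolynomial.aeval fun k => AddMonoidAlgebra.single ⟨B k, hB k⟩ (Complex.exp (c k))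

variable {S : AddSubmonoid (ι → ℤ)} {B : τ → ι → ℤ}

lemma toLaurent_scaledGenerators_X (hB : ∀ k, B k ∈ S) (c : τ → ℂ) (k : τ) :
    toLaurent S (scaledGenerators hB c (MvPolynomial.X k)) =
      AddMonoidAlgebra.single (B k) (Complex.exp (c k)) := by
  rw [scaledGenerators, MvPolynomial.aeval_X, toLaurent_single]

lemma toLaurent_comp_scaledGenerators [Fintype τ] [DecidableEq τ] (hB : ∀ k, B k ∈ S) (c : τ → ℂ) :
    (toLaurent S).comp (scaledGenerators hB c) = (monomialHom c B).comp (polyToLaurent τ) :=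
  MvPolynomial.algHom_ext fun k => by
    rw [AlgHom.comp_apply, AlgHom.comp_apply, toLaurent_scaledGenerators_X,
      monomialHom_polyToLaurent_X]

/-- Because `ℂ[S]` embeds in the Laurent polynomials, the relations can be computed there, where the
binomial description of the kernel applies. -/
lemma ker_scaledGenerators [Fintype τ] [DecidableEq τ] (hB : ∀ k, B k ∈ S) (c : τ → ℂ) :
    RingHom.ker (scaledGenerators hB c) =
      RingHom.ker ((monomialHom c B).comp (polyToLaurent τ)) := by
  rw [← toLaurent_comp_scaledGenerators hB]
  ext g
  rw [RingHom.mem_ker, RingHom.mem_ker, AlgHom.comp_apply,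
    map_eq_zero_iff _ (toLaurent_injective S)]

lemma scaledGenerators_surjective (hS : AddSubmonoid.closure (Set.range B) = S)
    (hB : ∀ k, B k ∈ S) (c : τ → ℂ) : Function.Surjective (scaledGenerators hB c) := by
  rw [← AlgHom.range_eq_top, eq_top_iff]
  have key : ∀ m (hm : m ∈ AddSubmonoid.closure (Set.range B)),
      AddMonoidAlgebra.single (⟨m, hS ▸ hm⟩ : S) (1 : ℂ) ∈ (scaledGenerators hB c).range := by
    intro m hm
    induction hm using AddSubmonoid.closure_induction with
    | mem x hx =>
      obtain ⟨k, rfl⟩ := hx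
      refine ⟨Complex.exp (-c k) • MvPolynomial.X k, ?_⟩
      change scaledGenerators hB c _ = _
      rw [map_smul, scaledGenerators, MvPolynomial.aeval_X, AddMonoidAlgebra.smul_single,
        smul_eq_mul, ← Complex.exp_add, neg_add_cancel, Complex.exp_zero]
    | zero => exact one_mem (scaledGenerators hB c).range
    | add x y hx hy hx' hy' =>
      have := mul_mem hx' hy'
      rw [AddMonoidAlgebra.single_mul_single, mul_one] at this
      exact this
  intro f _
  induction f using AddMonoidAlgebra.induction_linear with
  | zero => exact zero_mem _
  | add f g hf hg => exact add_mem (hf trivial) (hg trivial)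
  | single m z =>
    have h1 := (scaledGenerators hB c).range.smul_mem (key m (hS.symm ▸ m.2)) z
    rw [AddMonoidAlgebra.smul_single, smul_eq_mul, mul_one] at h1
    exact h1

end Isomorphism

lemma exists_iso_of_surjective {R S : Type} [CommRing R] [CommRing S] {φ : R →+* S}
    (hφ : Function.Surjective φ) {J : Ideal R} (hJ : J = RingHom.ker φ) :
    ∃ e : Spec (CommRingCat.of S) ≅ Spec (CommRingCat.of (R ⧸ J)),
      e.hom ≫ Spec.map (CommRingCat.ofHom (Ideal.Quotient.mk J)) =
        Spec.map (CommRingCat.ofHom φ) := by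
  let E := (Ideal.quotEquivOfEq hJ).trans (RingHom.quotientKerEquivOfSurjective hφ)
  have : IsIso (CommRingCat.ofHom E.toRingHom) :=
    (ConcreteCategory.isIso_iff_bijective _).2 E.bijective
  refine ⟨asIso (Spec.map (CommRingCat.ofHom E.toRingHom)), ?_⟩
  rw [asIso_hom, ← Spec.map_comp]
  rfl

end ToricMirror

end
-- The main theorem.
open ToricMirror in
theorem mainTheorem2 {ι κ ρ I : Type} [Fintype ι] [Fintype κ] [Fintype ρ] [Fintype I]
    [DecidableEq κ] [DecidableEq ρ]
    (Y : Fan ι) (hsmooth : Y.IsSmooth) (hcomplete : Y.IsComplete)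
    (u : ρ → ι → ℤ) (hu : Y.IsRayEnum u)
    (D : κ → ρ → ℤ) (hD : ∀ j r, 0 ≤ D j r) (hgen : ∀ j, Y.IsBasePointFree u (D j))
    (p : Module.Basis I ℤ (coker (Matrix.of u))) (t : I → ℂ)
    (m : I → ρ → ℤ) (hm : ∀ i r, m i r = charge u p i (Pi.single r 1))
    (d : I → κ → ℤ) (hd : ∀ i j, d i j = charge u p i (D j))
    (Q : I → ℂ) (hQ : ∀ i, Q i = Complex.exp (t i)) :
    -- the dual of the Landau-Ginzburg model of a generic section `w`
    (∀ w : κ → AddMonoidAlgebra ℂ (ι → ℤ), (∀ j, Y.IsSection u (D j) (w j)) →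
      (∀ j μ, Y.IsSection u (D j) (AddMonoidAlgebra.single μ 1) → (w j).coeff μ ≠ 0) →
      (∃ X' : Fan (ι ⊕ κ), (dualData u D p t w).A.IsVariety X') ∧
      ∀ X' : Fan (ι ⊕ κ), (dualData u D p t w).A.IsVariety X' →
        AddSubmonoid.closure (Set.range (dualData u D p t w).B.mat) = X'.regularChars ∧
        ∀ tHat : ρ → ℂ, (∀ i, ∑ r, tHat r * m i r = t i) →
          cokerClass (dualData u D p t w).B.mat (fun k => (kahlerLift κ tHat k : CmodZ)) =
            (dualData u D p t w).B.cls ∧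
          ∃ φ : MvPolynomial (ρ ⊕ κ) ℂ →ₐ[ℂ] AddMonoidAlgebra ℂ X'.regularChars,
            (∀ r, toLaurent _ (φ (MvPolynomial.X (Sum.inl r))) =
              AddMonoidAlgebra.single ((dualData u D p t w).B.mat (Sum.inl r)) (Complex.exp (tHat r))) ∧
            (∀ j, toLaurent _ (φ (MvPolynomial.X (Sum.inr j))) =
              AddMonoidAlgebra.single ((dualData u D p t w).B.mat (Sum.inr j)) 1) ∧
            (∃ e : Spec (CommRingCat.of (AddMonoidAlgebra ℂ X'.regularChars)) ≅
                giventalVariety m d Q,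
              e.hom ≫ giventalInclusion m d Q = Spec.map (CommRingCat.ofHom φ.toRingHom)) ∧
            toLaurent _ (φ (giventalF ρ κ)) =
              potential (dualData u D p t w).B.mat (kahlerLift κ tHat) ∧
            ∃ f : X'.toricVariety ⟶ complexSpace (ρ ⊕ κ),
              f = X'.toAffine ≫ Spec.map (CommRingCat.ofHom φ.toRingHom) ∧
              Set.range f = Set.range (giventalInclusion m d Q) ∧
              X'.IsFunction (f.appTop.hom ((Scheme.ΓSpecIso _).inv.hom (giventalF ρ κ)))
                (potential (dualData u D p t w).B.mat (kahlerLift κ tHat)) ∧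
              ((dualData u D p t w).A.cls = 0 →
                ∃ e : X'.toricVariety ≅ giventalVariety m d Q,
                  e.hom ≫ giventalInclusion m d Q = f)) ∧
    -- the section `w_GHV`, all of whose coefficients are `1`, has `K' = L = 0`
    (∃ w : κ → AddMonoidAlgebra ℂ (ι → ℤ), (∀ j, Y.IsSection u (D j) (w j)) ∧
      (∀ j μ, Y.IsSection u (D j) (AddMonoidAlgebra.single μ 1) → (w j).coeff μ = 1) ∧
      (dualData u D p t w).A.cls = 0) ∧
    -- the mirror of Hori and Vafa is that of Givental, in logarithmic coordinates
    {x : ρ ⊕ κ → ℂ | (∀ g ∈ giventalIdeal m d Q, MvPolynomial.eval x g = 0) ∧ ∀ k, x k ≠ 0} =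
      (fun (z : ρ ⊕ κ → ℂ) (k : ρ ⊕ κ) => Complex.exp (-z k)) '' horiVafaLocus m d (-t) := by
  refine ⟨fun w hw hw' => ⟨exists_isVariety_dualData, fun X' hX => ?_⟩,
    exists_section_coeff_one hsmooth hcomplete hu, givental_torus_eq_horiVafa p hm hQ⟩
  have hcl := closure_range_eq_regularChars hsmooth hcomplete hu hgen hw hw' hX
  have hB : ∀ k, totRay u D k ∈ X'.regularChars := fun k =>
    hcl ▸ AddSubmonoid.subset_closure (Set.mem_range_self k)
  refine ⟨hcl, fun tHat htHat => ⟨cokerClass_kahlerLift p hm htHat, ?_⟩⟩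
  obtain ⟨e, he⟩ : ∃ e : Spec (CommRingCat.of (AddMonoidAlgebra ℂ X'.regularChars)) ≅
      giventalVariety m d Q, e.hom ≫ giventalInclusion m d Q = Spec.map (CommRingCat.ofHom
        (scaledGenerators hB (Sum.elim tHat 0 : ρ ⊕ κ → ℂ)).toRingHom) :=
    exists_iso_of_surjective (scaledGenerators_surjective hcl hB _)
    ((giventalIdeal_eq_ker p hm hQ htHat hd).trans (ker_scaledGenerators hB _).symm)
  have hF : toLaurent _ (scaledGenerators hB (Sum.elim tHat 0 : ρ ⊕ κ → ℂ) (giventalF ρ κ)) =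
      potential (dualData u D p t w).B.mat (kahlerLift κ tHat) := by
    rw [potential_kahlerLift, giventalF, map_sum, map_sum]
    exact Finset.sum_congr rfl fun k _ => toLaurent_scaledGenerators_X hB _ k
  have hcomp : X'.toAffine ≫ Spec.map (CommRingCat.ofHom
      (scaledGenerators hB (Sum.elim tHat 0 : ρ ⊕ κ → ℂ)).toRingHom) =
      (X'.toAffine ≫ e.hom) ≫ giventalInclusion m d Q := by
    rw [Category.assoc, he]
  refine ⟨scaledGenerators hB (Sum.elim tHat 0), fun r => toLaurent_scaledGenerators_X hB _ _,
    fun j => ?_, ⟨e, he⟩, hF, _, rfl, ?_, ?_, fun h0 => ?_⟩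
  · rw [toLaurent_scaledGenerators_X, Sum.elim_inr, Pi.zero_apply, Complex.exp_zero]
    rfl
  · rw [hcomp]
    -- The map factors as a surjection onto `H'_Q` followed by its inclusion, so its image is all of
    -- `H'_Q` and not merely dense in it.
    have hsurj : Function.Surjective (X'.toAffine ≫ e.hom) := by
      have h1 := toAffine_surjective_of_isVariety hX hcl
      have h2 : Function.Surjective e.hom := e.hom.homeomorph.surjective
      rw [Scheme.Hom.comp_base, TopCat.coe_comp]
      exact h2.comp h1
    rw [Scheme.Hom.comp_base, TopCat.coe_comp]
    exact hsurj.range_comp _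
  · rw [← hF]
    exact X'.isFunction_toAffine (CommRingCat.ofHom
      (scaledGenerators hB (Sum.elim tHat 0 : ρ ⊕ κ → ℂ)).toRingHom) (giventalF ρ κ)
  · have := isIso_toAffine_of_cls_eq_zero hX h0
    exact ⟨asIso X'.toAffine ≪≫ e, hcomp.symm⟩
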